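/- For $n\ge1$ let $(X^{(n)},Y^{(n)})$ be a random vector with $X^{(n)}\in\mathbb N$, $Y^{(n)}\in\mathbb R$, converging in law to $(X,Y)$, where $X$ is $\mathbb N$-valued and not a.s. constant. Assume that $X$ and all the $X^{(n)}$ have span $1$, the span of $Z$ being $\sup\{m\in\mathbb N:\exists b\in\mathbb N,\ \mathrm{Supp}(Z)\subset m\mathbb N+b\}$. For a real random variable $Z$ put $\psi_Z(s)=\log\mathbb E[e^{sZ}]$ and $\mathrm{dom}\,\psi_Z=\{s\in\mathbb R:\mathbb E[e^{sZ}]<\infty\}$, and let $R_Z$ be the interior of the range of $\psi_Z'$ (taken on the interior of $\mathrm{dom}\,\psi_Z$). Let $p,q,p_n,q_n$ ($n\ge1$) be positive integers with $p/q\in R_X$, $p_n/q_n\in R_{X^{(n)}}$ and $p_n/q_n\to p/q$. Let $(X^{(n)}_i,Y^{(n)}_i)_{1\le i\le nq_n}$ be i.i.d. copies of $(X^{(n)},Y^{(n)})$, $S_n=\sum_{i=1}^{nq_n}X_i^{(n)}$, $T_n=\sum_{i=1}^{nq_n}Y_i^{(n)}$, and assume $\mathbb P(S_n=np_n)>0$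 for all $n\ge1$. Let $\tau$ and $\tau_n$ be the unique points in the interiors of $\mathrm{dom}\,\psi_X$ and $\mathrm{dom}\,\psi_{X^{(n)}}$ with $\psi_X'(\tau)=p/q$ and $\psi_{X^{(n)}}'(\tau_n)=p_n/q_n$. For $\xi$ in the interior of $\mathrm{dom}\,\psi_X$ let $(\check X_\xi,\check Y_\xi)$ have the law with density $e^{\xi X-\psi_X(\xi)}$ with respect to the law of $(X,Y)$, that is, $\mathbb P(\check X_\xi=k,\check Y_\xi\in A)=e^{k\xi-\psi_X(\xi)}\,\mathbb P(X=k,Y\in A)$; define $(\check X^{(n)}_\xi,\check Y^{(n)}_\xi)$ in the same way from $(X^{(n)},Y^{(n)})$. Let $\alpha_\tau^2$ be the variance of the residual $$(\check Y_\tau-\mathbb E\check Y_\tau)-\frac{\mathrm{cov}(\check X_\tau,\check Y_\tau)}{\mathrm{var}(\check X_\tau)}\,(\check X_\tau-\mathbb E\check X_\tau).$$ Assume: 1. there is $r_0>0$ such that $B_0:=\,]-r_0,r_0[\ \subset\mathrm{dom}\,\psi_Y\cap\bigcap_{n\ge1}\mathrm{dom}\,\psi_{Y^{(n)}}$; 2.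 there is $r>0$ such that $I_\tau:=[\tau-r,\tau+r]\subset\mathrm{dom}\,\psi_X\cap\bigcap_{n\ge1}\mathrm{dom}\,\psi_{X^{(n)}}$, $$\forall s\in I_\tau,\quad \sup_{t\in\mathbb R}\left|\mathbb E[e^{(it+s)X^{(n)}}]-\mathbb E[e^{(it+s)X}]\right|\to0,$$ $$\sup_{n\ge1}\ \sup_{(s,v)\in I_\tau\times B_0}\mathbb E\left[e^{sX^{(n)}+v(Y^{(n)}-\mathbb E\check Y^{(n)}_{\tau_n})}\right]<\infty;$$ 3. $(a_n)_{n\ge1}$ is a decreasing sequence of positive reals with $a_n\to0$ and $na_nq_n\to+\infty$. Then the law $R_n$ of $\sqrt{\frac{a_n}{nq_n}}\,\bigl(T_n-nq_n\,\mathbb E(\check Y^{(n)}_{\tau_n})\bigr)$ conditioned on the event $\{S_n=np_n\}$ satisfies a large deviation principle with speed $a_n$ and good rate function $J(y)=\frac{y^2}{2\alpha_\tau^2}$ (if $\alpha_\tau^2=0$, this is read as $J(0)=0$ and $J(y)=+\infty$ for $y\ne0$). That is, $J$ is lower semicontinuous with compact level sets, and for every Borel set $A\subset\mathbb R$ $$-\inf_{\mathrm{int}A}J\le\liminf_{n\to\infty}a_n\log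 R_n(A)\le\limsup_{n\to\infty}a_n\log R_n(A)\le-\inf_{\mathrm{clo}A}J.$$ -/

import Mathlib

open MeasureTheory ProbabilityTheory Filter Topology Set
open scoped ENNReal

namespace ConditionedSums

noncomputable section

/-! ### Large deviation principles -/

/-- The sequence of measures `(R n)` on `U` satisfies a large deviation principle with rate
function `I` and speed `(a n)`. -/
structure SatisfiesLDP {U : Type*} [TopologicalSpace U] [MeasurableSpace U]
    (R : ℕ → Measure U) (I : U → ℝ≥0∞) (a : ℕ → ℝ) : Prop where
  lowerSemicontinuous : LowerSemicontinuous I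
  lower_bound : ∀ A : Set U, MeasurableSet A →
    -(((⨅ x ∈ interior A, I x : ℝ≥0∞)) : EReal) ≤
      liminf (fun n => (a n : EReal) * ENNReal.log (R n A)) atTop
  upper_bound : ∀ A : Set U, MeasurableSet A →
    limsup (fun n => (a n : EReal) * ENNReal.log (R n A)) atTop ≤
      -(((⨅ x ∈ closure A, I x : ℝ≥0∞)) : EReal)

/-- A rate function is good if its level sets are compact. -/
def IsGoodRate {U : Type*} [TopologicalSpace U] (I : U → ℝ≥0∞) : Prop :=
  ∀ c : ℝ, 0 ≤ c → IsCompact {x | I x ≤ ENNReal.ofReal c}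

/-! ### The two coordinates of a random vector in `ℕ × ℝ`

A random vector `(X, Y)` with `X` integer valued is given by its law, a probability measure `μ` on
`ℕ × ℝ`; under `μ` the two coordinates `coordX`, `coordY` have the joint law of `(X, Y)`. -/

/-- The first coordinate, as a real random variable. -/
def coordX (w : ℕ × ℝ) : ℝ := (w.1 : ℝ)

/-- The second coordinate. -/
def coordY (w : ℕ × ℝ) : ℝ := w.2

/-- The span of `X`: the supremum (possibly infinite) of the `m` such that the support of `X` is
contained in `m ℕ + b` for some `b ∈ ℕ`. -/
def spanX (μ : Measure (ℕ × ℝ)) : ℕ∞ :=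
  ⨆ m ∈ {m : ℕ | ∃ b : ℕ, ∀ k : ℕ, μ {w | w.1 = k} ≠ 0 → ∃ j : ℕ, k = m * j + b}, (m : ℕ∞)

/-- The domain of the cumulant generating function of `X`. -/
def domX (μ : Measure (ℕ × ℝ)) : Set ℝ := integrableExpSet coordX μ

/-- The domain of the cumulant generating function of `Y`. -/
def domY (μ : Measure (ℕ × ℝ)) : Set ℝ := integrableExpSet coordY μ

/-- The derivative of the cumulant generating function `ψ_X`. -/
def psiX' (μ : Measure (ℕ × ℝ)) : ℝ → ℝ := deriv (cgf coordX μ)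

/-- `R_X`, the interior of the range of `ψ_X'`. -/
def rangeX (μ : Measure (ℕ × ℝ)) : Set ℝ := interior (psiX' μ '' interior (domX μ))

/-- The law of the tilted vector `(X̌_ξ, Y̌_ξ)`: density `exp (ξ X - ψ_X(ξ))` with respect to the
law `μ` of `(X, Y)`. -/
def tiltX (μ : Measure (ℕ × ℝ)) (ξ : ℝ) : Measure (ℕ × ℝ) :=
  μ.tilted (fun w => ξ * coordX w)

/-- `E(Y̌_ξ)`. -/
def tiltedMeanY (μ : Measure (ℕ × ℝ)) (ξ : ℝ) : ℝ := ∫ w, coordY w ∂(tiltX μ ξ)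

/-- `E(X̌_ξ)`. -/
def tiltedMeanX (μ : Measure (ℕ × ℝ)) (ξ : ℝ) : ℝ := ∫ w, coordX w ∂(tiltX μ ξ)

/-- The residual of the linear regression of `Y̌_ξ` on `X̌_ξ`. -/
def residual (μ : Measure (ℕ × ℝ)) (ξ : ℝ) (w : ℕ × ℝ) : ℝ :=
  (coordY w - tiltedMeanY μ ξ)
    - covariance coordX coordY (tiltX μ ξ) / variance coordX (tiltX μ ξ)
      * (coordX w - tiltedMeanX μ ξ)

/-- `α_ξ²`, the variance of the residual of the linear regression of `Y̌_ξ` on `X̌_ξ`. -/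
def alphaSq (μ : Measure (ℕ × ℝ)) (ξ : ℝ) : ℝ := variance (residual μ ξ) (tiltX μ ξ)

/-- `E[exp ((i t + s) X)]`. -/
def laplaceX (μ : Measure (ℕ × ℝ)) (s t : ℝ) : ℂ :=
  ∫ w, Complex.exp ((Complex.I * t + s) * coordX w) ∂μ

/-- The quadratic rate function `y² / (2 α²)`, with values in `[0, ∞]`. The division is that of
`[0, ∞]`, so for `α² = 0` the function is `0` at `y = 0` and `∞` elsewhere. -/
def quadraticRate (α2 : ℝ) (y : ℝ) : ℝ≥0∞ := ENNReal.ofReal (y ^ 2) / ENNReal.ofReal (2 * α2)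

/-- The sum of the integer-valued coordinates of a finite family of random vectors. -/
def sumX {Ω : Type*} {N : ℕ} (W : Fin N → Ω → ℕ × ℝ) (ω : Ω) : ℕ := ∑ i, (W i ω).1

/-- The sum of the real coordinates of a finite family of random vectors. -/
def sumY {Ω : Type*} {N : ℕ} (W : Fin N → Ω → ℕ × ℝ) (ω : Ω) : ℝ := ∑ i, (W i ω).2

end

end ConditionedSums

/-! Write `N = n q_n`, `ρ_n = p_n / q_n`, `m_n` for the mean of `Y` under the law tilted by `τ_n`,
and `L_n(s, v) = E[exp (s X + v Y)]`. By Gärtner–Ellis it suffices that the conditioned and rescaled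
sum `Z_n` satisfies `a_n log E[exp (u Z_n / a_n) | S_n = n p_n] → α² u² / 2` for every real `u`.
This limit is everywhere differentiable, even when `α² = 0`, and its Legendre transform is the
claimed rate (`satisfiesLDP_of_quadratic`). Since `u Z_n / a_n = v_n (T_n - N m_n)` with `v_n = u /
√(a_n N)`, and `v_n → 0`, only exponential moments near the origin in `v` matter.

Fourier inversion (`two_pi_mul_setIntegral_exp_sumY`) writes `E[exp (v T_n); S_n = n p_n]` as
`L_n(s, v)^N`, up to explicit factors, times the integral over `[-π, π]` of the `N`-th power of the
characteristic function of `X - ρ_n` under the law tilted by `(s, v)`. The parameter `s` is free. It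
is chosen as a saddle point `s = τ_n + h_n`, which keeps the tilted mean of `X` equal to `ρ_n`
(`exists_saddle_point`). For the probability of the conditioning event, `v = 0` and `s = τ_n`. A
local limit theorem, uniform in `n` (`tendsto_sqrt_mul_integral_charX`), gives both integrals the
same asymptotics, so their ratio tends to one.

What remains is `N (log L_n(τ_n + h_n, v_n) - log L_n(τ_n, 0) - h_n ρ_n - v_n m_n)`. To second order
this is `N / 2` times the minimum over `h` of `A h² + 2 B h v_n + D v_n²`, where `A`, `B`, `D` are
the tilted variances and covariance. The minimum is `(D - B² / A) v_n² = α² v_n²`, and `N v_n² = u²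
/ a_n`.

All limits in `n` rest on one exponential moment bound, for `exp (b X + β |Y|)` with `b > τ` and `β
> 0`. It upgrades weak convergence to convergence of tilted means, covariances and atoms. -/

namespace ConditionedSums

noncomputable section

/-! ### Exponential weights and weak convergence -/

/-- The norm-like function `X + |Y|` on `ℕ × ℝ`. -/
def size (w : ℕ × ℝ) : ℝ := coordX w + |coordY w|

@[fun_prop] lemma continuous_coordX : Continuous coordX := by
  unfold coordX; exact continuous_of_discreteTopology.comp continuous_fst

@[fun_prop] lemma continuous_coordY : Continuous coordY := continuous_snd

@[fun_prop] lemma continuous_size : Continuous size := by unfold size; fun_prop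

@[fun_prop] lemma measurable_coordX : Measurable coordX := continuous_coordX.measurable

@[fun_prop] lemma measurable_coordY : Measurable coordY := continuous_coordY.measurable

lemma coordX_nonneg (w : ℕ × ℝ) : 0 ≤ coordX w := Nat.cast_nonneg _

lemma size_nonneg (w : ℕ × ℝ) : 0 ≤ size w := add_nonneg (coordX_nonneg w) (abs_nonneg _)

lemma isCompact_size_le (R : ℝ) : IsCompact {w | size w ≤ R} := by
  have h : IsCompact ((Iic ⌊R⌋₊ : Set ℕ) ×ˢ Icc (-R) R) :=
    (finite_Iic _).isCompact.prod isCompact_Icc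
  refine h.of_isClosed_subset (isClosed_le continuous_size continuous_const) ?_
  intro w hw
  have hw' : (w.1 : ℝ) + |w.2| ≤ R := hw
  have h1 : (0 : ℝ) ≤ w.1 := Nat.cast_nonneg _
  have h2 := abs_nonneg w.2
  refine ⟨Nat.le_floor (by linarith), ?_⟩
  exact abs_le.1 (by linarith)

/-- A continuous cutoff function, equal to one on `{size ≤ R}` and zero off `{size ≤ R + 1}`. -/
def cutoff (R : ℝ) (w : ℕ × ℝ) : ℝ := max 0 (min 1 (R + 1 - size w))

@[fun_prop] lemma continuous_cutoff (R : ℝ) : Continuous (cutoff R) := by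
  unfold cutoff; fun_prop

lemma cutoff_nonneg (R : ℝ) (w : ℕ × ℝ) : 0 ≤ cutoff R w := le_max_left _ _

lemma cutoff_le_one (R : ℝ) (w : ℕ × ℝ) : cutoff R w ≤ 1 :=
  max_le zero_le_one (min_le_left _ _)

lemma cutoff_eq_one {R : ℝ} {w : ℕ × ℝ} (h : size w ≤ R) : cutoff R w = 1 := by
  unfold cutoff
  rw [min_eq_left (by linarith), max_eq_right zero_le_one]

lemma cutoff_eq_zero {R : ℝ} {w : ℕ × ℝ} (h : R + 1 ≤ size w) : cutoff R w = 0 := by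
  unfold cutoff
  exact max_eq_left ((min_le_right _ _).trans (by linarith))

/-- The exponential weight `exp (b X + β |Y|)`. -/
def expWeight (b β : ℝ) (w : ℕ × ℝ) : ℝ := Real.exp (b * coordX w + β * |coordY w|)

@[fun_prop] lemma continuous_expWeight (b β : ℝ) : Continuous (expWeight b β) := by
  unfold expWeight; fun_prop

lemma expWeight_pos (b β : ℝ) (w : ℕ × ℝ) : 0 < expWeight b β w := Real.exp_pos _

/-- Lowering both rates by `η` gains a factor decaying in the size; every tail estimate below comes
from this. -/
lemma expWeight_sub (b β η : ℝ) (w : ℕ × ℝ) :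
    expWeight (b - η) (β - η) w = expWeight b β w * Real.exp (-η * size w) := by
  unfold expWeight size
  rw [← Real.exp_add]; congr 1; ring

/-- Tail control: a function dominated by a slightly smaller exponential weight is integrable, and
its integral is well approximated by that of its truncations. -/
lemma integrable_and_abs_integral_sub_cutoff_le {ν : Measure (ℕ × ℝ)} [IsProbabilityMeasure ν]
    {b β C D η : ℝ} (hC0 : 0 ≤ C) (hη : 0 ≤ η)
    (hC : ∫⁻ w, ENNReal.ofReal (expWeight b β w) ∂ν ≤ ENNReal.ofReal C)
    {F : ℕ × ℝ → ℝ} (hF : AEStronglyMeasurable F ν)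
    (hdom : ∀ w, |F w| ≤ D * expWeight (b - η) (β - η) w) :
    Integrable F ν ∧ ∀ R, 0 ≤ R →
      |∫ w, F w ∂ν - ∫ w, cutoff R w * F w ∂ν| ≤ D * Real.exp (-η * R) * C := by
  have hD : 0 ≤ D := by
    have := (abs_nonneg _).trans (hdom (0, 0))
    exact nonneg_of_mul_nonneg_left this (expWeight_pos _ _ _)
  have hGint : Integrable (expWeight b β) ν := by
    refine ⟨(continuous_expWeight b β).aestronglyMeasurable, ?_⟩
    rw [hasFiniteIntegral_iff_ofReal (ae_of_all _ fun w => (expWeight_pos b β w).le)]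
    exact hC.trans_lt ENNReal.ofReal_lt_top
  have hGle : ∫ w, expWeight b β w ∂ν ≤ C := by
    rw [integral_eq_lintegral_of_nonneg_ae (ae_of_all _ fun w => (expWeight_pos b β w).le)
      (continuous_expWeight b β).aestronglyMeasurable]
    exact ENNReal.toReal_le_of_le_ofReal hC0 hC
  have hle : ∀ w, |F w| ≤ D * expWeight b β w := fun w => by
    refine (hdom w).trans (mul_le_mul_of_nonneg_left ?_ hD)
    rw [expWeight_sub]
    refine mul_le_of_le_one_right (expWeight_pos _ _ _).le (Real.exp_le_one_iff.2 ?_)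
    nlinarith [size_nonneg w]
  have hFint : Integrable F ν :=
    (hGint.const_mul D).mono' hF (ae_of_all _ fun w => by simpa using hle w)
  refine ⟨hFint, fun R hR => ?_⟩
  have hcF : Integrable (fun w => cutoff R w * F w) ν :=
    hFint.mono ((continuous_cutoff R).aestronglyMeasurable.mul hF) (ae_of_all _ fun w => by
      rw [norm_mul]
      refine mul_le_of_le_one_left (norm_nonneg _) ?_
      rw [Real.norm_of_nonneg (cutoff_nonneg R w)]
      exact cutoff_le_one R w)
  rw [← integral_sub hFint hcF]
  -- The truncation changes nothing on `size ≤ R`; beyond it, the spare rate `η` supplies the factor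
  -- `exp (-η R)`.
  have key : ∀ w, ‖F w - cutoff R w * F w‖ ≤ D * Real.exp (-η * R) * expWeight b β w := by
    intro w
    have hpos : 0 ≤ D * Real.exp (-η * R) * expWeight b β w := by
      have := expWeight_pos b β w
      positivity
    rcases le_total (size w) R with h | h
    · simpa [cutoff_eq_one h] using hpos
    · have h1 : F w - cutoff R w * F w = (1 - cutoff R w) * F w := by ring
      rw [h1, norm_mul, Real.norm_of_nonneg (by linarith [cutoff_le_one R w]), Real.norm_eq_abs]
      calc (1 - cutoff R w) * |F w| ≤ 1 * |F w| := by
            gcongr; linarith [cutoff_nonneg R w]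
        _ ≤ D * (expWeight b β w * Real.exp (-η * size w)) := by
            rw [one_mul, ← expWeight_sub]; exact hdom w
        _ ≤ D * (expWeight b β w * Real.exp (-η * R)) := by
            have := (expWeight_pos b β w).le
            gcongr D * (_ * Real.exp ?_)
            nlinarith
        _ = _ := by ring
  calc |∫ w, (F w - cutoff R w * F w) ∂ν|
      ≤ ∫ w, D * Real.exp (-η * R) * expWeight b β w ∂ν := by
        rw [← Real.norm_eq_abs]
        exact norm_integral_le_of_norm_le (hGint.const_mul _) (ae_of_all _ key)
    _ ≤ _ := by
        rw [integral_const_mul]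
        gcongr

lemma tendsto_integral_of_hasCompactSupport {ι : Type*} {l : Filter ι}
    {μn : ι → ProbabilityMeasure (ℕ × ℝ)} {μ : ProbabilityMeasure (ℕ × ℝ)}
    (hlaw : Tendsto μn l (𝓝 μ)) {f : ℕ × ℝ → ℝ} (hf : Continuous f) {R : ℝ}
    (hR : ∀ w, R ≤ size w → f w = 0) :
    Tendsto (fun n => ∫ w, f w ∂(μn n : Measure (ℕ × ℝ))) l
      (𝓝 (∫ w, f w ∂(μ : Measure (ℕ × ℝ)))) := by
  have hsupp : HasCompactSupport f := by
    refine HasCompactSupport.intro (isCompact_size_le R) fun w hw => hR w ?_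
    exact (not_le.1 hw).le
  obtain ⟨C, hC⟩ := hsupp.exists_bound_of_continuous hf
  exact (ProbabilityMeasure.tendsto_iff_forall_integral_tendsto.1 hlaw)
    (BoundedContinuousFunction.ofNormedAddCommGroup f hf C hC)

/-- A Fatou property: truncations of `G` are continuous with compact support, so the bound passes to
the limit law for each of them, and monotone convergence removes the cutoff. Lower integrals avoid
presupposing integrability under `μ`. -/
lemma lintegral_le_of_tendsto {ι : Type*} {l : Filter ι} [l.NeBot]
    {μn : ι → ProbabilityMeasure (ℕ × ℝ)} {μ : ProbabilityMeasure (ℕ × ℝ)}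
    (hlaw : Tendsto μn l (𝓝 μ)) {G : ℕ × ℝ → ℝ} (hG : Continuous G) (hG0 : ∀ w, 0 ≤ G w)
    {C : ℝ} (hC0 : 0 ≤ C)
    (hC : ∀ᶠ n in l, ∫⁻ w, ENNReal.ofReal (G w) ∂(μn n : Measure (ℕ × ℝ)) ≤ ENNReal.ofReal C) :
    ∫⁻ w, ENNReal.ofReal (G w) ∂(μ : Measure (ℕ × ℝ)) ≤ ENNReal.ofReal C := by
  have hcut : ∀ N : ℕ, ∫ w, cutoff N w * G w ∂(μ : Measure (ℕ × ℝ)) ≤ C := by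
    intro N
    refine le_of_tendsto (tendsto_integral_of_hasCompactSupport hlaw
      (f := fun w => cutoff N w * G w) (by fun_prop) (R := N + 1)
      (fun w hw => by simp [cutoff_eq_zero hw])) ?_
    filter_upwards [hC] with n hn
    rw [integral_eq_lintegral_of_nonneg_ae
      (ae_of_all _ fun w => mul_nonneg (cutoff_nonneg _ _) (hG0 w))
      (by fun_prop)]
    refine ENNReal.toReal_le_of_le_ofReal hC0 (le_trans (lintegral_mono fun w => ?_) hn)
    exact ENNReal.ofReal_le_ofReal (mul_le_of_le_one_left (hG0 w) (cutoff_le_one _ _))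
  have hmono : ∀ w, Monotone fun N : ℕ => ENNReal.ofReal (cutoff N w * G w) := by
    intro w M N hMN
    have hMN' : (M : ℝ) ≤ N := by exact_mod_cast hMN
    refine ENNReal.ofReal_le_ofReal (mul_le_mul_of_nonneg_right ?_ (hG0 w))
    unfold cutoff
    gcongr
  have hlim : ∀ w, Tendsto (fun N : ℕ => ENNReal.ofReal (cutoff N w * G w)) atTop
      (𝓝 (ENNReal.ofReal (G w))) := by
    intro w
    refine tendsto_const_nhds.congr' ?_
    filter_upwards [eventually_ge_atTop ⌈size w⌉₊] with N hN
    rw [cutoff_eq_one ((Nat.le_ceil _).trans (by exact_mod_cast hN)), one_mul]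
  refine le_of_tendsto (lintegral_tendsto_of_tendsto_of_monotone
    (fun N => by fun_prop) (ae_of_all _ hmono) (ae_of_all _ hlim)) (Eventually.of_forall fun N => ?_)
  have hint : Integrable (fun w => cutoff N w * G w) (μ : Measure (ℕ × ℝ)) := by
    have hc : Continuous fun w => cutoff N w * G w := by fun_prop
    refine hc.integrable_of_hasCompactSupport ?_
    refine HasCompactSupport.intro (isCompact_size_le (N + 1)) fun w hw => ?_
    simp [cutoff_eq_zero (not_le.1 hw).le]
  rw [← ofReal_integral_eq_lintegral_ofReal hint
    (ae_of_all _ fun w => mul_nonneg (cutoff_nonneg _ _) (hG0 w))]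
  exact ENNReal.ofReal_le_ofReal (hcut N)

/-- Convergence of integrals of locally uniformly convergent functions dominated by an exponential
weight, along a weakly convergent family of laws with a bounded exponential moment. -/
theorem tendsto_integral_of_expWeight_bound {ι : Type*} {l : Filter ι}
    {μn : ι → ProbabilityMeasure (ℕ × ℝ)} {μ : ProbabilityMeasure (ℕ × ℝ)}
    (hlaw : Tendsto μn l (𝓝 μ)) {b β C D η : ℝ} (hC0 : 0 ≤ C) (hη : 0 < η)
    (hC : ∀ᶠ n in l,
      ∫⁻ w, ENNReal.ofReal (expWeight b β w) ∂(μn n : Measure (ℕ × ℝ)) ≤ ENNReal.ofReal C)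
    {F : ι → ℕ × ℝ → ℝ} {F0 : ℕ × ℝ → ℝ} (hF : ∀ n, Continuous (F n)) (hF0 : Continuous F0)
    (hunif : ∀ R, TendstoUniformlyOn F F0 l {w | size w ≤ R})
    (hdom : ∀ᶠ n in l, ∀ w, |F n w| ≤ D * expWeight (b - η) (β - η) w) :
    Tendsto (fun n => ∫ w, F n w ∂(μn n : Measure (ℕ × ℝ))) l
      (𝓝 (∫ w, F0 w ∂(μ : Measure (ℕ × ℝ)))) := by
  rcases l.eq_or_neBot with rfl | hne
  · exact tendsto_bot
  have hdom0 : ∀ w, |F0 w| ≤ D * expWeight (b - η) (β - η) w := by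
    intro w
    have h1 : Tendsto (fun n => F n w) l (𝓝 (F0 w)) :=
      (hunif (size w)).tendsto_at (x := w) (by simp)
    exact le_of_tendsto h1.abs (hdom.mono fun n hn => hn w)
  have hD : 0 ≤ D := nonneg_of_mul_nonneg_left ((abs_nonneg _).trans (hdom0 (0, 0)))
    (expWeight_pos _ _ _)
  have hCμ := lintegral_le_of_tendsto hlaw (continuous_expWeight b β)
    (fun w => (expWeight_pos b β w).le) hC0 hC
  rw [Metric.tendsto_nhds]
  intro ε hε
  have htail : Tendsto (fun R : ℝ => D * Real.exp (-η * R) * C) atTop (𝓝 0) := by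
    have h1 : Tendsto (fun R : ℝ => Real.exp (-η * R)) atTop (𝓝 0) :=
      Real.tendsto_exp_atBot.comp (tendsto_id.const_mul_atTop_of_neg (by linarith))
    simpa using (h1.const_mul D).mul_const C
  -- Four errors of `ε / 4`: the tails beyond `R` under `μn n` and under `μ`, the uniform distance
  -- from `F n` to `F0` on `size ≤ R + 1`, and weak convergence for the truncated `F0`.
  obtain ⟨R, hRε, hR0⟩ := ((htail.eventually (gt_mem_nhds (show (0 : ℝ) < ε / 4 by linarith))).and
    (eventually_ge_atTop 0)).exists
  have hcomp := tendsto_integral_of_hasCompactSupport hlaw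
      (f := fun w => cutoff R w * F0 w) (by fun_prop) (R := R + 1)
      (fun w hw => by simp [cutoff_eq_zero hw])
  have h0 := (integrable_and_abs_integral_sub_cutoff_le hC0 hη.le hCμ
    hF0.aestronglyMeasurable hdom0).2 R hR0
  filter_upwards [hC, hdom, Metric.tendstoUniformlyOn_iff.1 (hunif (R + 1)) (ε / 4) (by linarith),
    Metric.tendsto_nhds.1 hcomp (ε / 4) (by linarith)] with n hCn hdn hun hcn
  obtain ⟨hIn, hn⟩ := integrable_and_abs_integral_sub_cutoff_le hC0 hη.le hCn
    (hF n).aestronglyMeasurable hdn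
  have hn := hn R hR0
  have hintc : ∀ {f : ℕ × ℝ → ℝ}, Continuous f →
      Integrable (fun w => cutoff R w * f w) (μn n : Measure (ℕ × ℝ)) := by
    intro f hf
    have hc : Continuous fun w => cutoff R w * f w := by fun_prop
    refine hc.integrable_of_hasCompactSupport ?_
    refine HasCompactSupport.intro (isCompact_size_le (R + 1)) fun w hw => ?_
    simp [cutoff_eq_zero (not_le.1 hw).le]
  have hmid : |∫ w, cutoff R w * F n w ∂(μn n : Measure (ℕ × ℝ))
      - ∫ w, cutoff R w * F0 w ∂(μn n : Measure (ℕ × ℝ))| ≤ ε / 4 := by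
    rw [← integral_sub (hintc (hF n)) (hintc hF0), ← Real.norm_eq_abs]
    refine (norm_integral_le_of_norm_le_const (C := ε / 4) (ae_of_all _ fun w => ?_)).trans
      (by simp)
    rw [← mul_sub, norm_mul, Real.norm_of_nonneg (cutoff_nonneg R w)]
    rcases le_total (size w) (R + 1) with h | h
    · have := (hun w h).le
      rw [dist_comm, Real.dist_eq] at this
      calc cutoff R w * ‖F n w - F0 w‖ ≤ 1 * (ε / 4) :=
            mul_le_mul (cutoff_le_one _ _) this (norm_nonneg _) zero_le_one
        _ = _ := one_mul _
    · rw [cutoff_eq_zero h, zero_mul]; linarith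
  rw [Real.dist_eq] at hcn ⊢
  rw [abs_le] at hmid hn h0
  rw [abs_lt] at hcn ⊢
  constructor <;> linarith [hmid.1, hmid.2, hn.1, hn.2, h0.1, h0.2, hcn.1, hcn.2]

/-! ### Tilted laws and second-order expansions -/

/-- Functions growing slower than any exponential of the size. -/
def SubExp (g : ℕ × ℝ → ℝ) : Prop :=
  ∀ δ : ℝ, 0 < δ → ∃ D, ∀ w, |g w| ≤ D * Real.exp (δ * size w)

lemma SubExp.of_bounded {g : ℕ × ℝ → ℝ} {C : ℝ} (h : ∀ w, |g w| ≤ C) : SubExp g := by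
  intro δ hδ
  refine ⟨C, fun w => (h w).trans ?_⟩
  have hC : 0 ≤ C := (abs_nonneg _).trans (h w)
  refine le_mul_of_one_le_right hC (Real.one_le_exp ?_)
  have := size_nonneg w
  positivity

lemma SubExp.of_le_size {g : ℕ × ℝ → ℝ} (h : ∀ w, |g w| ≤ size w) : SubExp g := by
  intro δ hδ
  refine ⟨δ⁻¹, fun w => (h w).trans ?_⟩
  have := Real.add_one_le_exp (δ * size w)
  rw [inv_mul_eq_div, le_div_iff₀ hδ]
  linarith

lemma SubExp.mul {f g : ℕ × ℝ → ℝ} (hf : SubExp f) (hg : SubExp g) :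
    SubExp (fun w => f w * g w) := by
  intro δ hδ
  obtain ⟨D, hD⟩ := hf (δ / 2) (by linarith)
  obtain ⟨E, hE⟩ := hg (δ / 2) (by linarith)
  refine ⟨D * E, fun w => ?_⟩
  rw [abs_mul]
  calc |f w| * |g w| ≤ (D * Real.exp (δ / 2 * size w)) * (E * Real.exp (δ / 2 * size w)) :=
        mul_le_mul (hD w) (hE w) (abs_nonneg _) ((abs_nonneg _).trans (hD w))
    _ = D * E * (Real.exp (δ / 2 * size w) * Real.exp (δ / 2 * size w)) := by ring
    _ = _ := by rw [← Real.exp_add]; congr 2; ring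

lemma SubExp.one : SubExp (fun _ => 1) := SubExp.of_bounded (C := 1) fun _ => by simp

lemma subExp_coordX : SubExp coordX := SubExp.of_le_size fun w => by
  rw [abs_of_nonneg (coordX_nonneg w)]
  exact le_add_of_nonneg_right (abs_nonneg _)

lemma subExp_coordY : SubExp coordY := SubExp.of_le_size fun w =>
  le_add_of_nonneg_left (coordX_nonneg w)

/-- The exponential of a linear form. -/
def expLin (s v : ℝ) (w : ℕ × ℝ) : ℝ := Real.exp (s * coordX w + v * coordY w)

@[fun_prop] lemma continuous_expLin (s v : ℝ) : Continuous (expLin s v) := by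
  unfold expLin; fun_prop

lemma expLin_pos (s v : ℝ) (w : ℕ × ℝ) : 0 < expLin s v w := Real.exp_pos _

/-- Of the margin `2 * η`, one `η` absorbs the growth of `g` and the other is kept for the tails.
Only an upper bound on `s` is needed, because `X ≥ 0`. -/
lemma abs_mul_expLin_le {g : ℕ × ℝ → ℝ} {D b β η s v : ℝ}
    (hg : ∀ w, |g w| ≤ D * Real.exp (η * size w)) (hs : s ≤ b - 2 * η)
    (hv : |v| ≤ β - 2 * η) (w : ℕ × ℝ) :
    |g w * expLin s v w| ≤ D * expWeight (b - η) (β - η) w := by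
  have hD : 0 ≤ D := nonneg_of_mul_nonneg_left ((abs_nonneg _).trans (hg w)) (Real.exp_pos _)
  rw [abs_mul, abs_of_pos (expLin_pos s v w)]
  calc |g w| * expLin s v w ≤ (D * Real.exp (η * size w)) * expLin s v w :=
        mul_le_mul_of_nonneg_right (hg w) (expLin_pos s v w).le
    _ = D * (Real.exp (η * size w) * expLin s v w) := by ring
    _ ≤ _ := by
        refine mul_le_mul_of_nonneg_left ?_ hD
        unfold expLin expWeight size
        rw [← Real.exp_add]
        refine Real.exp_le_exp.2 ?_
        have h1 : v * coordY w ≤ (β - 2 * η) * |coordY w| :=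
          (le_abs_self _).trans (by rw [abs_mul]; gcongr)
        have h2 : s * coordX w ≤ (b - 2 * η) * coordX w :=
          mul_le_mul_of_nonneg_right hs (coordX_nonneg w)
        linarith

lemma integrable_mul_expLin {ν : Measure (ℕ × ℝ)} [IsProbabilityMeasure ν] {b β s v : ℝ}
    (hG : Integrable (expWeight b β) ν) (hs : s < b) (hv : |v| < β)
    {g : ℕ × ℝ → ℝ} (hgc : Continuous g) (hg : SubExp g) :
    Integrable (fun w => g w * expLin s v w) ν := by
  obtain ⟨η, hη, hη1, hη2⟩ : ∃ η, 0 < η ∧ s ≤ b - 2 * η ∧ |v| ≤ β - 2 * η :=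
    ⟨min ((b - s) / 2) ((β - |v|) / 2), lt_min (by linarith) (by linarith),
      by linarith [min_le_left ((b - s) / 2) ((β - |v|) / 2)],
      by linarith [min_le_right ((b - s) / 2) ((β - |v|) / 2)]⟩
  obtain ⟨D, hD⟩ := hg η hη
  have hGpos : ∀ᵐ w ∂ν, 0 ≤ expWeight b β w := ae_of_all _ fun w => (expWeight_pos b β w).le
  refine (integrable_and_abs_integral_sub_cutoff_le (integral_nonneg_of_ae hGpos) hη.le
    (ofReal_integral_eq_lintegral_ofReal hG hGpos).ge
    (by fun_prop) (abs_mul_expLin_le hD hη1 hη2)).1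

lemma integrable_expLin {ν : Measure (ℕ × ℝ)} [IsProbabilityMeasure ν] {b β s v : ℝ}
    (hG : Integrable (expWeight b β) ν) (hs : s < b) (hv : |v| < β) :
    Integrable (expLin s v) ν := by
  simpa using integrable_mul_expLin hG hs hv continuous_const SubExp.one

lemma tendsto_integral_mul_expLin {ι : Type*} {l : Filter ι}
    {μn : ι → ProbabilityMeasure (ℕ × ℝ)} {μ : ProbabilityMeasure (ℕ × ℝ)}
    (hlaw : Tendsto μn l (𝓝 μ)) {b β C : ℝ} (hC0 : 0 ≤ C)
    (hC : ∀ᶠ n in l,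
      ∫⁻ w, ENNReal.ofReal (expWeight b β w) ∂(μn n : Measure (ℕ × ℝ)) ≤ ENNReal.ofReal C)
    {sn vn : ι → ℝ} {s v : ℝ} (hsn : Tendsto sn l (𝓝 s)) (hvn : Tendsto vn l (𝓝 v))
    (hs : s < b) (hv : |v| < β) {g : ℕ × ℝ → ℝ} (hgc : Continuous g) (hg : SubExp g) :
    Tendsto (fun n => ∫ w, g w * expLin (sn n) (vn n) w ∂(μn n : Measure (ℕ × ℝ))) l
      (𝓝 (∫ w, g w * expLin s v w ∂(μ : Measure (ℕ × ℝ)))) := by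
  obtain ⟨η, hη, hη1, hη2⟩ : ∃ η, 0 < η ∧ s < b - 2 * η ∧ |v| < β - 2 * η :=
    ⟨min ((b - s) / 3) ((β - |v|) / 3), lt_min (by linarith) (by linarith),
      by linarith [min_le_left ((b - s) / 3) ((β - |v|) / 3)],
      by linarith [min_le_right ((b - s) / 3) ((β - |v|) / 3)]⟩
  obtain ⟨D, hD⟩ := hg η hη
  refine tendsto_integral_of_expWeight_bound hlaw hC0 hη hC (D := D)
    (fun n => by fun_prop) (by fun_prop) ?_ ?_
  · intro R
    -- A jointly continuous function depends continuously on its parameter in the compact-open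
    -- topology, which is uniform convergence on compacts.
    let Φ : C((ℝ × ℝ) × (ℕ × ℝ), ℝ) :=
      ⟨fun q => g q.2 * Real.exp (q.1.1 * coordX q.2 + q.1.2 * coordY q.2), by fun_prop⟩
    have h1 : Tendsto (fun n => Φ.curry (sn n, vn n)) l (𝓝 (Φ.curry (s, v))) :=
      (Φ.curry.continuous.tendsto (s, v)).comp (hsn.prodMk_nhds hvn)
    exact ContinuousMap.tendsto_iff_forall_isCompact_tendstoUniformlyOn.1 h1 _
      (isCompact_size_le R)
  · filter_upwards [hsn.eventually (gt_mem_nhds hη1), hvn.abs.eventually (gt_mem_nhds hη2)]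
      with n h1 h2 w
    exact abs_mul_expLin_le hD h1.le h2.le w

/-- The Laplace transform `E[exp (s X + v Y)]`. -/
def mgf₂ (ν : Measure (ℕ × ℝ)) (s v : ℝ) : ℝ := ∫ w, expLin s v w ∂ν

/-- The law tilted in both coordinates. -/
def tilt₂ (ν : Measure (ℕ × ℝ)) (s v : ℝ) : Measure (ℕ × ℝ) :=
  ν.tilted (fun w => s * coordX w + v * coordY w)

lemma tiltX_eq (ν : Measure (ℕ × ℝ)) (s : ℝ) : tiltX ν s = tilt₂ ν s 0 := by
  simp [tiltX, tilt₂]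

lemma integral_tilt₂ {ν : Measure (ℕ × ℝ)} {s v : ℝ} (g : ℕ × ℝ → ℝ) :
    ∫ w, g w ∂(tilt₂ ν s v) = (∫ w, g w * expLin s v w ∂ν) / mgf₂ ν s v := by
  rw [tilt₂, integral_tilted, ← integral_div]
  congr with w
  rw [smul_eq_mul]
  unfold mgf₂ expLin
  ring

section SingleLaw

variable {ν : Measure (ℕ × ℝ)} [IsProbabilityMeasure ν] {b β s v : ℝ}

lemma mgf₂_pos (hG : Integrable (expWeight b β) ν) (hs : s < b) (hv : |v| < β) :
    0 < mgf₂ ν s v :=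
  integral_exp_pos (integrable_expLin hG hs hv)

lemma isProbabilityMeasure_tilt₂ (hG : Integrable (expWeight b β) ν) (hs : s < b) (hv : |v| < β) :
    IsProbabilityMeasure (tilt₂ ν s v) :=
  isProbabilityMeasure_tilted (integrable_expLin hG hs hv)

lemma integrable_tilt₂ (hG : Integrable (expWeight b β) ν) (hs : s < b) (hv : |v| < β)
    {g : ℕ × ℝ → ℝ} (hgc : Continuous g) (hg : SubExp g) : Integrable g (tilt₂ ν s v) := by
  rw [tilt₂, integrable_tilted_iff (integrable_expLin hG hs hv)]
  refine (integrable_mul_expLin hG hs hv hgc hg).congr (ae_of_all _ fun w => ?_)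
  exact mul_comm _ _

lemma memLp_two_tilt₂ (hG : Integrable (expWeight b β) ν) (hs : s < b) (hv : |v| < β)
    {g : ℕ × ℝ → ℝ} (hgc : Continuous g) (hg : SubExp g) : MemLp g 2 (tilt₂ ν s v) := by
  rw [memLp_two_iff_integrable_sq hgc.aestronglyMeasurable]
  have := integrable_tilt₂ hG hs hv (g := fun w => g w * g w) (by fun_prop) (hg.mul hg)
  simpa [sq] using this

lemma variance_linear_tilt₂ (hG : Integrable (expWeight b β) ν) (hs : s < b) (hv : |v| < β)
    (h k : ℝ) :
    variance (fun w => h * coordX w + k * coordY w) (tilt₂ ν s v) =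
      h ^ 2 * variance coordX (tilt₂ ν s v)
        + 2 * (h * k) * covariance coordX coordY (tilt₂ ν s v)
        + k ^ 2 * variance coordY (tilt₂ ν s v) := by
  have := isProbabilityMeasure_tilt₂ hG hs hv
  have hX := memLp_two_tilt₂ hG hs hv continuous_coordX subExp_coordX
  have hY := memLp_two_tilt₂ hG hs hv continuous_coordY subExp_coordY
  have := variance_add (hX.const_mul h) (hY.const_mul k)
  have e : (fun w => h * coordX w + k * coordY w)
      = (fun w => h * coordX w) + fun w => k * coordY w := rfl
  rw [e, this, variance_const_mul, variance_const_mul, covariance_const_mul_left,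
    covariance_const_mul_right]
  ring

/-- Taylor's formula with Lagrange remainder along a segment: the gradient of `log mgf₂` is the
tilted mean and its Hessian the tilted covariance. It reduces to the one-variable expansion of the
cumulant generating function of the centred form `Z` under the law tilted at the starting point. -/
lemma log_mgf₂_sub_eq (hG : Integrable (expWeight b β) ν) {h k : ℝ} (hs : s < b) (hv : |v| < β)
    (hs' : s + h < b) (hv' : |v + k| < β) :
    ∃ θ ∈ Ioo (0 : ℝ) 1, Real.log (mgf₂ ν (s + h) (v + k)) - Real.log (mgf₂ ν s v) =
      h * (∫ w, coordX w ∂(tilt₂ ν s v)) + k * (∫ w, coordY w ∂(tilt₂ ν s v))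
      + variance (fun w => h * coordX w + k * coordY w)
          (tilt₂ ν (s + θ * h) (v + θ * k)) / 2 := by
  have hP := isProbabilityMeasure_tilt₂ hG hs hv
  have hX := integrable_tilt₂ hG hs hv continuous_coordX subExp_coordX
  have hY := integrable_tilt₂ hG hs hv continuous_coordY subExp_coordY
  set c : ℝ := h * (∫ w, coordX w ∂(tilt₂ ν s v)) + k * (∫ w, coordY w ∂(tilt₂ ν s v)) with hc
  set Z : ℕ × ℝ → ℝ := fun w => h * coordX w + k * coordY w - c with hZ
  have hint : Integrable (fun w => Real.exp (s * coordX w + v * coordY w)) ν :=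
    integrable_expLin hG hs hv
  have hmean : ∫ w, Z w ∂(tilt₂ ν s v) = 0 := by
    have e := integral_sub ((hX.const_mul h).add (hY.const_mul k)) (integrable_const c)
    rw [integral_add' (hX.const_mul h) (hY.const_mul k), integral_const_mul, integral_const_mul,
      ← hc, integral_const, probReal_univ, one_smul, sub_self] at e
    exact e
  have hU : ∀ t : ℝ, s + t * h < b → |v + t * k| < β → t ∈ integrableExpSet Z (tilt₂ ν s v) := by
    intro t h1 h2
    show Integrable _ _
    rw [tilt₂, integrable_tilted_iff hint]
    have := (integrable_expLin hG h1 h2).const_mul (Real.exp (-t * c))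
    refine this.congr (ae_of_all _ fun w => ?_)
    simp only [hZ, expLin, smul_eq_mul, ← Real.exp_add]
    congr 1; ring
  have hopen : IsOpen {t : ℝ | s + t * h < b ∧ |v + t * k| < β} :=
    (isOpen_lt (f := fun t : ℝ => s + t * h) (g := fun _ => b) (by fun_prop) (by fun_prop)).inter
      (isOpen_lt (f := fun t : ℝ => |v + t * k|) (g := fun _ => β) (by fun_prop) (by fun_prop))
  have hsub : {t : ℝ | s + t * h < b ∧ |v + t * k| < β} ⊆
      interior (integrableExpSet Z (tilt₂ ν s v)) :=
    interior_maximal (fun t ht => hU t ht.1 ht.2) hopen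
  -- The domain `s < b`, `|v| < β` is convex, so it contains the whole segment.
  have hIcc : Icc (0 : ℝ) 1 ⊆ {t : ℝ | s + t * h < b ∧ |v + t * k| < β} := by
    intro t ht
    have e1 : s + t * h = (1 - t) * s + t * (s + h) := by ring
    have e2 : v + t * k = (1 - t) * v + t * (v + k) := by ring
    have ht0 := ht.1
    have ht1 := ht.2
    rw [abs_lt] at hv hv'
    refine ⟨?_, abs_lt.2 ⟨?_, ?_⟩⟩
    · rw [e1]; rcases ht0.eq_or_lt with rfl | h0
      · simpa using hs
      · nlinarith
    · rw [e2]; rcases ht0.eq_or_lt with rfl | h0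
      · simpa using hv.1
      · nlinarith
    · rw [e2]; rcases ht0.eq_or_lt with rfl | h0
      · simpa using hv.2
      · nlinarith
  obtain ⟨θ, hθ, hcgf⟩ := exists_cgf_eq_iteratedDeriv_two_cgf_mul (X := Z) (μ := tilt₂ ν s v)
    one_pos hmean (hIcc.trans hsub)
  refine ⟨θ, hθ, ?_⟩
  have hθ' := hIcc ⟨hθ.1.le, hθ.2.le⟩
  have hPθ := isProbabilityMeasure_tilt₂ hG hθ'.1 hθ'.2
  -- Successive tilts add their exponents, and the centring constant in `Z` disappears in the
  -- normalisation.
  have htilt : (tilt₂ ν s v).tilted (fun w => θ * Z w) = tilt₂ ν (s + θ * h) (v + θ * k) := by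
    have e1 : (tilt₂ ν (s + θ * h) (v + θ * k)).tilted (fun _ => -θ * c)
        = tilt₂ ν (s + θ * h) (v + θ * k) := tilted_const _ _
    rw [← e1]
    unfold tilt₂
    rw [tilted_tilted hint, tilted_tilted (integrable_expLin hG hθ'.1 hθ'.2)]
    congr 1
    funext w
    simp only [hZ, Pi.add_apply]
    ring
  rw [← variance_tilted_mul (hsub hθ'), htilt] at hcgf
  have hvar : variance Z (tilt₂ ν (s + θ * h) (v + θ * k))
      = variance (fun w => h * coordX w + k * coordY w)
          (tilt₂ ν (s + θ * h) (v + θ * k)) := by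
    rw [hZ]
    exact variance_sub_const (by fun_prop) c
  have hmgf : mgf Z (tilt₂ ν s v) 1 = Real.exp (-c) * mgf₂ ν (s + h) (v + k) / mgf₂ ν s v := by
    rw [mgf, integral_tilt₂]
    congr 1
    rw [mgf₂, ← integral_const_mul]
    refine integral_congr_ae (ae_of_all _ fun w => ?_)
    simp only [hZ, expLin, ← Real.exp_add]
    congr 1; ring
  have hp1 := mgf₂_pos hG hs hv
  have hp2 := mgf₂_pos hG hs' hv'
  rw [cgf, hmgf, Real.log_div (by positivity) hp1.ne', Real.log_mul (by positivity) hp2.ne',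
    Real.log_exp, hvar] at hcgf
  linarith

end SingleLaw

section Limits

variable {ι : Type*} {l : Filter ι} {μn : ι → ProbabilityMeasure (ℕ × ℝ)}
  {μ : ProbabilityMeasure (ℕ × ℝ)} {b β C : ℝ} {sn vn : ι → ℝ} {s v : ℝ}

lemma integrable_expWeight_of_lintegral_le {ν : Measure (ℕ × ℝ)}
    (h : ∫⁻ w, ENNReal.ofReal (expWeight b β w) ∂ν ≤ ENNReal.ofReal C) :
    Integrable (expWeight b β) ν := by
  refine ⟨(continuous_expWeight b β).aestronglyMeasurable, ?_⟩
  rw [hasFiniteIntegral_iff_ofReal (ae_of_all _ fun w => (expWeight_pos b β w).le)]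
  exact h.trans_lt ENNReal.ofReal_lt_top

lemma integrable_expWeight_of_tendsto [l.NeBot] (hlaw : Tendsto μn l (𝓝 μ)) (hC0 : 0 ≤ C)
    (hC : ∀ᶠ n in l,
      ∫⁻ w, ENNReal.ofReal (expWeight b β w) ∂(μn n : Measure (ℕ × ℝ)) ≤ ENNReal.ofReal C) :
    Integrable (expWeight b β) (μ : Measure (ℕ × ℝ)) :=
  integrable_expWeight_of_lintegral_le (lintegral_le_of_tendsto hlaw (continuous_expWeight b β)
    (fun w => (expWeight_pos b β w).le) hC0 hC)

lemma tendsto_mgf₂ (hlaw : Tendsto μn l (𝓝 μ)) (hC0 : 0 ≤ C)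
    (hC : ∀ᶠ n in l,
      ∫⁻ w, ENNReal.ofReal (expWeight b β w) ∂(μn n : Measure (ℕ × ℝ)) ≤ ENNReal.ofReal C)
    (hsn : Tendsto sn l (𝓝 s)) (hvn : Tendsto vn l (𝓝 v)) (hs : s < b) (hv : |v| < β) :
    Tendsto (fun n => mgf₂ (μn n) (sn n) (vn n)) l (𝓝 (mgf₂ μ s v)) := by
  simpa [mgf₂] using tendsto_integral_mul_expLin hlaw hC0 hC hsn hvn hs hv
    continuous_const SubExp.one

lemma tendsto_integral_tilt₂ (hlaw : Tendsto μn l (𝓝 μ)) (hC0 : 0 ≤ C)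
    (hC : ∀ᶠ n in l,
      ∫⁻ w, ENNReal.ofReal (expWeight b β w) ∂(μn n : Measure (ℕ × ℝ)) ≤ ENNReal.ofReal C)
    (hsn : Tendsto sn l (𝓝 s)) (hvn : Tendsto vn l (𝓝 v)) (hs : s < b) (hv : |v| < β)
    {g : ℕ × ℝ → ℝ} (hgc : Continuous g) (hg : SubExp g) :
    Tendsto (fun n => ∫ w, g w ∂(tilt₂ (μn n) (sn n) (vn n))) l
      (𝓝 (∫ w, g w ∂(tilt₂ μ s v))) := by
  rcases l.eq_or_neBot with rfl | hne
  · exact tendsto_bot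
  simp_rw [integral_tilt₂]
  exact (tendsto_integral_mul_expLin hlaw hC0 hC hsn hvn hs hv hgc hg).div
    (tendsto_mgf₂ hlaw hC0 hC hsn hvn hs hv)
    (mgf₂_pos (integrable_expWeight_of_tendsto hlaw hC0 hC) hs hv).ne'

lemma tendsto_covariance_tilt₂ (hlaw : Tendsto μn l (𝓝 μ)) (hC0 : 0 ≤ C)
    (hC : ∀ᶠ n in l,
      ∫⁻ w, ENNReal.ofReal (expWeight b β w) ∂(μn n : Measure (ℕ × ℝ)) ≤ ENNReal.ofReal C)
    (hsn : Tendsto sn l (𝓝 s)) (hvn : Tendsto vn l (𝓝 v)) (hs : s < b) (hv : |v| < β)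
    {f g : ℕ × ℝ → ℝ} (hfc : Continuous f) (hf : SubExp f) (hgc : Continuous g) (hg : SubExp g) :
    Tendsto (fun n => covariance f g (tilt₂ (μn n) (sn n) (vn n))) l
      (𝓝 (covariance f g (tilt₂ μ s v))) := by
  rcases l.eq_or_neBot with rfl | hne
  · exact tendsto_bot
  have hcov : ∀ {ν : Measure (ℕ × ℝ)} [IsProbabilityMeasure ν] {s v : ℝ},
      Integrable (expWeight b β) ν → s < b → |v| < β →
      covariance f g (tilt₂ ν s v) = ∫ w, f w * g w ∂(tilt₂ ν s v)
        - (∫ w, f w ∂(tilt₂ ν s v)) * ∫ w, g w ∂(tilt₂ ν s v) := by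
    intro ν _ s v hG hs hv
    have := isProbabilityMeasure_tilt₂ hG hs hv
    exact covariance_eq_sub (memLp_two_tilt₂ hG hs hv hfc hf) (memLp_two_tilt₂ hG hs hv hgc hg)
  rw [hcov (integrable_expWeight_of_tendsto hlaw hC0 hC) hs hv]
  refine Tendsto.congr' ?_ ((tendsto_integral_tilt₂ hlaw hC0 hC hsn hvn hs hv
    (g := fun w => f w * g w) (by fun_prop) (hf.mul hg)).sub
    ((tendsto_integral_tilt₂ hlaw hC0 hC hsn hvn hs hv hfc hf).mul
      (tendsto_integral_tilt₂ hlaw hC0 hC hsn hvn hs hv hgc hg)))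
  filter_upwards [hC, hsn.eventually (gt_mem_nhds hs), hvn.abs.eventually (gt_mem_nhds hv)]
    with n h1 h2 h3
  exact (hcov (integrable_expWeight_of_lintegral_le h1) h2 h3).symm

end Limits

/-! ### Convergence of the tilting parameter -/

lemma integral_coordX_tilt₂_eq_psiX' {ν : Measure (ℕ × ℝ)} {s : ℝ}
    (hs : s ∈ interior (domX ν)) :
    ∫ w, coordX w ∂(tilt₂ ν s 0) = psiX' ν s := by
  rw [← tiltX_eq]
  exact integral_tilted_mul_self hs

lemma monotoneOn_psiX' {ν : Measure (ℕ × ℝ)} : MonotoneOn (psiX' ν) (interior (domX ν)) := by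
  have hd : ∀ x ∈ interior (domX ν), AnalyticAt ℝ (psiX' ν) x := fun x hx =>
    (analyticAt_cgf hx).deriv
  refine monotoneOn_of_deriv_nonneg convex_integrableExpSet.interior
    (fun x hx => (hd x hx).continuousAt.continuousWithinAt)
    (fun x hx => (hd x (interior_subset hx)).differentiableAt.differentiableWithinAt) ?_
  intro x hx
  rw [interior_interior] at hx
  have h := variance_tilted_mul hx
  rw [iteratedDeriv_succ, iteratedDeriv_one] at h
  exact h ▸ variance_nonneg _ _

section SingleLaw

variable {ν : Measure (ℕ × ℝ)} [IsProbabilityMeasure ν] {b β s t v : ℝ}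

/-- `ν` is absolutely continuous with respect to its tilt, so a vanishing tilted variance would make
`X` constant under `ν`. -/
lemma variance_coordX_tilt₂_pos (hG : Integrable (expWeight b β) ν) (hs : s < b) (hv : |v| < β)
    (hconst : ¬ ∃ c : ℕ, ∀ᵐ w ∂ν, w.1 = c) : 0 < variance coordX (tilt₂ ν s v) := by
  have := isProbabilityMeasure_tilt₂ hG hs hv
  refine (variance_nonneg _ _).lt_of_ne fun h0 => hconst ?_
  have hX := memLp_two_tilt₂ hG hs hv continuous_coordX subExp_coordX
  have hae : ∀ᵐ w ∂(tilt₂ ν s v), coordX w = ∫ w, coordX w ∂(tilt₂ ν s v) := by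
    have h1 := hX.ofReal_variance_eq
    rw [← h0, ENNReal.ofReal_zero, eq_comm, evariance_eq_zero_iff (by fun_prop)] at h1
    exact h1
  have hae' : ∀ᵐ w ∂ν, coordX w = ∫ w, coordX w ∂(tilt₂ ν s v) :=
    (absolutelyContinuous_tilted (integrable_expLin hG hs hv)).ae_le hae
  obtain ⟨w0, hw0⟩ := hae'.exists
  refine ⟨w0.1, hae'.mono fun w hw => ?_⟩
  have : (w.1 : ℝ) = w0.1 := hw.trans hw0.symm
  exact_mod_cast this

/-- Adding the second-order expansions from `s` to `t` and from `t` to `s` cancels the logarithms: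
`t - s` times the difference of means equals a sum of two positive half-variances. -/
lemma integral_coordX_tilt₂_lt (hG : Integrable (expWeight b β) ν) (hst : s < t) (ht : t < b)
    (hv : |v| < β) (hconst : ¬ ∃ c : ℕ, ∀ᵐ w ∂ν, w.1 = c) :
    ∫ w, coordX w ∂(tilt₂ ν s v) < ∫ w, coordX w ∂(tilt₂ ν t v) := by
  have hs := hst.trans ht
  obtain ⟨θ, hθ, e1⟩ := log_mgf₂_sub_eq hG (h := t - s) (k := 0) hs hv (by linarith) (by simpa)
  obtain ⟨θ', hθ', e2⟩ := log_mgf₂_sub_eq hG (h := s - t) (k := 0) ht hv (by linarith) (by simpa)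
  have h1 : s + θ * (t - s) < b := by nlinarith [hθ.1, hθ.2]
  have h2 : t + θ' * (s - t) < b := by nlinarith [hθ'.1, hθ'.2]
  rw [variance_linear_tilt₂ hG h1 (by simpa)] at e1
  rw [variance_linear_tilt₂ hG h2 (by simpa)] at e2
  have p1 := variance_coordX_tilt₂_pos hG h1 (v := v + θ * 0) (by simpa) hconst
  have p2 := variance_coordX_tilt₂_pos hG h2 (v := v + θ' * 0) (by simpa) hconst
  have e3 : s + (t - s) = t := by ring
  have e4 : t + (s - t) = s := by ring
  rw [e3, add_zero] at e1
  rw [e4, add_zero] at e2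
  have q1 : 0 < (t - s) ^ 2 * variance coordX (tilt₂ ν (s + θ * (t - s)) (v + θ * 0)) := by
    have : 0 < t - s := by linarith
    positivity
  have q2 : 0 < (s - t) ^ 2 * variance coordX (tilt₂ ν (t + θ' * (s - t)) (v + θ' * 0)) := by
    have : s - t ≠ 0 := by linarith
    positivity
  have hts : 0 < t - s := by linarith
  nlinarith

lemma Iio_subset_interior_domX (hG : Integrable (expWeight b β) ν) (hβ : 0 < β) :
    Iio b ⊆ interior (domX ν) := by
  refine interior_maximal (fun s hs => ?_) isOpen_Iio
  have := integrable_expLin hG hs (v := 0) (by simpa)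
  show Integrable _ _
  unfold expLin at this
  simpa using this

end SingleLaw

section Limits

variable {ι : Type*} {l : Filter ι} {μn : ι → ProbabilityMeasure (ℕ × ℝ)}
  {μ : ProbabilityMeasure (ℕ × ℝ)} {b β C : ℝ}

/-- The limiting `ψ_X'` is strictly increasing near `τ`. At a fixed `x` on one side of `τ`, the
values `psiX' (μn n) x` are eventually strictly on that side of `psiX' (μn n) (τn n)`, and
monotonicity then locates `τn n`. -/
lemma tendsto_of_tendsto_psiX' [l.NeBot] (hlaw : Tendsto μn l (𝓝 μ)) (hC0 : 0 ≤ C)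
    (hC : ∀ᶠ n in l,
      ∫⁻ w, ENNReal.ofReal (expWeight b β w) ∂(μn n : Measure (ℕ × ℝ)) ≤ ENNReal.ofReal C)
    (hβ : 0 < β) (hconst : ¬ ∃ c : ℕ, ∀ᵐ w ∂(μ : Measure (ℕ × ℝ)), w.1 = c)
    {τ : ℝ} (hτ : τ < b) {τn : ι → ℝ}
    (hτn : ∀ᶠ n in l, τn n ∈ interior (domX (μn n : Measure (ℕ × ℝ))))
    (hlim : Tendsto (fun n => psiX' (μn n : Measure (ℕ × ℝ)) (τn n)) l
      (𝓝 (psiX' (μ : Measure (ℕ × ℝ)) τ))) :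
    Tendsto τn l (𝓝 τ) := by
  have hG := integrable_expWeight_of_tendsto hlaw hC0 hC
  have hβ' : |(0 : ℝ)| < β := by simpa
  rw [← integral_coordX_tilt₂_eq_psiX' (Iio_subset_interior_domX hG hβ hτ)] at hlim
  have hE : ∀ s < b, Tendsto (fun n => psiX' (μn n : Measure (ℕ × ℝ)) s) l
      (𝓝 (∫ w, coordX w ∂(tilt₂ (μ : Measure (ℕ × ℝ)) s 0))) := by
    intro s hs
    refine (tendsto_integral_tilt₂ hlaw hC0 hC (tendsto_const_nhds (x := s))
      (tendsto_const_nhds (x := (0 : ℝ))) hs hβ' continuous_coordX subExp_coordX).congr' ?_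
    filter_upwards [hC] with n hn
    exact integral_coordX_tilt₂_eq_psiX'
      (Iio_subset_interior_domX (integrable_expWeight_of_lintegral_le hn) hβ hs)
  rw [tendsto_order]
  constructor
  · intro x hx
    have hlt := integral_coordX_tilt₂_lt hG hx hτ hβ' hconst
    filter_upwards [hC, hτn, (hE x (hx.trans hτ)).eventually_lt hlim hlt] with n h1 h2 h3
    by_contra hcon
    exact h3.not_ge (monotoneOn_psiX' h2 (Iio_subset_interior_domX
      (integrable_expWeight_of_lintegral_le h1) hβ (hx.trans hτ)) (not_lt.1 hcon))
  · intro x hx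
    -- Convergence of `psiX'` is available only below `b`, so a larger `x` is replaced by a point of
    -- `(τ, b)`.
    wlog hxb : x < b generalizing x
    · obtain ⟨y, hy1, hy2⟩ := exists_between hτ
      exact (this y hy1 hy2).mono fun n hn => hn.trans (hy2.trans_le (not_lt.1 hxb))
    have hlt := integral_coordX_tilt₂_lt hG hx hxb hβ' hconst
    filter_upwards [hC, hτn, hlim.eventually_lt (hE x hxb) hlt] with n h1 h2 h3
    by_contra hcon
    exact h3.not_ge (monotoneOn_psiX' (Iio_subset_interior_domX
      (integrable_expWeight_of_lintegral_le h1) hβ hxb) h2 (not_lt.1 hcon))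

/-- This removes the centring `m n`, on which no bound is assumed. By tightness a fixed compact has
mass above `1 / 2` under `μn n`, and there the uncentred exponential is bounded below; the centred
bounds with `v = ±β` therefore bound `exp (∓β m n)`. The point `τ` serves only for this, `b` for the
conclusion. -/
lemma exists_expWeight_bound (hlaw : Tendsto μn l (𝓝 μ)) {m : ι → ℝ} {B : ℝ} (hβ : 0 ≤ β)
    (hB0 : 0 ≤ B) (τ : ℝ)
    (hB : ∀ᶠ n in l, ∀ s ∈ ({τ, b} : Set ℝ), ∀ v ∈ ({β, -β} : Set ℝ),
      ∫⁻ w, ENNReal.ofReal (Real.exp (s * coordX w + v * (coordY w - m n)))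
        ∂(μn n : Measure (ℕ × ℝ)) ≤ ENNReal.ofReal B) :
    ∃ C, 0 ≤ C ∧ ∀ᶠ n in l,
      ∫⁻ w, ENNReal.ofReal (expWeight b β w) ∂(μn n : Measure (ℕ × ℝ)) ≤ ENNReal.ofReal C := by
  have hcut : Tendsto (fun N : ℕ => ∫ w, cutoff N w ∂(μ : Measure (ℕ × ℝ))) atTop (𝓝 1) := by
    have : (1 : ℝ) = ∫ w, (1 : ℝ) ∂(μ : Measure (ℕ × ℝ)) := by simp
    rw [this]
    refine tendsto_integral_of_dominated_convergence (fun _ => 1) (fun N => by fun_prop)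
      (integrable_const _) (fun N => ae_of_all _ fun w => ?_) (ae_of_all _ fun w => ?_)
    · rw [Real.norm_of_nonneg (cutoff_nonneg _ _)]; exact cutoff_le_one _ _
    · refine tendsto_const_nhds.congr' ?_
      filter_upwards [eventually_ge_atTop ⌈size w⌉₊] with N hN
      rw [cutoff_eq_one ((Nat.le_ceil _).trans (by exact_mod_cast hN))]
  obtain ⟨R, hR⟩ := (hcut.eventually (lt_mem_nhds (show (1 / 2 : ℝ) < 1 by norm_num))).exists
  have hcn := (tendsto_integral_of_hasCompactSupport hlaw (continuous_cutoff R) (R := R + 1)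
    (fun w hw => cutoff_eq_zero hw)).eventually (lt_mem_nhds hR)
  -- On the support of the cutoff, `τ X + v Y ≥ -K` when `|v| = β`.
  set K : ℝ := (|τ| + β) * (R + 1) with hK
  have hQ : ∀ᶠ n in l, ∀ v ∈ ({β, -β} : Set ℝ),
      Real.exp (-v * m n) ≤ 2 * B * Real.exp K := by
    filter_upwards [hB, hcn] with n hBn hcn v hv
    have habs : |v| = β := by
      rcases hv with rfl | hv
      · exact abs_of_nonneg hβ
      · rw [mem_singleton_iff.1 hv, abs_neg, abs_of_nonneg hβ]
    have h1 := hBn τ (by simp) v hv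
    have hint : Integrable (cutoff R) (μn n : Measure (ℕ × ℝ)) := by
      refine Integrable.of_bound (by fun_prop) 1 (ae_of_all _ fun w => ?_)
      rw [Real.norm_of_nonneg (cutoff_nonneg _ _)]; exact cutoff_le_one _ _
    have h2 : ENNReal.ofReal (Real.exp (-K - v * m n) *
        ∫ w, cutoff R w ∂(μn n : Measure (ℕ × ℝ))) ≤ ENNReal.ofReal B := by
      rw [← integral_const_mul, ofReal_integral_eq_lintegral_ofReal (hint.const_mul _)
        (ae_of_all _ fun w => mul_nonneg (Real.exp_pos _).le (cutoff_nonneg _ _))]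
      refine (lintegral_mono fun w => ENNReal.ofReal_le_ofReal ?_).trans h1
      rcases le_total (R + 1 : ℝ) (size w) with h | h
      · rw [cutoff_eq_zero h, mul_zero]; exact (Real.exp_pos _).le
      · refine (mul_le_of_le_one_right (Real.exp_pos _).le (cutoff_le_one _ _)).trans
          (Real.exp_le_exp.2 ?_)
        have hx := coordX_nonneg w
        have hy := abs_nonneg (coordY w)
        have hsz : coordX w + |coordY w| ≤ R + 1 := h
        have e1 : |τ * coordX w| ≤ |τ| * (R + 1) := by
          rw [abs_mul, abs_of_nonneg hx]; gcongr; linarith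
        have e2 : |v * coordY w| ≤ β * (R + 1) := by
          rw [abs_mul, habs]; gcongr; linarith
        have := (abs_le.1 e1).1
        have := (abs_le.1 e2).1
        rw [hK]; linarith
    have h3 := (ENNReal.ofReal_le_ofReal_iff hB0).1 h2
    have h4 : Real.exp (-v * m n) = Real.exp K * Real.exp (-K - v * m n) := by
      rw [← Real.exp_add]; congr 1; ring
    rw [h4]
    have h5 := Real.exp_pos (-K - v * m n)
    have h6 : Real.exp (-K - v * m n) ≤ 2 * B := by nlinarith
    nlinarith [Real.exp_pos K]
  refine ⟨2 * (2 * B * Real.exp K * B), by positivity, ?_⟩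
  filter_upwards [hB, hQ] with n hBn hQn
  have hone : ∀ v ∈ ({β, -β} : Set ℝ), ∫⁻ w, ENNReal.ofReal (expLin b v w)
      ∂(μn n : Measure (ℕ × ℝ)) ≤ ENNReal.ofReal (2 * B * Real.exp K * B) := by
    intro v hv
    have h1 : ∀ w, ENNReal.ofReal (expLin b v w) = ENNReal.ofReal (Real.exp (v * m n)) *
        ENNReal.ofReal (Real.exp (b * coordX w + v * (coordY w - m n))) := by
      intro w
      rw [← ENNReal.ofReal_mul (Real.exp_pos _).le, ← Real.exp_add, expLin]
      congr 2; ring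
    simp_rw [h1]
    rw [lintegral_const_mul _ (by fun_prop), ENNReal.ofReal_mul (by positivity)]
    refine mul_le_mul' (ENNReal.ofReal_le_ofReal ?_) (hBn b (by simp) v hv)
    have := hQn (-v) (by rcases hv with rfl | hv <;> simp_all)
    simpa using this
  calc ∫⁻ w, ENNReal.ofReal (expWeight b β w) ∂(μn n : Measure (ℕ × ℝ))
      ≤ ∫⁻ w, (ENNReal.ofReal (expLin b β w) + ENNReal.ofReal (expLin b (-β) w))
          ∂(μn n : Measure (ℕ × ℝ)) := by
        refine lintegral_mono fun w => ?_
        rw [← ENNReal.ofReal_add (expLin_pos _ _ _).le (expLin_pos _ _ _).le]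
        refine ENNReal.ofReal_le_ofReal ?_
        have h1 := expLin_pos b β w
        have h2 := expLin_pos b (-β) w
        rcases abs_cases (coordY w) with ⟨h, -⟩ | ⟨h, -⟩
        · have : expWeight b β w = expLin b β w := by unfold expWeight expLin; rw [h]
          linarith
        · have : expWeight b β w = expLin b (-β) w := by
            unfold expWeight expLin; rw [h]; congr 1; ring
          linarith
    _ ≤ _ := by
        rw [lintegral_add_left (by fun_prop), two_mul,
          ENNReal.ofReal_add (by positivity) (by positivity)]
        exact add_le_add (hone β (by simp)) (hone (-β) (by simp))

end Limits

/-! ### The saddle point -/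

section SingleLaw

variable {ν : Measure (ℕ × ℝ)} [IsProbabilityMeasure ν] {b β s v : ℝ}

/-- The right-hand side is a Schur complement, the minimum over `h` of the variance of `h X + Y`; in
this form `α²` comes out of the saddle point. -/
lemma alphaSq_eq (hG : Integrable (expWeight b β) ν) (hs : s < b) (hβ : 0 < β)
    (hA : variance coordX (tilt₂ ν s 0) ≠ 0) :
    alphaSq ν s = variance coordY (tilt₂ ν s 0)
      - covariance coordX coordY (tilt₂ ν s 0) ^ 2 / variance coordX (tilt₂ ν s 0) := by
  have hv : |(0 : ℝ)| < β := by simpa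
  have hP := isProbabilityMeasure_tilt₂ hG hs hv
  set A := variance coordX (tilt₂ ν s 0) with hAdef
  set B := covariance coordX coordY (tilt₂ ν s 0) with hBdef
  have e : residual ν s = fun w => (-(B / A) * coordX w + 1 * coordY w)
      - (tiltedMeanY ν s - B / A * tiltedMeanX ν s) := by
    funext w
    rw [residual, tiltX_eq, ← hAdef, ← hBdef]
    ring
  have e2 := variance_linear_tilt₂ hG hs hv (-(B / A)) 1
  rw [alphaSq, tiltX_eq, e, variance_sub_const (by fun_prop), e2, ← hAdef, ← hBdef]
  field_simp
  ring

lemma cgf_coordX_tilt₂ (hG : Integrable (expWeight b β) ν) (hs : s < b) (hv : |v| < β) {t : ℝ}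
    (ht : s + t < b) :
    cgf coordX (tilt₂ ν s v) t = Real.log (mgf₂ ν (s + t) v) - Real.log (mgf₂ ν s v) := by
  rw [cgf, mgf, integral_tilt₂, ← Real.log_div (mgf₂_pos hG ht hv).ne' (mgf₂_pos hG hs hv).ne']
  congr 2
  refine integral_congr_ae (ae_of_all _ fun w => ?_)
  simp only [expLin, ← Real.exp_add]
  congr 1; ring

/-- First-order condition: the derivative at `0` of the cumulant generating function of `X` under
the tilted law is the tilted mean. -/
lemma integral_coordX_tilt₂_of_isLocalMin (hG : Integrable (expWeight b β) ν) (hs : s < b)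
    (hv : |v| < β) {a : ℝ}
    (hmin : IsLocalMin (fun t => Real.log (mgf₂ ν (s + t) v) - t * a) 0) :
    ∫ w, coordX w ∂(tilt₂ ν s v) = a := by
  have hP := isProbabilityMeasure_tilt₂ hG hs hv
  have hlt : ∀ᶠ t in 𝓝 (0 : ℝ), s + t < b :=
    (isOpen_lt (f := fun t : ℝ => s + t) (g := fun _ => b) (by fun_prop)
      (by fun_prop)).mem_nhds (by simpa using hs)
  have h0 : (0 : ℝ) ∈ interior (integrableExpSet coordX (tilt₂ ν s v)) := by
    rw [mem_interior_iff_mem_nhds]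
    filter_upwards [hlt] with t ht
    show Integrable _ _
    rw [tilt₂, integrable_tilted_iff (integrable_expLin hG hs hv)]
    refine (integrable_expLin hG ht hv).congr (ae_of_all _ fun w => ?_)
    simp only [expLin, smul_eq_mul, ← Real.exp_add]
    congr 1; ring
  have hd : HasDerivAt (cgf coordX (tilt₂ ν s v)) (∫ w, coordX w ∂(tilt₂ ν s v)) 0 := by
    have h1 := (analyticAt_cgf h0).differentiableAt.hasDerivAt
    rwa [deriv_cgf_zero h0, probReal_univ, div_one] at h1
  have hd2 : HasDerivAt (fun t => cgf coordX (tilt₂ ν s v) t - t * a)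
      (∫ w, coordX w ∂(tilt₂ ν s v) - 1 * a) 0 := hd.sub ((hasDerivAt_id 0).mul_const a)
  have hmin2 : IsLocalMin (fun t => cgf coordX (tilt₂ ν s v) t - t * a) 0 := by
    filter_upwards [hmin, hlt] with t h1 h2
    rw [cgf_coordX_tilt₂ hG hs hv h2, cgf_coordX_tilt₂ hG hs hv (by simpa using hs)]
    linarith
  have := hmin2.hasDerivAt_eq_zero hd2
  linarith

end SingleLaw

section Limits

variable {ι : Type*} {l : Filter ι} {μn : ι → ProbabilityMeasure (ℕ × ℝ)}
  {μ : ProbabilityMeasure (ℕ × ℝ)} {b β C : ℝ}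

/-- Compactness of the interval; continuity in `h` is `tendsto_mgf₂` for a constant family of laws.
-/
lemma exists_isMinOn_log_mgf₂ {ν : ProbabilityMeasure (ℕ × ℝ)}
    (hG : Integrable (expWeight b β) (ν : Measure (ℕ × ℝ))) {t v δ : ℝ}
    (hδ : 0 ≤ δ) (ht : t + δ < b) (hv : |v| < β) (a : ℝ) :
    ∃ h ∈ Icc (-δ) δ, IsMinOn (fun h => Real.log (mgf₂ ν (t + h) v) - h * a) (Icc (-δ) δ) h := by
  refine isCompact_Icc.exists_isMinOn ⟨0, by simp [hδ]⟩ fun h hh => ?_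
  have hlt : t + h < b := by linarith [hh.2]
  have hGpos : ∀ᵐ w ∂(ν : Measure (ℕ × ℝ)), 0 ≤ expWeight b β w :=
    ae_of_all _ fun w => (expWeight_pos b β w).le
  have h1 : Tendsto (fun h => mgf₂ ν (t + h) v) (𝓝[Icc (-δ) δ] h) (𝓝 (mgf₂ ν (t + h) v)) :=
    tendsto_mgf₂ (tendsto_const_nhds (x := ν)) (integral_nonneg_of_ae hGpos)
      (Eventually.of_forall fun _ => (ofReal_integral_eq_lintegral_ofReal hG hGpos).ge)
      ((continuous_const.add continuous_id).tendsto h |>.mono_left nhdsWithin_le_nhds)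
      tendsto_const_nhds hlt hv
  exact (h1.log (mgf₂_pos hG hlt hv).ne').sub
    ((continuous_id.mul continuous_const).tendsto h |>.mono_left nhdsWithin_le_nhds)

/-- A saddle point of the Laplace transform in the first variable, close to `τ`, and the quadratic
expansion of the corresponding value. -/
theorem exists_saddle_point [l.NeBot] (hlaw : Tendsto μn l (𝓝 μ)) (hC0 : 0 ≤ C)
    (hC : ∀ᶠ n in l,
      ∫⁻ w, ENNReal.ofReal (expWeight b β w) ∂(μn n : Measure (ℕ × ℝ)) ≤ ENNReal.ofReal C)
    (hβ : 0 < β) (hconst : ¬ ∃ c : ℕ, ∀ᵐ w ∂(μ : Measure (ℕ × ℝ)), w.1 = c)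
    {τ : ℝ} (hτ : τ < b) {τn vn : ι → ℝ} (hτn : Tendsto τn l (𝓝 τ)) (hvn : Tendsto vn l (𝓝 0)) :
    ∃ hn : ι → ℝ, Tendsto hn l (𝓝 0) ∧
      (∀ᶠ n in l, ∫ w, coordX w ∂(tilt₂ (μn n) (τn n + hn n) (vn n))
        = ∫ w, coordX w ∂(tilt₂ (μn n) (τn n) 0)) ∧
      ∀ ε > 0, ∀ᶠ n in l,
        |Real.log (mgf₂ (μn n) (τn n + hn n) (vn n)) - Real.log (mgf₂ (μn n) (τn n) 0)
          - hn n * (∫ w, coordX w ∂(tilt₂ (μn n) (τn n) 0))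
          - vn n * (∫ w, coordY w ∂(tilt₂ (μn n) (τn n) 0))
          - vn n ^ 2 * (alphaSq μ τ / 2)| ≤ ε * vn n ^ 2 := by
  have hG := integrable_expWeight_of_tendsto hlaw hC0 hC
  have hβ' : |(0 : ℝ)| < β := by simpa
  have hGn : ∀ᶠ n in l, Integrable (expWeight b β) (μn n : Measure (ℕ × ℝ)) :=
    hC.mono fun n hn => integrable_expWeight_of_lintegral_le hn
  obtain ⟨δ, hδ, hδb⟩ : ∃ δ, 0 < δ ∧ τ + 2 * δ < b := ⟨(b - τ) / 4, by linarith, by linarith⟩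
  have hτδ : ∀ᶠ n in l, τn n + δ < b :=
    (hτn.eventually (gt_mem_nhds (show τ < τ + δ by linarith))).mono fun n hn => by linarith
  have hvβ : ∀ᶠ n in l, |vn n| < β :=
    (by simpa using hvn.abs : Tendsto (fun n => |vn n|) l (𝓝 0)).eventually (gt_mem_nhds hβ)
  set ρ : ι → ℝ := fun n => ∫ w, coordX w ∂(tilt₂ (μn n) (τn n) 0) with hρ
  set A := variance coordX (tilt₂ (μ : Measure (ℕ × ℝ)) τ 0) with hA
  set B := covariance coordX coordY (tilt₂ (μ : Measure (ℕ × ℝ)) τ 0) with hB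
  set D := variance coordY (tilt₂ (μ : Measure (ℕ × ℝ)) τ 0) with hD
  have hApos : 0 < A := variance_coordX_tilt₂_pos hG hτ hβ' hconst
  have hα : alphaSq μ τ = D - B ^ 2 / A := alphaSq_eq hG hτ hβ hApos.ne'
  have hcov : ∀ {tn wn : ι → ℝ}, Tendsto tn l (𝓝 τ) → Tendsto wn l (𝓝 0) →
      Tendsto (fun n => variance coordX (tilt₂ (μn n) (tn n) (wn n))) l (𝓝 A) ∧
      Tendsto (fun n => covariance coordX coordY (tilt₂ (μn n) (tn n) (wn n))) l (𝓝 B) ∧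
      Tendsto (fun n => variance coordY (tilt₂ (μn n) (tn n) (wn n))) l (𝓝 D) := by
    intro tn wn htn hwn
    have h1 := tendsto_covariance_tilt₂ hlaw hC0 hC htn hwn hτ hβ' continuous_coordX
      subExp_coordX continuous_coordX subExp_coordX
    have h2 := tendsto_covariance_tilt₂ hlaw hC0 hC htn hwn hτ hβ' continuous_coordX
      subExp_coordX continuous_coordY subExp_coordY
    have h3 := tendsto_covariance_tilt₂ hlaw hC0 hC htn hwn hτ hβ' continuous_coordY
      subExp_coordY continuous_coordY subExp_coordY
    simp_rw [covariance_self continuous_coordX.measurable.aemeasurable] at h1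
    simp_rw [covariance_self continuous_coordY.measurable.aemeasurable] at h3
    exact ⟨h1, h2, h3⟩
  -- The saddle point is a minimiser over `[-δ, δ]`. It becomes a critical point as soon as it lies
  -- in the interior, which follows from `hn → 0`.
  obtain ⟨hn, hhn⟩ := Eventually.choice (r := fun n h => h ∈ Icc (-δ) δ ∧
      IsMinOn (fun h => Real.log (mgf₂ (μn n) (τn n + h) (vn n)) - h * ρ n) (Icc (-δ) δ) h) (by
    filter_upwards [hGn, hτδ, hvβ] with n h1 h2 h3
    exact exists_isMinOn_log_mgf₂ h1 hδ.le h2 h3 (ρ n))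
  have hlim : Tendsto hn l (𝓝 0) := by
    -- Every cluster point `x` of `hn` inherits in the limit the comparison with the competitor `h =
    -- 0`.
    rw [tendsto_iff_ultrafilter]
    intro g hg
    obtain ⟨x, hx, hgx⟩ := (isCompact_Icc (a := -δ) (b := δ)).ultrafilter_le_nhds (g.map hn)
      (by
        rw [le_principal_iff]
        exact (hhn.filter_mono hg).mono fun n hn => hn.1)
    have hgx' : Tendsto hn g (𝓝 x) := hgx
    suffices x = 0 by rwa [this] at hgx'
    by_contra hx0
    have hxb : τ + x < b := by linarith [hx.2]
    have hρg : Tendsto ρ g (𝓝 (∫ w, coordX w ∂(tilt₂ (μ : Measure (ℕ × ℝ)) τ 0))) :=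
      (tendsto_integral_tilt₂ hlaw hC0 hC hτn tendsto_const_nhds hτ hβ' continuous_coordX
        subExp_coordX).mono_left hg
    have h1 := tendsto_mgf₂ (hlaw.mono_left hg) hC0 (hC.filter_mono hg)
      ((hτn.mono_left hg).add hgx') (hvn.mono_left hg) hxb hβ'
    have h2 := tendsto_mgf₂ (hlaw.mono_left hg) hC0 (hC.filter_mono hg)
      (hτn.mono_left hg) (hvn.mono_left hg) hτ hβ'
    have h3 := le_of_tendsto_of_tendsto
      ((h1.log (mgf₂_pos hG hxb hβ').ne').sub (hgx'.mul hρg))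
      (h2.log (mgf₂_pos hG hτ hβ').ne') ((hhn.filter_mono hg).mono fun n hn => by
        have := hn.2 (show (0 : ℝ) ∈ Icc (-δ) δ by simp [hδ.le])
        simpa using this)
    -- For the limit law at `v = 0`, strict convexity makes the value at any `x ≠ 0` strictly larger
    -- than at `0`, a contradiction.
    obtain ⟨θ, hθ, e⟩ := log_mgf₂_sub_eq hG (h := x) (k := 0) hτ hβ' hxb (by simpa)
    have hθb : τ + θ * x < b := by
      rcases le_total 0 x with h | h <;> nlinarith [hθ.1, hθ.2]
    rw [variance_linear_tilt₂ hG hθb (by simpa), add_zero] at e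
    have hpos := variance_coordX_tilt₂_pos hG hθb (v := 0 + θ * 0) (by simpa) hconst
    have : 0 < x ^ 2 * variance coordX (tilt₂ (μ : Measure (ℕ × ℝ)) (τ + θ * x) (0 + θ * 0)) := by
      positivity
    linarith
  -- An exact quadratic expansion along any increment tending to zero, with coefficients taken at
  -- intermediate points that converge to `(τ, 0)`.
  have hdiff : ∀ {kn : ι → ℝ}, Tendsto kn l (𝓝 0) → ∃ tn wn : ι → ℝ, Tendsto tn l (𝓝 τ) ∧
      Tendsto wn l (𝓝 0) ∧ ∀ᶠ n in l,
        Real.log (mgf₂ (μn n) (τn n + kn n) (vn n)) - Real.log (mgf₂ (μn n) (τn n) 0)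
          - kn n * ρ n - vn n * (∫ w, coordY w ∂(tilt₂ (μn n) (τn n) 0)) =
        (kn n ^ 2 * variance coordX (tilt₂ (μn n) (tn n) (wn n))
          + 2 * (kn n * vn n) * covariance coordX coordY (tilt₂ (μn n) (tn n) (wn n))
          + vn n ^ 2 * variance coordY (tilt₂ (μn n) (tn n) (wn n))) / 2 := by
    intro kn hkn
    have hlt := (by simpa using hτn.add hkn : Tendsto (fun n => τn n + kn n) l (𝓝 τ)).eventually
      (gt_mem_nhds hτ)
    have hlt' := hτn.eventually (gt_mem_nhds hτ)
    obtain ⟨θ, hθ⟩ := Eventually.choice (r := fun n θ => θ ∈ Ioo (0 : ℝ) 1 ∧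
        Real.log (mgf₂ (μn n) (τn n + kn n) (0 + vn n)) - Real.log (mgf₂ (μn n) (τn n) 0) =
        kn n * (∫ w, coordX w ∂(tilt₂ (μn n) (τn n) 0))
          + vn n * (∫ w, coordY w ∂(tilt₂ (μn n) (τn n) 0))
        + variance (fun w => kn n * coordX w + vn n * coordY w)
          (tilt₂ (μn n) (τn n + θ * kn n) (0 + θ * vn n)) / 2) (by
      filter_upwards [hGn, hlt, hlt', hvβ] with n h1 h2 h3 h4
      exact log_mgf₂_sub_eq h1 h3 hβ' h2 (by simpa))
    have hbdd : ∀ {f : ι → ℝ}, Tendsto f l (𝓝 0) → Tendsto (fun n => θ n * f n) l (𝓝 0) := by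
      intro f hf
      refine squeeze_zero_norm' (a := fun n => |f n|) ?_ (by simpa using hf.abs)
      filter_upwards [hθ] with n hn
      rw [norm_mul, Real.norm_eq_abs, Real.norm_eq_abs, abs_of_pos hn.1.1]
      exact mul_le_of_le_one_left (abs_nonneg _) hn.1.2.le
    have ht : Tendsto (fun n => τn n + θ n * kn n) l (𝓝 τ) := by simpa using hτn.add (hbdd hkn)
    have hw : Tendsto (fun n => 0 + θ n * vn n) l (𝓝 0) := by simpa using hbdd hvn
    refine ⟨_, _, ht, hw, ?_⟩
    filter_upwards [hθ, hGn, ht.eventually (gt_mem_nhds hτ),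
      (by simpa using hw.abs : Tendsto (fun n => |0 + θ n * vn n|) l (𝓝 0)).eventually
        (gt_mem_nhds hβ)] with n h1 h2 h3 h4
    have e := h1.2
    rw [variance_linear_tilt₂ h2 h3 h4, zero_add] at e
    simp only [hρ, zero_add] at e ⊢
    linarith
  refine ⟨hn, hlim, ?_, ?_⟩
  · have hint : ∀ᶠ n in l, hn n ∈ Ioo (-δ) δ := hlim (Ioo_mem_nhds (by linarith) hδ)
    filter_upwards [hhn, hint, hGn, hτδ, hvβ] with n h1 h2 h3 h4 h5
    refine integral_coordX_tilt₂_of_isLocalMin h3 (by linarith [h2.2]) h5 ?_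
    have hnear : ∀ᶠ t in 𝓝 (0 : ℝ), hn n + t ∈ Icc (-δ) δ := by
      have hc : ContinuousAt (fun t => hn n + t) 0 := by fun_prop
      exact hc (by simpa using Icc_mem_nhds h2.1 h2.2)
    filter_upwards [hnear] with t ht
    have h6 := h1.2 ht
    simp only [mem_ofPred_eq, ← add_assoc] at h6
    simp only [add_zero, zero_mul, sub_zero]
    linarith
  · intro ε hε
    -- The trial increment `-(B / A) v` minimises the limiting quadratic form. Minimality of `hn`
    -- against it gives the upper bound, and completing the square at `hn` gives the lower one, so
    -- no rate for `hn` is needed.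
    have hkn : Tendsto (fun n => -(B / A) * vn n) l (𝓝 0) := by simpa using hvn.const_mul (-(B / A))
    obtain ⟨tn, wn, htn, hwn, e1⟩ := hdiff hlim
    obtain ⟨tn', wn', htn', hwn', e2⟩ := hdiff hkn
    obtain ⟨a1, b1, d1⟩ := hcov htn hwn
    obtain ⟨a2, b2, d2⟩ := hcov htn' hwn'
    have hlow := d1.sub ((b1.pow 2).div a1 hApos.ne')
    have hup := ((a2.const_mul ((B / A) ^ 2)).sub (b2.const_mul (2 * (B / A)))).add d2
    have hupeq : (B / A) ^ 2 * A - 2 * (B / A) * B + D = alphaSq μ τ := by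
      rw [hα]; field_simp; ring
    rw [hupeq] at hup
    rw [← hα] at hlow
    filter_upwards [e1, e2, a1.eventually (lt_mem_nhds hApos),
      hlow.eventually (lt_mem_nhds (show alphaSq μ τ - ε < alphaSq μ τ by linarith)),
      hup.eventually (gt_mem_nhds (show alphaSq μ τ < alphaSq μ τ + ε by linarith)), hhn,
      hkn (Icc_mem_nhds (show -δ < 0 by linarith) hδ)] with n e1 e2 ha hl hu hmin hk
    set a' := variance coordX (tilt₂ (μn n : Measure (ℕ × ℝ)) (tn n) (wn n))
    set b' := covariance coordX coordY (tilt₂ (μn n : Measure (ℕ × ℝ)) (tn n) (wn n))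
    set d' := variance coordY (tilt₂ (μn n : Measure (ℕ × ℝ)) (tn n) (wn n))
    have hm := hmin.2 hk
    simp only [mem_ofPred_eq] at hm
    have hv2 := sq_nonneg (vn n)
    rw [abs_le]
    constructor
    · have hsq : hn n ^ 2 * a' + 2 * (hn n * vn n) * b' + vn n ^ 2 * d'
          = a' * (hn n + vn n * b' / a') ^ 2 + vn n ^ 2 * (d' - b' ^ 2 / a') := by
        field_simp; ring
      have h1 : 0 ≤ a' * (hn n + vn n * b' / a') ^ 2 := by positivity
      have hl' : alphaSq μ τ - ε < d' - b' ^ 2 / a' := hl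
      have h2 := mul_le_mul_of_nonneg_left hl'.le hv2
      simp only [hρ] at e1
      rw [e1, hsq]
      nlinarith
    · have h2 := mul_le_mul_of_nonneg_left hu.le hv2
      simp only [hρ] at e1 e2 hm
      nlinarith

end Limits

/-! ### Characteristic functions of laws of span one -/

/-- If `X` has span one and is not constant, some integer combination of points of its support, with
coefficients of sum zero, equals one. -/
lemma exists_combination_eq_one {μ : Measure (ℕ × ℝ)} [IsProbabilityMeasure μ]
    (hspan : spanX μ = 1) (hconst : ¬ ∃ c : ℕ, ∀ᵐ w ∂μ, w.1 = c) :
    ∃ (F : Finset ℕ) (c : ℕ → ℤ), (∀ k ∈ F, μ {w | w.1 = k} ≠ 0) ∧ ∑ k ∈ F, c k = 0 ∧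
      ∑ k ∈ F, c k * (k : ℤ) = 1 := by
  set S : Set ℕ := {k | μ {w | w.1 = k} ≠ 0} with hS
  have hae : ∀ᵐ w ∂μ, w.1 ∈ S := by
    rw [ae_iff]
    have : {w : ℕ × ℝ | w.1 ∉ S} = ⋃ k ∈ Sᶜ, {w | w.1 = k} := by ext w; simp
    rw [this]
    exact (measure_biUnion_null_iff (to_countable _)).2 fun k hk => not_not.1 hk
  obtain ⟨w0, hw0⟩ := hae.exists
  have hne : ∃ k, k ∈ S := ⟨_, hw0⟩
  classical
  set k0 := Nat.find hne with hk0
  have hk0S : k0 ∈ S := Nat.find_spec hne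
  have hmin : ∀ k ∈ S, k0 ≤ k := fun k hk => Nat.find_min' hne hk
  let e0 : (ℕ →₀ ℤ) →ₗ[ℤ] ℤ := Finsupp.linearCombination ℤ fun _ => (1 : ℤ)
  let e1 : (ℕ →₀ ℤ) →ₗ[ℤ] ℤ := Finsupp.linearCombination ℤ fun k => (k : ℤ)
  -- `H` consists of the integer combinations of support points with coefficients of sum zero; the
  -- goal is `1 ∈ H`. Its generator divides every `k - k0` with `k` in the support.
  let H : Ideal ℤ := Submodule.map e1 (Finsupp.supported ℤ ℤ S ⊓ LinearMap.ker e0)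
  have hdiff : ∀ k ∈ S, ((k : ℤ) - k0) ∈ H := by
    intro k hk
    refine ⟨Finsupp.single k 1 - Finsupp.single k0 1, ⟨?_, ?_⟩, ?_⟩
    · exact Submodule.sub_mem _ (Finsupp.single_mem_supported ℤ _ hk)
        (Finsupp.single_mem_supported ℤ _ hk0S)
    · simp [e0]
    · simp [e1]
  obtain ⟨g, hg⟩ := (IsPrincipalIdealRing.principal H).principal
  have hdvd : ∀ k ∈ S, g.natAbs ∣ k - k0 := by
    intro k hk
    have h1 := hdiff k hk
    rw [hg, Ideal.submodule_span_eq, Ideal.mem_span_singleton] at h1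
    rw [← Int.natCast_dvd_natCast, Nat.cast_sub (hmin k hk)]
    exact Int.natAbs_dvd.2 h1
  have hle : ((g.natAbs : ℕ) : ℕ∞) ≤ 1 := by
    rw [← hspan]
    refine le_iSup₂_of_le g.natAbs ⟨k0, fun k hk => ?_⟩ le_rfl
    obtain ⟨j, hj⟩ := hdvd k hk
    have := hmin k hk
    exact ⟨j, by omega⟩
  have hle' : g.natAbs ≤ 1 := by exact_mod_cast hle
  -- The span bounds the generator by one but does not exclude zero; a zero generator would reduce
  -- the support to `k0`.
  have hg1 : g.natAbs = 1 := by
    refine le_antisymm hle' (Nat.one_le_iff_ne_zero.2 fun h0 => hconst ⟨k0, ?_⟩)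
    filter_upwards [hae] with w hw
    have h1 := hdvd _ hw
    rw [h0, zero_dvd_iff] at h1
    have := hmin _ hw
    omega
  have h1H : (1 : ℤ) ∈ H := by
    rw [hg, Ideal.submodule_span_eq, Ideal.mem_span_singleton]
    exact Int.natAbs_dvd_natAbs.1 (by simp [hg1])
  obtain ⟨c, ⟨hc1, hc2⟩, hc3⟩ := h1H
  refine ⟨c.support, c, fun k hk => (Finsupp.mem_supported ℤ c).1 hc1 hk, ?_, ?_⟩
  · have : e0 c = 0 := hc2
    simpa [e0, Finsupp.linearCombination_apply, Finsupp.sum] using this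
  · simpa [e1, Finsupp.linearCombination_apply, Finsupp.sum] using hc3

/-- Subadditivity of `|sin|`, the source of the bounds for integer combinations that follow. -/
lemma abs_sin_add_le (x y : ℝ) : |Real.sin (x + y)| ≤ |Real.sin x| + |Real.sin y| := by
  rw [Real.sin_add]
  refine (abs_add_le _ _).trans (add_le_add ?_ ?_)
  · rw [abs_mul]; exact mul_le_of_le_one_right (abs_nonneg _) (Real.abs_cos_le_one _)
  · rw [abs_mul]; exact mul_le_of_le_one_left (abs_nonneg _) (Real.abs_cos_le_one _)

lemma abs_sin_natCast_mul_le (n : ℕ) (x : ℝ) : |Real.sin (n * x)| ≤ n * |Real.sin x| := by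
  induction n with
  | zero => simp
  | succ n ih =>
    push_cast
    rw [add_mul, one_mul, add_mul, one_mul]
    exact (abs_sin_add_le _ _).trans (by linarith)

lemma abs_sin_intCast_mul_le (c : ℤ) (x : ℝ) : |Real.sin (c * x)| ≤ |(c : ℝ)| * |Real.sin x| := by
  have h := abs_sin_natCast_mul_le c.natAbs x
  have h2 : ((c.natAbs : ℕ) : ℝ) = |(c : ℝ)| := by rw [Nat.cast_natAbs]; simp
  rw [h2] at h
  refine le_trans (le_of_eq ?_) h
  rcases abs_cases (c : ℝ) with ⟨h3, -⟩ | ⟨h3, -⟩ <;> rw [h3]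
  rw [neg_mul, Real.sin_neg, abs_neg]

lemma abs_sin_sum_le {ι : Type*} (F : Finset ι) (c : ι → ℤ) (x : ι → ℝ) :
    |Real.sin (∑ k ∈ F, c k * x k)| ≤ ∑ k ∈ F, |(c k : ℝ)| * |Real.sin (x k)| := by
  classical
  induction F using Finset.induction_on with
  | empty => simp
  | insert a s ha ih =>
    rw [Finset.sum_insert ha, Finset.sum_insert ha]
    exact (abs_sin_add_le _ _).trans (add_le_add (abs_sin_intCast_mul_le _ _) ih)

/-- The combination of the angles `(t k - θ) / 2` with coefficients `c k` is `t / 2`: the unknown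
phase `θ` drops out because the coefficients sum to zero. Subadditivity of `|sin|`, Jordan's
inequality at `t / 2` and Cauchy–Schwarz conclude. -/
lemma sq_le_mul_sum_sin_sq {F : Finset ℕ} {c : ℕ → ℤ} (h0 : ∑ k ∈ F, c k = 0)
    (h1 : ∑ k ∈ F, c k * (k : ℤ) = 1) {t : ℝ} (ht : |t| ≤ Real.pi) (θ : ℝ) :
    t ^ 2 ≤ Real.pi ^ 2 * (∑ k ∈ F, (c k : ℝ) ^ 2) *
      ∑ k ∈ F, Real.sin ((t * k - θ) / 2) ^ 2 := by
  have h0' : ∑ k ∈ F, (c k : ℝ) = 0 := by exact_mod_cast h0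
  have h1' : ∑ k ∈ F, (c k : ℝ) * k = 1 := by exact_mod_cast h1
  have e : ∑ k ∈ F, (c k : ℝ) * ((t * k - θ) / 2) = t / 2 := by
    have : ∀ k ∈ F, (c k : ℝ) * ((t * k - θ) / 2) = t / 2 * (c k * k) - θ / 2 * c k :=
      fun k _ => by ring
    rw [Finset.sum_congr rfl this, Finset.sum_sub_distrib, ← Finset.mul_sum, ← Finset.mul_sum,
      h0', h1']
    ring
  have h2 := abs_sin_sum_le F c fun k => (t * k - θ) / 2
  rw [e] at h2
  have h3 := Real.mul_abs_le_abs_sin (x := t / 2) (by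
    rw [abs_div, abs_two]; linarith)
  have hpi := Real.pi_pos
  have h4 : |t| ≤ Real.pi * ∑ k ∈ F, |(c k : ℝ)| * |Real.sin ((t * k - θ) / 2)| := by
    have h5 : 2 / Real.pi * |t / 2| = |t| / Real.pi := by rw [abs_div, abs_two]; ring
    rw [h5, div_le_iff₀ hpi] at h3
    nlinarith
  have h6 := Finset.sum_mul_sq_le_sq_mul_sq F (fun k => |(c k : ℝ)|)
    fun k => |Real.sin ((t * k - θ) / 2)|
  simp only [sq_abs] at h6
  calc t ^ 2 = |t| ^ 2 := (sq_abs t).symm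
    _ ≤ (Real.pi * ∑ k ∈ F, |(c k : ℝ)| * |Real.sin ((t * k - θ) / 2)|) ^ 2 := by gcongr
    _ = Real.pi ^ 2 * (∑ k ∈ F, |(c k : ℝ)| * |Real.sin ((t * k - θ) / 2)|) ^ 2 := by ring
    _ ≤ _ := by rw [mul_assoc]; gcongr

/-- The characteristic function of `X - a`. -/
def charX (ν : Measure (ℕ × ℝ)) (a t : ℝ) : ℂ :=
  ∫ w, Complex.exp ((t * (coordX w - a) : ℝ) * Complex.I) ∂ν

lemma integrable_exp_ofReal_mul_I {α : Type*} [MeasurableSpace α] {ν : Measure α}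
    [IsFiniteMeasure ν] {f : α → ℝ} (hf : Measurable f) :
    Integrable (fun w => Complex.exp ((f w : ℝ) * Complex.I)) ν :=
  Integrable.of_bound (by fun_prop) 1
    (ae_of_all _ fun w => by rw [Complex.norm_exp_ofReal_mul_I])

lemma sum_sq_pos_of_combination_eq_one {F : Finset ℕ} {c : ℕ → ℤ}
    (h1 : ∑ k ∈ F, c k * (k : ℤ) = 1) : 0 < ∑ k ∈ F, (c k : ℝ) ^ 2 := by
  refine (Finset.sum_nonneg fun k _ => sq_nonneg _).lt_of_ne fun hQ0 => ?_
  have hz0 := (Finset.sum_eq_zero_iff_of_nonneg fun k _ => sq_nonneg (c k : ℝ)).1 hQ0.symm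
  have : ∑ k ∈ F, c k * (k : ℤ) = 0 := Finset.sum_eq_zero fun k hk => by
    have := hz0 k hk
    simp only [ne_eq, OfNat.ofNat_ne_zero, not_false_eq_true, pow_eq_zero_iff,
      Int.cast_eq_zero] at this
    simp [this]
  omega

/-- A Gaussian upper bound for the characteristic function from finitely many atoms. -/
lemma norm_charX_le {ν : Measure (ℕ × ℝ)} [IsProbabilityMeasure ν] {F : Finset ℕ} {c : ℕ → ℤ}
    (h0 : ∑ k ∈ F, c k = 0) (h1 : ∑ k ∈ F, c k * (k : ℤ) = 1) {δ : ℝ} (hδ : 0 ≤ δ)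
    (hatom : ∀ k ∈ F, δ ≤ ν.real {w | w.1 = k}) (a : ℝ) {t : ℝ} (ht : |t| ≤ Real.pi) :
    ‖charX ν a t‖ ≤ Real.exp (-(2 * δ / (Real.pi ^ 2 * ∑ k ∈ F, (c k : ℝ) ^ 2)) * t ^ 2) := by
  set z := charX ν a t with hz
  obtain ⟨α, hα⟩ : ∃ α, α = Complex.arg z := ⟨_, rfl⟩
  set θ := α + t * a with hθ
  have hcosint : Integrable (fun w => Real.cos (t * coordX w - θ)) ν :=
    Integrable.of_bound (by fun_prop) 1 (ae_of_all _ fun w => Real.abs_cos_le_one _)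
  -- Rotating by the argument of `z` turns its modulus into the mean of a cosine.
  have hnorm : ‖z‖ = ∫ w, Real.cos (t * coordX w - θ) ∂ν := by
    have e1 : (‖z‖ : ℂ) = z * Complex.exp ((-α : ℝ) * Complex.I) := by
      have h := Complex.norm_mul_exp_arg_mul_I z
      rw [← hα] at h
      calc (‖z‖ : ℂ) = (‖z‖ * Complex.exp (α * Complex.I)) * Complex.exp ((-α : ℝ) * Complex.I) := by
            rw [mul_assoc, ← Complex.exp_add]; simp
        _ = _ := by rw [h]
    have e2 : z * Complex.exp ((-α : ℝ) * Complex.I)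
        = ∫ w, Complex.exp ((t * coordX w - θ : ℝ) * Complex.I) ∂ν := by
      rw [hz, charX, ← integral_mul_const]
      congr 1; funext w
      rw [← Complex.exp_add]
      congr 1
      rw [hθ]; push_cast; ring
    have e3 := congrArg Complex.re (e1.trans e2)
    rw [Complex.ofReal_re] at e3
    rw [e3]
    have := integral_re (𝕜 := ℂ) (integrable_exp_ofReal_mul_I (ν := ν)
      (f := fun w => t * coordX w - θ) (by fun_prop))
    rw [← RCLike.re_eq_complex_re, ← this]
    congr 1; funext w
    rw [RCLike.re_eq_complex_re, Complex.exp_ofReal_mul_I_re]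
  have hsin : ∀ w, 1 - Real.cos (t * coordX w - θ) = 2 * Real.sin ((t * coordX w - θ) / 2) ^ 2 := by
    intro w
    rw [Real.sin_sq_eq_half_sub]
    have : 2 * ((t * coordX w - θ) / 2) = t * coordX w - θ := by ring
    rw [this]; ring
  -- `1 - cos` is a nonnegative squared sine, so its mean is at least the contribution of the atoms
  -- in `F`.
  have hlow : 2 * δ * ∑ k ∈ F, Real.sin ((t * k - θ) / 2) ^ 2 ≤ 1 - ‖z‖ := by
    have hmeas : ∀ k : ℕ, MeasurableSet {w : ℕ × ℝ | w.1 = k} := fun k =>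
      measurable_fst (measurableSet_singleton k)
    have hle : ∀ w : ℕ × ℝ, ∑ k ∈ F, ({w : ℕ × ℝ | w.1 = k}.indicator
        (fun _ => 2 * Real.sin ((t * k - θ) / 2) ^ 2) w) ≤ 1 - Real.cos (t * coordX w - θ) := by
      intro w
      rw [hsin w]
      calc ∑ k ∈ F, ({w : ℕ × ℝ | w.1 = k}.indicator
            (fun _ => 2 * Real.sin ((t * k - θ) / 2) ^ 2) w)
          = ∑ k ∈ F, if w.1 = k then 2 * Real.sin ((t * coordX w - θ) / 2) ^ 2 else 0 := by
            refine Finset.sum_congr rfl fun k _ => ?_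
            by_cases h : w.1 = k
            · simp [indicator, h, coordX]
            · simp [indicator, h]
        _ ≤ _ := by
            rw [Finset.sum_ite_eq]
            split_ifs
            · exact le_rfl
            · positivity
    have hmono := integral_mono (μ := ν) (integrable_finsetSum F fun k _ =>
      (integrable_const (2 * Real.sin ((t * k - θ) / 2) ^ 2)).indicator (hmeas k))
      ((integrable_const (1 : ℝ)).sub hcosint) hle
    rw [integral_finsetSum _ fun k _ => (integrable_const _).indicator (hmeas k)] at hmono
    simp only [Pi.sub_apply] at hmono
    rw [integral_sub (integrable_const _) hcosint, ← hnorm, integral_const, probReal_univ,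
      one_smul] at hmono
    refine le_trans ?_ hmono
    rw [Finset.mul_sum]
    refine Finset.sum_le_sum fun k hk => ?_
    rw [integral_indicator_const _ (hmeas k), smul_eq_mul]
    nlinarith [hatom k hk, sq_nonneg (Real.sin ((t * k - θ) / 2))]
  have hsq := sq_le_mul_sum_sin_sq h0 h1 ht θ
  set Q := ∑ k ∈ F, (c k : ℝ) ^ 2 with hQ
  set S := ∑ k ∈ F, Real.sin ((t * k - θ) / 2) ^ 2 with hSdef
  have hQpos : 0 < Q := sum_sq_pos_of_combination_eq_one h1
  have hpi := Real.pi_pos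
  have h5 : 2 * δ / (Real.pi ^ 2 * Q) * t ^ 2 ≤ 1 - ‖z‖ := by
    refine le_trans ?_ hlow
    rw [div_mul_eq_mul_div, div_le_iff₀ (by positivity)]
    nlinarith
  have h6 := Real.add_one_le_exp (-(2 * δ / (Real.pi ^ 2 * Q)) * t ^ 2)
  linarith

/-! ### A local limit theorem in Fourier form -/

/-- Taylor's bound for `|y| ≤ 1`; for `|y| ≥ 1` each of the terms `1`, `1`, `|y|`, `y² / 2` is
bounded through `|y|³`. The constant `4` covers both ranges. -/
lemma norm_exp_mul_I_sub_le (y : ℝ) :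
    ‖Complex.exp (y * Complex.I) - (1 + y * Complex.I - (y ^ 2 / 2 : ℝ))‖ ≤ 4 * |y| ^ 3 := by
  have hn : ‖(y * Complex.I : ℂ)‖ = |y| := by simp
  have hy := abs_nonneg y
  rcases le_total |y| 1 with h | h
  · have h1 := Complex.exp_bound (x := y * Complex.I) (by rw [hn]; exact h) (n := 3) (by norm_num)
    rw [hn] at h1
    have e : ∑ m ∈ Finset.range 3, (y * Complex.I : ℂ) ^ m / (m.factorial : ℂ)
        = 1 + y * Complex.I - (y ^ 2 / 2 : ℝ) := by
      have e2 : (y * Complex.I : ℂ) ^ 2 = -(y : ℂ) ^ 2 := by rw [mul_pow, Complex.I_sq]; ring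
      rw [Finset.sum_range_succ, Finset.sum_range_succ, Finset.sum_range_one, e2]
      push_cast [Nat.factorial]; ring
    rw [e] at h1
    refine h1.trans ?_
    have h3 : 0 ≤ |y| ^ 3 := by positivity
    norm_num [Nat.factorial]
    nlinarith
  · have h1 : ‖(1 + y * Complex.I - (y ^ 2 / 2 : ℝ) : ℂ)‖ ≤ 1 + |y| + y ^ 2 / 2 := by
      refine (norm_sub_le _ _).trans (add_le_add ((norm_add_le _ _).trans ?_) ?_)
      · rw [hn]; simp
      · rw [Complex.norm_real, Real.norm_of_nonneg (by positivity)]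
    refine (norm_sub_le _ _).trans ?_
    rw [Complex.norm_exp_ofReal_mul_I]
    have h2 : y ^ 2 = |y| ^ 2 := (sq_abs y).symm
    have h3 : |y| ^ 2 ≤ |y| ^ 3 := pow_le_pow_right₀ h (by norm_num)
    have h4 : |y| ≤ |y| ^ 2 := by nlinarith
    linarith

/-- The linear term integrates to zero because `a` is the mean, and `|X - a|³ ≤ X³ + a³` since both
are nonnegative. -/
lemma norm_charX_sub_le {ν : Measure (ℕ × ℝ)} [IsProbabilityMeasure ν] {a : ℝ} (ha : 0 ≤ a)
    (hX2 : MemLp coordX 2 ν) (hX3 : Integrable (fun w => coordX w ^ 3) ν)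
    (hmean : ∫ w, coordX w ∂ν = a) (t : ℝ) :
    ‖charX ν a t - (1 - (variance coordX ν * t ^ 2 / 2 : ℝ))‖
      ≤ 4 * (∫ w, coordX w ^ 3 ∂ν + a ^ 3) * |t| ^ 3 := by
  have hX1 : Integrable coordX ν := hX2.integrable (by norm_num)
  have hc1 : Integrable (fun w => coordX w - a) ν := hX1.sub (integrable_const a)
  have hc2 : Integrable (fun w => (coordX w - a) ^ 2) ν :=
    (hX2.sub (memLp_const a)).integrable_sq
  have hvar : variance coordX ν = ∫ w, (coordX w - a) ^ 2 ∂ν := by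
    rw [variance_eq_integral (by fun_prop), hmean]
  have hpoly : Integrable (fun w => ((1 : ℂ) + (t * (coordX w - a) : ℝ) * Complex.I
      - ((t * (coordX w - a)) ^ 2 / 2 : ℝ))) ν := by
    refine ((integrable_const _).add ((hc1.const_mul t).ofReal.mul_const _)).sub ?_
    have : Integrable (fun w => (t * (coordX w - a)) ^ 2 / 2) ν := by
      refine (hc2.const_mul (t ^ 2 / 2)).congr (ae_of_all _ fun w => ?_)
      simp only; ring
    exact this.ofReal
  have hint : ∫ w, ((1 : ℂ) + (t * (coordX w - a) : ℝ) * Complex.I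
      - ((t * (coordX w - a)) ^ 2 / 2 : ℝ)) ∂ν = 1 - (variance coordX ν * t ^ 2 / 2 : ℝ) := by
    have i1 : Integrable (fun w => (1 : ℂ) + (t * (coordX w - a) : ℝ) * Complex.I) ν :=
      (integrable_const _).add ((hc1.const_mul t).ofReal.mul_const _)
    have i2 : Integrable (fun w => (((t * (coordX w - a)) ^ 2 / 2 : ℝ) : ℂ)) ν := by
      have : Integrable (fun w => (t * (coordX w - a)) ^ 2 / 2) ν := by
        refine (hc2.const_mul (t ^ 2 / 2)).congr (ae_of_all _ fun w => ?_)
        simp only; ring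
      exact this.ofReal
    rw [integral_sub i1 i2, integral_add (integrable_const _)
      ((hc1.const_mul t).ofReal.mul_const _), integral_mul_const, integral_complex_ofReal,
      integral_complex_ofReal, integral_const_mul, integral_sub hX1 (integrable_const a), hmean,
      hvar]
    have : ∫ w, (t * (coordX w - a)) ^ 2 / 2 ∂ν = (∫ w, (coordX w - a) ^ 2 ∂ν) * t ^ 2 / 2 := by
      rw [← integral_mul_const, ← integral_div]
      congr 1; funext w; ring
    rw [this]
    simp
  have hexp := integrable_exp_ofReal_mul_I (ν := ν) (f := fun w => t * (coordX w - a))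
    (by fun_prop)
  rw [← hint, charX, ← integral_sub hexp hpoly]
  calc ‖∫ w, (Complex.exp ((t * (coordX w - a) : ℝ) * Complex.I)
        - ((1 : ℂ) + (t * (coordX w - a) : ℝ) * Complex.I
          - ((t * (coordX w - a)) ^ 2 / 2 : ℝ))) ∂ν‖
      ≤ ∫ w, 4 * |t| ^ 3 * (coordX w ^ 3 + a ^ 3) ∂ν := by
        refine norm_integral_le_of_norm_le ((hX3.add (integrable_const _)).const_mul _)
          (ae_of_all _ fun w => (norm_exp_mul_I_sub_le _).trans ?_)
        rw [abs_mul, mul_pow, ← mul_assoc]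
        refine mul_le_mul_of_nonneg_left ?_ (by positivity)
        have hx := coordX_nonneg w
        rcases le_total (coordX w) a with h | h
        · rw [abs_of_nonpos (by linarith)]
          have : (-(coordX w - a)) ^ 3 ≤ a ^ 3 := pow_le_pow_left₀ (by linarith) (by linarith) 3
          have := pow_nonneg hx 3
          linarith
        · rw [abs_of_nonneg (by linarith)]
          have : (coordX w - a) ^ 3 ≤ coordX w ^ 3 :=
            pow_le_pow_left₀ (by linarith) (by linarith) 3
          have := pow_nonneg ha 3
          linarith
    _ = _ := by
        rw [integral_const_mul, integral_add hX3 (integrable_const _), integral_const,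
          probReal_univ, one_smul]
        ring

lemma norm_pow_sub_pow_le_mul {x y : ℂ} (hx : ‖x‖ ≤ 1) (hy : ‖y‖ ≤ 1) (N : ℕ) :
    ‖x ^ N - y ^ N‖ ≤ N * ‖x - y‖ := by
  induction N with
  | zero => simp
  | succ N ih =>
    have e : x ^ (N + 1) - y ^ (N + 1) = x * (x ^ N - y ^ N) + (x - y) * y ^ N := by ring
    rw [e]
    refine (norm_add_le _ _).trans ?_
    rw [norm_mul, norm_mul, norm_pow]
    push_cast
    have h1 : ‖x‖ * ‖x ^ N - y ^ N‖ ≤ 1 * (N * ‖x - y‖) :=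
      mul_le_mul hx ih (norm_nonneg _) zero_le_one
    have h2 : ‖x - y‖ * ‖y‖ ^ N ≤ ‖x - y‖ * 1 :=
      mul_le_mul_of_nonneg_left (pow_le_one₀ (norm_nonneg _) hy) (norm_nonneg _)
    linarith

/-- With `y n = A n x² / (2 N)`, both `ψ n (x / √N)` and `exp (-y n)` lie in the unit disc and
differ by `O(N^(-3/2)) + y n²`. Taking `N`-th powers multiplies the error by at most `N`, and it
still tends to zero. -/
lemma tendsto_pow_of_quadratic_expansion {l : Filter ℕ} {ψ : ℕ → ℝ → ℂ} {N : ℕ → ℕ} {A : ℕ → ℝ}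
    {A0 M : ℝ} (hN : Tendsto N l atTop) (hA : Tendsto A l (𝓝 A0)) (hA0 : 0 < A0)
    (hle : ∀ᶠ n in l, ∀ t, ‖ψ n t‖ ≤ 1)
    (hψ : ∀ᶠ n in l, ∀ t, ‖ψ n t - (1 - (A n * t ^ 2 / 2 : ℝ))‖ ≤ M * |t| ^ 3) (x : ℝ) :
    Tendsto (fun n => ψ n (x / √(N n)) ^ N n) l (𝓝 (Real.exp (-(A0 / 2) * x ^ 2) : ℝ)) := by
  have hN' : Tendsto (fun n => (N n : ℝ)) l atTop := tendsto_natCast_atTop_atTop.comp hN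
  have hs : Tendsto (fun n => √(N n : ℝ)) l atTop := Real.tendsto_sqrt_atTop.comp hN'
  set y : ℕ → ℝ := fun n => A n * x ^ 2 / 2 / N n with hy
  have hylim : Tendsto y l (𝓝 0) :=
    (((hA.mul_const (x ^ 2)).div_const 2).div_atTop hN')
  have hpow : ∀ᶠ n in l, Real.exp (-(y n)) ^ N n = Real.exp (-(A n / 2) * x ^ 2) := by
    filter_upwards [hN'.eventually_gt_atTop 0] with n hn
    rw [← Real.exp_nat_mul]
    congr 1
    simp only [hy]; field_simp
  have hmain : Tendsto (fun n => ((Real.exp (-(y n)) : ℝ) : ℂ) ^ N n) l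
      (𝓝 (Real.exp (-(A0 / 2) * x ^ 2) : ℝ)) := by
    have h1 : Tendsto (fun n => Real.exp (-(A n / 2) * x ^ 2)) l
        (𝓝 (Real.exp (-(A0 / 2) * x ^ 2))) :=
      (Real.continuous_exp.tendsto _).comp (((hA.div_const 2).neg).mul_const _)
    refine ((Complex.continuous_ofReal.tendsto _).comp h1).congr' ?_
    filter_upwards [hpow] with n hn
    simp only [Function.comp_apply]
    rw [← hn]; push_cast; rfl
  have herr : Tendsto (fun n => M * |x| ^ 3 / √(N n) + (A n * x ^ 2 / 2) * y n) l (𝓝 0) := by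
    have h1 : Tendsto (fun n => M * |x| ^ 3 / √(N n : ℝ)) l (𝓝 0) :=
      tendsto_const_nhds.div_atTop hs
    simpa using h1.add (((hA.mul_const (x ^ 2)).div_const 2).mul hylim)
  refine tendsto_iff_norm_sub_tendsto_zero.2 ?_
  have hdiff : Tendsto (fun n => ψ n (x / √(N n)) ^ N n - ((Real.exp (-(y n)) : ℝ) : ℂ) ^ N n) l
      (𝓝 0) := by
    refine squeeze_zero_norm' ?_ herr
    filter_upwards [hle, hψ, hN'.eventually_gt_atTop 0, hA.eventually (lt_mem_nhds hA0),
      hylim.eventually (gt_mem_nhds (show (0 : ℝ) < 1 by norm_num))] with n h1 h2 h3 h4 h5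
    have hy0 : 0 ≤ y n := by simp only [hy]; positivity
    have hb : ‖((Real.exp (-(y n)) : ℝ) : ℂ)‖ ≤ 1 := by
      rw [Complex.norm_real, Real.norm_of_nonneg (Real.exp_pos _).le]
      exact Real.exp_le_one_iff.2 (by linarith)
    refine (norm_pow_sub_pow_le_mul (h1 _) hb _).trans ?_
    have hsq : √(N n : ℝ) ^ 2 = N n := Real.sq_sqrt h3.le
    have hspos : 0 < √(N n : ℝ) := Real.sqrt_pos.2 h3
    have e1 : A n * (x / √(N n)) ^ 2 / 2 = y n := by
      rw [div_pow, hsq]; simp only [hy]; ring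
    have h6 := h2 (x / √(N n))
    rw [e1, abs_div, abs_of_pos hspos, div_pow] at h6
    have h7 : ‖((Real.exp (-(y n)) : ℝ) : ℂ) - (1 - (y n : ℝ))‖ ≤ y n ^ 2 := by
      have := Real.abs_exp_sub_one_sub_id_le (x := -(y n)) (by rw [abs_neg, abs_of_nonneg hy0]; exact h5.le)
      have e : ((Real.exp (-(y n)) : ℝ) : ℂ) - (1 - (y n : ℝ))
          = ((Real.exp (-(y n)) - 1 - -(y n) : ℝ) : ℂ) := by push_cast; ring
      rw [e, Complex.norm_real, Real.norm_eq_abs]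
      simpa using this
    have h8 : ‖ψ n (x / √(N n)) - ((Real.exp (-(y n)) : ℝ) : ℂ)‖
        ≤ M * (|x| ^ 3 / √(N n) ^ 3) + y n ^ 2 := by
      have e : ψ n (x / √(N n)) - ((Real.exp (-(y n)) : ℝ) : ℂ)
        = (ψ n (x / √(N n)) - (1 - (y n : ℝ)))
          - (((Real.exp (-(y n)) : ℝ) : ℂ) - (1 - (y n : ℝ))) := by ring
      rw [e]
      exact (norm_sub_le _ _).trans (add_le_add h6 h7)
    refine (mul_le_mul_of_nonneg_left h8 h3.le).trans (le_of_eq ?_)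
    have e3 : (N n : ℝ) * y n = A n * x ^ 2 / 2 := by simp only [hy]; field_simp
    have e4 : (N n : ℝ) * (|x| ^ 3 / √(N n) ^ 3) = |x| ^ 3 / √(N n) := by
      have : √(N n : ℝ) ^ 3 = N n * √(N n) := by rw [← hsq]; ring_nf; rw [Real.sqrt_sq hspos.le]; ring
      rw [this]; field_simp
    calc (N n : ℝ) * (M * (|x| ^ 3 / √(N n) ^ 3) + y n ^ 2)
        = M * ((N n : ℝ) * (|x| ^ 3 / √(N n) ^ 3)) + ((N n : ℝ) * y n) * y n := by ring
      _ = _ := by rw [e3, e4]; ring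
  have := (hdiff.add hmain).sub_const ((Real.exp (-(A0 / 2) * x ^ 2) : ℝ) : ℂ)
  simpa using this.norm

/-- The Fourier integral of a local limit theorem. -/
lemma tendsto_sqrt_mul_integral_pow {ψ : ℕ → ℝ → ℂ} {N : ℕ → ℕ} {A : ℕ → ℝ}
    {A0 M κ : ℝ} (hN : Tendsto N atTop atTop) (hA : Tendsto A atTop (𝓝 A0)) (hA0 : 0 < A0)
    (hκ : 0 < κ) (hcont : ∀ n, Measurable (ψ n))
    (hle : ∀ᶠ n in atTop, ∀ t, ‖ψ n t‖ ≤ 1)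
    (hψ : ∀ᶠ n in atTop, ∀ t, ‖ψ n t - (1 - (A n * t ^ 2 / 2 : ℝ))‖ ≤ M * |t| ^ 3)
    (hgauss : ∀ᶠ n in atTop, ∀ t, |t| ≤ Real.pi → ‖ψ n t‖ ≤ Real.exp (-κ * t ^ 2)) :
    Tendsto (fun n => (√(N n) : ℂ) * ∫ t in (-Real.pi)..Real.pi, ψ n t ^ N n) atTop
      (𝓝 (√(Real.pi / (A0 / 2)) : ℝ)) := by
  have hN' : Tendsto (fun n => (N n : ℝ)) atTop atTop := tendsto_natCast_atTop_atTop.comp hN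
  have hs : Tendsto (fun n => √(N n : ℝ)) atTop atTop := Real.tendsto_sqrt_atTop.comp hN'
  have hpi := Real.pi_pos
  -- The substitution `t = x / √N` spreads the integral over a growing interval. The Gaussian bound
  -- on `[-π, π]` becomes the fixed majorant `exp (-κ x²)`.
  have hlim : Tendsto (fun n => ∫ x : ℝ, (Ioc (-Real.pi * √(N n)) (Real.pi * √(N n))).indicator
      (fun x => ψ n (x / √(N n)) ^ N n) x) atTop
      (𝓝 (∫ x : ℝ, ((Real.exp (-(A0 / 2) * x ^ 2) : ℝ) : ℂ))) := by
    refine tendsto_integral_filter_of_dominated_convergence (fun x => Real.exp (-κ * x ^ 2))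
      (Eventually.of_forall fun n => ?_) ?_ (integrable_exp_neg_mul_sq hκ) (ae_of_all _ fun x => ?_)
    · have : Measurable fun x : ℝ => ψ n (x / √(N n)) ^ N n :=
        ((hcont n).comp (measurable_id.div_const _)).pow_const _
      exact (this.indicator measurableSet_Ioc).aestronglyMeasurable
    · filter_upwards [hgauss, hN'.eventually_gt_atTop 0] with n h1 h2
      refine ae_of_all _ fun x => ?_
      have hspos : 0 < √(N n : ℝ) := Real.sqrt_pos.2 h2
      by_cases hx : x ∈ Ioc (-Real.pi * √(N n)) (Real.pi * √(N n))
      · rw [indicator_of_mem hx, norm_pow]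
        have h3 : |x / √(N n)| ≤ Real.pi := by
          rw [abs_le, le_div_iff₀ hspos, div_le_iff₀ hspos]
          exact ⟨hx.1.le, hx.2⟩
        refine (pow_le_pow_left₀ (norm_nonneg _) (h1 _ h3) _).trans (le_of_eq ?_)
        rw [← Real.exp_nat_mul, div_pow, Real.sq_sqrt h2.le]
        congr 1; field_simp
      · rw [indicator_of_notMem hx, norm_zero]; exact (Real.exp_pos _).le
    · refine (tendsto_pow_of_quadratic_expansion hN hA hA0 hle hψ x).congr' ?_
      have h1 : Tendsto (fun n => Real.pi * √(N n : ℝ)) atTop atTop := hs.const_mul_atTop hpi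
      filter_upwards [h1.eventually_gt_atTop |x|] with n hn
      rw [indicator_of_mem]
      have := abs_lt.1 hn
      exact ⟨by linarith [this.1], this.2.le⟩
  rw [integral_complex_ofReal, integral_gaussian] at hlim
  refine hlim.congr' ?_
  filter_upwards [hN'.eventually_gt_atTop 0] with n h2
  have hspos : 0 < √(N n : ℝ) := Real.sqrt_pos.2 h2
  rw [integral_indicator measurableSet_Ioc, ← intervalIntegral.integral_of_le (by nlinarith)]
  have := intervalIntegral.integral_comp_div (f := fun t => ψ n t ^ N n) (a := -Real.pi * √(N n))
    (b := Real.pi * √(N n)) hspos.ne'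
  rw [this, mul_div_assoc, mul_div_assoc, div_self hspos.ne', mul_one, mul_one]
  rw [Complex.real_smul]

/-! ### Fourier inversion for exponential moments on a level set -/

lemma integral_exp_mul_intCast_mul_I (m : ℤ) :
    ∫ t in (-Real.pi)..Real.pi, Complex.exp ((t * m : ℝ) * Complex.I)
      = if m = 0 then (2 * Real.pi : ℂ) else 0 := by
  split_ifs with h
  · simp only [h, Int.cast_zero, mul_zero, Complex.ofReal_zero, zero_mul, Complex.exp_zero]
    rw [intervalIntegral.integral_const]
    simp only [Complex.real_smul, mul_one]
    push_cast; ring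
  · have hc : (m * Complex.I : ℂ) ≠ 0 := mul_ne_zero (by exact_mod_cast h) Complex.I_ne_zero
    have e : ∀ t : ℝ, Complex.exp ((t * m : ℝ) * Complex.I) = Complex.exp (m * Complex.I * t) := by
      intro t; congr 1; push_cast; ring
    simp_rw [e]
    rw [integral_exp_mul_complex hc]
    have e2 : (m * Complex.I * (Real.pi : ℝ) : ℂ)
        = m * Complex.I * ((-Real.pi : ℝ) : ℂ) + m * (2 * Real.pi * Complex.I) := by
      push_cast; ring
    rw [e2, Complex.exp_add, Complex.exp_int_mul_two_pi_mul_I, mul_one, sub_self, zero_div]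

lemma continuous_charX {ν : Measure (ℕ × ℝ)} [IsFiniteMeasure ν] (a : ℝ) :
    Continuous (charX ν a) := by
  unfold charX
  refine continuous_of_dominated (F := fun t w => Complex.exp ((t * (coordX w - a) : ℝ) * Complex.I))
    (bound := fun _ => 1) (fun t => ?_) (fun t => ae_of_all _ fun w => ?_)
    (integrable_const _) (ae_of_all _ fun w => by fun_prop)
  · exact (integrable_exp_ofReal_mul_I (by fun_prop)).aestronglyMeasurable
  · rw [Complex.norm_exp_ofReal_mul_I]

lemma norm_charX_le_one {ν : Measure (ℕ × ℝ)} [IsProbabilityMeasure ν] (a t : ℝ) :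
    ‖charX ν a t‖ ≤ 1 := by
  refine (norm_integral_le_of_norm_le_const (C := 1) (ae_of_all _ fun w => ?_)).trans (by simp)
  rw [Complex.norm_exp_ofReal_mul_I]

lemma integral_expLin_mul_exp_eq {μ : Measure (ℕ × ℝ)} {s v a t : ℝ} (hL : mgf₂ μ s v ≠ 0) :
    ∫ w, (expLin s v w : ℂ) * Complex.exp ((t * (coordX w - a) : ℝ) * Complex.I) ∂μ
      = mgf₂ μ s v * charX (tilt₂ μ s v) a t := by
  rw [charX, tilt₂, integral_tilted, ← integral_const_mul]
  congr 1; funext w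
  rw [Complex.real_smul]
  change _ = (mgf₂ μ s v : ℂ) * (((expLin s v w / mgf₂ μ s v : ℝ) : ℂ) * _)
  have : (mgf₂ μ s v : ℂ) ≠ 0 := by exact_mod_cast hL
  push_cast
  field_simp

lemma prod_expLin_eq {Ω : Type*} {N : ℕ} {W : Fin N → Ω → ℕ × ℝ} (s v : ℝ) (ω : Ω) :
    ∏ i, expLin s v (W i ω) = Real.exp (s * sumX W ω + v * sumY W ω) := by
  simp only [expLin]
  rw [← Real.exp_sum, Finset.sum_add_distrib, ← Finset.mul_sum, ← Finset.mul_sum]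
  simp [sumX, sumY, coordX, coordY]

section IndepSums

variable {Ω : Type*} [MeasurableSpace Ω] {P : Measure Ω} {N : ℕ} {W : Fin N → Ω → ℕ × ℝ}
  {μ : Measure (ℕ × ℝ)}

lemma aemeasurable_sumX (hlaw : ∀ i, HasLaw (W i) μ P) : AEMeasurable (sumX W) P := by
  unfold sumX
  exact Finset.aemeasurable_fun_sum _ fun i _ => measurable_fst.comp_aemeasurable (hlaw i).aemeasurable

lemma aemeasurable_sumY (hlaw : ∀ i, HasLaw (W i) μ P) : AEMeasurable (sumY W) P := by
  unfold sumY
  exact Finset.aemeasurable_fun_sum _ fun i _ => measurable_snd.comp_aemeasurable (hlaw i).aemeasurable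

lemma nullMeasurableSet_sumX_eq (hlaw : ∀ i, HasLaw (W i) μ P) (k : ℕ) :
    NullMeasurableSet {ω | sumX W ω = k} P :=
  (aemeasurable_sumX hlaw).nullMeasurableSet_preimage (measurableSet_singleton k)

lemma integrable_exp_sum [IsProbabilityMeasure μ] [IsProbabilityMeasure P]
    (hlaw : ∀ i, HasLaw (W i) μ P)
    (hind : iIndepFun W P) {b β s v : ℝ} (hG : Integrable (expWeight b β) μ) (hs : s < b)
    (hv : |v| < β) :
    Integrable (fun ω => Real.exp (s * sumX W ω + v * sumY W ω)) P := by
  simp_rw [← prod_expLin_eq]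
  have h1 : Integrable (fun x : Fin N → ℕ × ℝ => ∏ i, expLin s v (x i))
      (Measure.pi fun i => P.map (W i)) :=
    Integrable.fintype_prod (f := fun _ => expLin s v) fun i => by
      rw [(hlaw i).map_eq]; exact integrable_expLin hG hs hv
  rw [← hind.map_fun_eq_pi_map fun i => (hlaw i).aemeasurable] at h1
  exact h1.comp_aemeasurable (aemeasurable_pi_lambda _ fun i => (hlaw i).aemeasurable)

/-- Fourier inversion for the exponential moments of `T` on `{S = k}`. -/
lemma two_pi_mul_setIntegral_exp_sumY [IsProbabilityMeasure μ] [IsProbabilityMeasure P]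
    (hlaw : ∀ i, HasLaw (W i) μ P)
    (hind : iIndepFun W P) {b β s v : ℝ} (hG : Integrable (expWeight b β) μ) (hs : s < b)
    (hv : |v| < β) {k : ℕ} {a : ℝ} (hk : N * a = k) :
    ((2 * Real.pi * Real.exp (s * k) * ∫ ω in {ω | sumX W ω = k}, Real.exp (v * sumY W ω) ∂P : ℝ) : ℂ)
      = (mgf₂ μ s v : ℂ) ^ N * ∫ t in (-Real.pi)..Real.pi, charX (tilt₂ μ s v) a t ^ N := by
  have hpi : -Real.pi ≤ Real.pi := by linarith [Real.pi_pos]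
  have hL := (mgf₂_pos hG hs hv).ne'
  set f : Ω → ℝ := fun ω => Real.exp (s * sumX W ω + v * sumY W ω) with hf
  have hfint : Integrable f P := integrable_exp_sum hlaw hind hG hs hv
  -- Integrated in `t`, `Φ` gives `2π` on `{S = k}` times the weight, by orthogonality of
  -- characters. Integrated in `ω`, it factorises by independence, `k = N * a` being shared equally
  -- among the factors. Fubini equates the two.
  let Φ : Ω → ℝ → ℂ := fun ω t => (f ω : ℂ) * Complex.exp ((t * (sumX W ω - k) : ℝ) * Complex.I)
  have hΦprod : ∀ ω t, Φ ω t = ∏ i, ((expLin s v (W i ω) : ℂ)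
      * Complex.exp ((t * (coordX (W i ω) - a) : ℝ) * Complex.I)) := by
    intro ω t
    rw [Finset.prod_mul_distrib, ← Complex.exp_sum, ← Complex.ofReal_prod, prod_expLin_eq,
      ← Finset.sum_mul, ← Complex.ofReal_sum, ← Finset.mul_sum, Finset.sum_sub_distrib]
    simp only [Φ, hf, Finset.sum_const, Finset.card_univ, Fintype.card_fin, nsmul_eq_mul, hk]
    simp [sumX, coordX]
  have hinner : ∀ t, ∫ ω, Φ ω t ∂P = (mgf₂ μ s v * charX (tilt₂ μ s v) a t) ^ N := by
    intro t
    simp_rw [hΦprod]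
    have hm : Measurable fun w : ℕ × ℝ => (expLin s v w : ℂ)
      * Complex.exp ((t * (coordX w - a) : ℝ) * Complex.I) := by
      have := (continuous_expLin s v).measurable
      fun_prop
    rw [hind.integral_fun_prod_comp (f := fun _ w => (expLin s v w : ℂ)
      * Complex.exp ((t * (coordX w - a) : ℝ) * Complex.I)) (fun i => (hlaw i).aemeasurable)
      (fun i => hm.aestronglyMeasurable)]
    have : ∀ i, ∫ ω, (expLin s v (W i ω) : ℂ)
        * Complex.exp ((t * (coordX (W i ω) - a) : ℝ) * Complex.I) ∂P
        = mgf₂ μ s v * charX (tilt₂ μ s v) a t := by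
      intro i
      rw [← integral_expLin_mul_exp_eq hL]
      exact (hlaw i).integral_comp hm.aestronglyMeasurable
    rw [Finset.prod_congr rfl fun i _ => this i]
    simp
  have houter : ∀ ω, ∫ t in (-Real.pi)..Real.pi, Φ ω t
      = ((({ω | sumX W ω = k}.indicator (fun ω => 2 * Real.pi * Real.exp (s * k)
        * Real.exp (v * sumY W ω)) ω : ℝ)) : ℂ) := by
    intro ω
    simp only [Φ]
    rw [intervalIntegral.integral_const_mul]
    have := integral_exp_mul_intCast_mul_I ((sumX W ω : ℤ) - k)
    push_cast at this ⊢
    rw [this]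
    by_cases h : sumX W ω = k
    · rw [indicator_of_mem (show ω ∈ {ω | sumX W ω = k} from h), if_pos (by simp [h])]
      simp only [hf, h, Real.exp_add]
      push_cast; ring
    · rw [indicator_of_notMem (show ω ∉ {ω | sumX W ω = k} from h), if_neg (by
        rw [sub_eq_zero]; exact_mod_cast h)]
      simp
  have hswap : ∫ ω, (∫ t in (-Real.pi)..Real.pi, Φ ω t) ∂P
      = ∫ t in (-Real.pi)..Real.pi, (∫ ω, Φ ω t ∂P) := by
    simp_rw [intervalIntegral.integral_of_le hpi]
    refine integral_integral_swap ?_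
    have hSm : AEMeasurable (fun ω => (sumX W ω : ℝ)) P :=
      (measurable_of_countable _).comp_aemeasurable (aemeasurable_sumX hlaw)
    refine Integrable.mono' (hfint.mul_prod (integrable_const (1 : ℝ))) ?_ (ae_of_all _ ?_)
    · refine AEMeasurable.aestronglyMeasurable ?_
      have h1 : AEMeasurable (fun z : Ω × ℝ => f z.1)
        (P.prod (volume.restrict (Ioc (-Real.pi) Real.pi))) := hfint.aemeasurable.comp_fst
      have h2 : AEMeasurable (fun z : Ω × ℝ => (sumX W z.1 : ℝ))
        (P.prod (volume.restrict (Ioc (-Real.pi) Real.pi))) := hSm.comp_fst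
      have h3 : AEMeasurable (fun z : Ω × ℝ => z.2 * (sumX W z.1 - k))
        (P.prod (volume.restrict (Ioc (-Real.pi) Real.pi))) :=
        measurable_snd.aemeasurable.mul (h2.sub_const _)
      exact (Complex.measurable_ofReal.comp_aemeasurable h1).mul
        (Complex.measurable_exp.comp_aemeasurable
          ((Complex.measurable_ofReal.comp_aemeasurable h3).mul_const _))
    · rintro ⟨ω, t⟩
      simp only [Function.uncurry_apply_pair, Φ, norm_mul, Complex.norm_exp_ofReal_mul_I, mul_one,
        Complex.norm_real]
      rw [Real.norm_of_nonneg (Real.exp_pos _).le]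
  simp_rw [houter, hinner, mul_pow] at hswap
  rw [intervalIntegral.integral_const_mul, integral_complex_ofReal,
    integral_indicator₀ (nullMeasurableSet_sumX_eq hlaw k), integral_const_mul] at hswap
  exact hswap

end IndepSums

/-! ### Conditional exponential moments -/

/-- The tilt is finite even where the weight is not integrable, so measurability of `charX` holds
for every `n` and not just eventually. -/
instance isZeroOrProbabilityMeasure_tilt₂ (ν : Measure (ℕ × ℝ)) (s v : ℝ) :
    IsZeroOrProbabilityMeasure (tilt₂ ν s v) :=
  inferInstanceAs (IsZeroOrProbabilityMeasure (ν.tilted _))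

section

variable {μn : ℕ → ProbabilityMeasure (ℕ × ℝ)} {μ : ProbabilityMeasure (ℕ × ℝ)} {b β C : ℝ}

/-- Since `ℕ` is discrete, indicators of `{X = k}` are continuous, so the tilted atoms converge to
positive limits. A lower bound uniform over the finite `F` follows. -/
lemma eventually_le_measureReal_tilt₂ {ι : Type*} {l : Filter ι}
    {μn : ι → ProbabilityMeasure (ℕ × ℝ)} [l.NeBot] (hlaw : Tendsto μn l (𝓝 μ)) (hC0 : 0 ≤ C)
    (hC : ∀ᶠ n in l,
      ∫⁻ w, ENNReal.ofReal (expWeight b β w) ∂(μn n : Measure (ℕ × ℝ)) ≤ ENNReal.ofReal C)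
    {sn vn : ι → ℝ} {s v : ℝ} (hsn : Tendsto sn l (𝓝 s)) (hvn : Tendsto vn l (𝓝 v))
    (hs : s < b) (hv : |v| < β) {F : Finset ℕ}
    (hF : ∀ k ∈ F, (μ : Measure (ℕ × ℝ)) {w | w.1 = k} ≠ 0) :
    ∃ δ > 0, ∀ᶠ n in l, ∀ k ∈ F,
      δ ≤ (tilt₂ (μn n : Measure (ℕ × ℝ)) (sn n) (vn n)).real {w | w.1 = k} := by
  have hG := integrable_expWeight_of_tendsto hlaw hC0 hC
  have hP := isProbabilityMeasure_tilt₂ hG hs hv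
  have hmeas : ∀ k : ℕ, MeasurableSet {w : ℕ × ℝ | w.1 = k} := fun k =>
    measurable_fst (measurableSet_singleton k)
  have hlim : ∀ k : ℕ, Tendsto
      (fun n => (tilt₂ (μn n : Measure (ℕ × ℝ)) (sn n) (vn n)).real {w | w.1 = k}) l
      (𝓝 ((tilt₂ (μ : Measure (ℕ × ℝ)) s v).real {w | w.1 = k})) := by
    intro k
    have hc : Continuous ({w : ℕ × ℝ | w.1 = k}.indicator (fun _ => (1 : ℝ))) := by
      have : ({w : ℕ × ℝ | w.1 = k}.indicator (fun _ => (1 : ℝ)))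
          = (fun m : ℕ => if m = k then (1 : ℝ) else 0) ∘ Prod.fst := by
        funext w; simp [indicator]
      rw [this]
      exact continuous_of_discreteTopology.comp continuous_fst
    have hsub : SubExp ({w : ℕ × ℝ | w.1 = k}.indicator (fun _ => (1 : ℝ))) :=
      SubExp.of_bounded (C := 1) fun w => by
        by_cases h : w.1 = k <;> simp [indicator, h]
    have := tendsto_integral_tilt₂ hlaw hC0 hC hsn hvn hs hv hc hsub
    simpa [integral_indicator_const _ (hmeas k)] using this
  have hpos : ∀ k ∈ F, 0 < (tilt₂ (μ : Measure (ℕ × ℝ)) s v).real {w | w.1 = k} := by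
    intro k hk
    refine ENNReal.toReal_pos (fun h0 => hF k hk ?_) (measure_ne_top _ _)
    exact absolutelyContinuous_tilted (integrable_expLin hG hs hv) h0
  obtain ⟨δ, hδ, hδ0⟩ := (((Finset.eventually_all F).2 fun k hk =>
    (nhdsWithin_le_nhds (gt_mem_nhds (hpos k hk)) : ∀ᶠ δ in 𝓝[>] (0 : ℝ), _)).and
    self_mem_nhdsWithin).exists
  refine ⟨δ, hδ0, (Finset.eventually_all F).2 fun k hk => ?_⟩
  exact ((hlim k).eventually (lt_mem_nhds (hδ k hk))).mono fun n hn => hn.le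

/-- A uniform local limit theorem, in Fourier form, for tilted laws. -/
theorem tendsto_sqrt_mul_integral_charX (hlaw : Tendsto μn atTop (𝓝 μ)) (hC0 : 0 ≤ C)
    (hC : ∀ᶠ n in atTop,
      ∫⁻ w, ENNReal.ofReal (expWeight b β w) ∂(μn n : Measure (ℕ × ℝ)) ≤ ENNReal.ofReal C)
    (hβ : 0 < β) (hspan : spanX (μ : Measure (ℕ × ℝ)) = 1)
    (hconst : ¬ ∃ c : ℕ, ∀ᵐ w ∂(μ : Measure (ℕ × ℝ)), w.1 = c)
    {τ : ℝ} (hτ : τ < b) {sn vn : ℕ → ℝ} (hsn : Tendsto sn atTop (𝓝 τ))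
    (hvn : Tendsto vn atTop (𝓝 0)) {N : ℕ → ℕ} (hN : Tendsto N atTop atTop) :
    Tendsto (fun n => (√(N n) : ℂ) * ∫ t in (-Real.pi)..Real.pi,
        charX (tilt₂ (μn n) (sn n) (vn n)) (∫ w, coordX w ∂(tilt₂ (μn n) (sn n) (vn n))) t ^ N n)
      atTop (𝓝 (√(Real.pi / (variance coordX (tilt₂ (μ : Measure (ℕ × ℝ)) τ 0) / 2)) : ℝ)) := by
  have hG := integrable_expWeight_of_tendsto hlaw hC0 hC
  have hβ' : |(0 : ℝ)| < β := by simpa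
  have hX3 : SubExp (fun w => coordX w ^ 3) := by
    have := (subExp_coordX.mul subExp_coordX).mul subExp_coordX
    refine fun δ hδ => ?_
    obtain ⟨D, hD⟩ := this δ hδ
    refine ⟨D, fun w => ?_⟩
    have h := hD w
    simp only at h ⊢
    rwa [show coordX w ^ 3 = coordX w * coordX w * coordX w by ring]
  have hgood : ∀ᶠ n in atTop, Integrable (expWeight b β) (μn n : Measure (ℕ × ℝ)) ∧
      sn n < b ∧ |vn n| < β := by
    filter_upwards [hC, hsn.eventually (gt_mem_nhds hτ),
      hvn.abs.eventually (gt_mem_nhds hβ')] with n h1 h2 h3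
    exact ⟨integrable_expWeight_of_lintegral_le h1, h2, h3⟩
  have hA := tendsto_covariance_tilt₂ hlaw hC0 hC hsn hvn hτ hβ' continuous_coordX
      subExp_coordX continuous_coordX subExp_coordX
  simp_rw [covariance_self continuous_coordX.measurable.aemeasurable] at hA
  have hmean := tendsto_integral_tilt₂ hlaw hC0 hC hsn hvn hτ hβ' continuous_coordX subExp_coordX
  have hthird := tendsto_integral_tilt₂ hlaw hC0 hC hsn hvn hτ hβ'
    (g := fun w => coordX w ^ 3) (by fun_prop) hX3
  obtain ⟨M, hM⟩ : ∃ M, ∀ᶠ n in atTop, 4 * (∫ w, coordX w ^ 3 ∂(tilt₂ (μn n) (sn n) (vn n))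
      + (∫ w, coordX w ∂(tilt₂ (μn n) (sn n) (vn n))) ^ 3) ≤ M :=
    ⟨_, (((hthird.add (hmean.pow 3)).const_mul 4).eventually (gt_mem_nhds (lt_add_one _))).mono
      fun n hn => hn.le⟩
  obtain ⟨F, c, hF, h0, h1⟩ := exists_combination_eq_one hspan hconst
  obtain ⟨δ, hδ, hatom⟩ := eventually_le_measureReal_tilt₂ hlaw hC0 hC hsn hvn hτ hβ' hF
  have hQpos : 0 < ∑ k ∈ F, (c k : ℝ) ^ 2 := sum_sq_pos_of_combination_eq_one h1
  have hpi := Real.pi_pos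
  -- The Gaussian rate `κ` depends only on `F`, `c` and `δ`, which come from the limit law and do
  -- not vary with `n`.
  refine tendsto_sqrt_mul_integral_pow (M := M)
    (κ := 2 * δ / (Real.pi ^ 2 * ∑ k ∈ F, (c k : ℝ) ^ 2)) hN hA
    (variance_coordX_tilt₂_pos hG hτ hβ' hconst) (by positivity)
    (fun n => (continuous_charX _).measurable) ?_ ?_ ?_
  · filter_upwards [hgood] with n hn t
    have := isProbabilityMeasure_tilt₂ hn.1 hn.2.1 hn.2.2
    exact norm_charX_le_one _ _
  · filter_upwards [hgood, hM] with n hn hMn t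
    have := isProbabilityMeasure_tilt₂ hn.1 hn.2.1 hn.2.2
    refine (norm_charX_sub_le (integral_nonneg coordX_nonneg)
      (memLp_two_tilt₂ hn.1 hn.2.1 hn.2.2 continuous_coordX subExp_coordX)
      (integrable_tilt₂ hn.1 hn.2.1 hn.2.2 (by fun_prop) hX3) rfl t).trans ?_
    exact mul_le_mul_of_nonneg_right hMn (by positivity)
  · filter_upwards [hgood, hatom] with n hn hat t ht
    have := isProbabilityMeasure_tilt₂ hn.1 hn.2.1 hn.2.2
    exact norm_charX_le h0 h1 hδ.le hat _ ht

/-- Asymptotics of the exponential moments of `T` conditioned on `{S = k}`, at a small parameter. -/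
theorem eventually_setIntegral_exp_ratio (hlaw : Tendsto μn atTop (𝓝 μ)) (hC0 : 0 ≤ C)
    (hC : ∀ᶠ n in atTop,
      ∫⁻ w, ENNReal.ofReal (expWeight b β w) ∂(μn n : Measure (ℕ × ℝ)) ≤ ENNReal.ofReal C)
    (hβ : 0 < β) (hspan : spanX (μ : Measure (ℕ × ℝ)) = 1)
    (hconst : ¬ ∃ c : ℕ, ∀ᵐ w ∂(μ : Measure (ℕ × ℝ)), w.1 = c)
    {τ : ℝ} (hτ : τ < b) {τn vn : ℕ → ℝ} (hτn : Tendsto τn atTop (𝓝 τ))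
    (hvn : Tendsto vn atTop (𝓝 0)) {N k : ℕ → ℕ} (hN : Tendsto N atTop atTop)
    (hk : ∀ᶠ n in atTop, N n * (∫ w, coordX w ∂(tilt₂ (μn n) (τn n) 0)) = k n)
    {Ω : ℕ → Type*} [∀ n, MeasurableSpace (Ω n)] {P : ∀ n, Measure (Ω n)}
    [∀ n, IsProbabilityMeasure (P n)] {W : ∀ n, Fin (N n) → Ω n → ℕ × ℝ}
    (hW_law : ∀ᶠ n in atTop, ∀ i, HasLaw (W n i) (μn n : Measure (ℕ × ℝ)) (P n))
    (hW_indep : ∀ᶠ n in atTop, iIndepFun (W n) (P n)) {ε : ℝ} (hε : 0 < ε) :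
    ∀ᶠ n in atTop,
      Real.exp (N n * vn n ^ 2 * (alphaSq μ τ / 2 - ε)) / 2 * (P n).real {ω | sumX (W n) ω = k n} ≤
        ∫ ω in {ω | sumX (W n) ω = k n}, Real.exp (vn n *
          (sumY (W n) ω - N n * ∫ w, coordY w ∂(tilt₂ (μn n) (τn n) 0))) ∂(P n) ∧
      ∫ ω in {ω | sumX (W n) ω = k n}, Real.exp (vn n *
          (sumY (W n) ω - N n * ∫ w, coordY w ∂(tilt₂ (μn n) (τn n) 0))) ∂(P n) ≤
        2 * Real.exp (N n * vn n ^ 2 * (alphaSq μ τ / 2 + ε)) *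
          (P n).real {ω | sumX (W n) ω = k n} := by
  have hG := integrable_expWeight_of_tendsto hlaw hC0 hC
  have hβ' : |(0 : ℝ)| < β := by simpa
  obtain ⟨hn, hhn, hsaddle, hquad⟩ := exists_saddle_point hlaw hC0 hC hβ hconst hτ hτn hvn
  have hsn : Tendsto (fun n => τn n + hn n) atTop (𝓝 τ) := by simpa using hτn.add hhn
  set c0 : ℝ := √(Real.pi / (variance coordX (tilt₂ (μ : Measure (ℕ × ℝ)) τ 0) / 2)) with hc0
  have hc0pos : 0 < c0 := Real.sqrt_pos.2 (div_pos Real.pi_pos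
    (half_pos (variance_coordX_tilt₂_pos hG hτ hβ' hconst)))
  -- The limiting constant depends only on the limit of the tilting parameters, which is `(τ, 0)`
  -- both with and without `v`; hence `J / J0 → 1`.
  have hJ := (Complex.continuous_re.tendsto _).comp (tendsto_sqrt_mul_integral_charX hlaw hC0 hC
    hβ hspan hconst hτ hsn hvn hN)
  have hJ0 := (Complex.continuous_re.tendsto _).comp (tendsto_sqrt_mul_integral_charX hlaw hC0 hC
    hβ hspan hconst hτ hτn (tendsto_const_nhds (x := (0 : ℝ))) hN)
  rw [← hc0, Complex.ofReal_re] at hJ hJ0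
  simp only [Function.comp_def, Complex.re_ofReal_mul] at hJ hJ0
  set J : ℕ → ℝ := fun n => (∫ t in (-Real.pi)..Real.pi,
        charX (tilt₂ (μn n) (τn n + hn n) (vn n))
          (∫ w, coordX w ∂(tilt₂ (μn n) (τn n + hn n) (vn n))) t ^ N n).re with hJdef
  set J0 : ℕ → ℝ := fun n => (∫ t in (-Real.pi)..Real.pi,
        charX (tilt₂ (μn n) (τn n) 0) (∫ w, coordX w ∂(tilt₂ (μn n) (τn n) 0)) t ^ N n).re with hJ0def
  have hratio : Tendsto (fun n => J n / J0 n) atTop (𝓝 1) := by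
    have h1 := hJ.div hJ0 hc0pos.ne'
    rw [div_self hc0pos.ne'] at h1
    refine h1.congr' ?_
    filter_upwards [hN.eventually_gt_atTop 0] with n h2
    have : √(N n : ℝ) ≠ 0 := (Real.sqrt_pos.2 (by exact_mod_cast h2)).ne'
    simp only [Pi.div_apply]
    rw [mul_div_mul_left _ _ this]
  filter_upwards [hC, hsn.eventually (gt_mem_nhds hτ), hτn.eventually (gt_mem_nhds hτ),
    hvn.abs.eventually (gt_mem_nhds hβ'), hsaddle, hquad ε hε, hk, hW_law, hW_indep,
    hratio.eventually (lt_mem_nhds (show (1 / 2 : ℝ) < 1 by norm_num)),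
    hratio.eventually (gt_mem_nhds (show (1 : ℝ) < 2 by norm_num)),
    hJ0.eventually (lt_mem_nhds hc0pos)]
    with n hCn hs1 hs2 hv1 hsad hq hkn hl hi hr1 hr2 hJ0n
  have hGn := integrable_expWeight_of_lintegral_le hCn
  have hJ0pos : 0 < J0 n := pos_of_mul_pos_right hJ0n (Real.sqrt_nonneg _)
  -- The saddle equation lets the same level `k n` serve as `N` times the tilted mean for both
  -- parameters.
  have f1 := congrArg Complex.re (two_pi_mul_setIntegral_exp_sumY hl hi hGn hs1 hv1 (k := k n)
    (a := ∫ w, coordX w ∂(tilt₂ (μn n) (τn n + hn n) (vn n))) (by rw [hsad]; exact hkn))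
  have f0 := congrArg Complex.re (two_pi_mul_setIntegral_exp_sumY hl hi hGn hs2 hβ' (k := k n)
    (a := ∫ w, coordX w ∂(tilt₂ (μn n) (τn n) 0)) hkn)
  rw [Complex.ofReal_re, ← Complex.ofReal_pow, Complex.re_ofReal_mul] at f1 f0
  have hJn : (∫ t in (-Real.pi)..Real.pi, charX (tilt₂ (μn n) (τn n + hn n) (vn n))
          (∫ w, coordX w ∂(tilt₂ (μn n) (τn n + hn n) (vn n))) t ^ N n).re = J n := rfl
  have hJ0n' : (∫ t in (-Real.pi)..Real.pi, charX (tilt₂ (μn n) (τn n) 0)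
      (∫ w, coordX w ∂(tilt₂ (μn n) (τn n) 0)) t ^ N n).re = J0 n := rfl
  rw [hJn] at f1
  rw [hJ0n'] at f0
  set E : Set (Ω n) := {ω | sumX (W n) ω = k n} with hE
  set L := mgf₂ (μn n : Measure (ℕ × ℝ)) (τn n + hn n) (vn n) with hL
  set L0 := mgf₂ (μn n : Measure (ℕ × ℝ)) (τn n) 0 with hL0
  set m := ∫ w, coordY w ∂(tilt₂ (μn n : Measure (ℕ × ℝ)) (τn n) 0) with hm
  set ρ := ∫ w, coordX w ∂(tilt₂ (μn n : Measure (ℕ × ℝ)) (τn n) 0) with hρ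
  have hLpos : 0 < L := mgf₂_pos hGn hs1 hv1
  have hL0pos : 0 < L0 := mgf₂_pos hGn hs2 hβ'
  have hP : ∫ ω in E, Real.exp (0 * sumY (W n) ω) ∂(P n) = (P n).real E := by simp
  rw [hP] at f0
  have hsplit : ∫ ω in E, Real.exp (vn n * (sumY (W n) ω - N n * m)) ∂(P n)
      = Real.exp (-(vn n * (N n * m))) * ∫ ω in E, Real.exp (vn n * sumY (W n) ω) ∂(P n) := by
    rw [← integral_const_mul (Real.exp (-(vn n * (N n * m))))]
    congr 1; funext ω
    rw [← Real.exp_add]; congr 1; ring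
  set I := ∫ ω in E, Real.exp (vn n * sumY (W n) ω) ∂(P n) with hI
  set X := Real.log L - Real.log L0 - hn n * ρ - vn n * m with hX
  have hpowL : L ^ N n = Real.exp (N n * Real.log L) := by
    rw [Real.exp_nat_mul, Real.exp_log hLpos]
  have hpowL0 : L0 ^ N n = Real.exp (N n * Real.log L0) := by
    rw [Real.exp_nat_mul, Real.exp_log hL0pos]
  have hpi := Real.pi_pos
  -- An exact identity; only afterwards are `X` replaced by its quadratic expansion and `J / J0` by
  -- the crude bounds `1 / 2` and `2`.
  have hkey : Real.exp (-(vn n * (N n * m))) * I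
      = Real.exp (N n * X) * (J n / J0 n) * (P n).real E := by
    have hI' : I = Real.exp (N n * Real.log L) * J n
        / (2 * Real.pi * Real.exp ((τn n + hn n) * k n)) := by
      rw [eq_div_iff (by positivity), ← hpowL, ← f1]; ring
    have hP' : (P n).real E = Real.exp (N n * Real.log L0) * J0 n
        / (2 * Real.pi * Real.exp (τn n * k n)) := by
      rw [eq_div_iff (by positivity), ← hpowL0, ← f0]; ring
    have hexp : Real.exp (-(vn n * (N n * m))) * Real.exp (N n * Real.log L)
          * Real.exp (τn n * k n)
        = Real.exp (N n * X) * Real.exp (N n * Real.log L0)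
          * Real.exp ((τn n + hn n) * k n) := by
      rw [← Real.exp_add, ← Real.exp_add, ← Real.exp_add, ← Real.exp_add]
      congr 1
      rw [hX, ← hkn]; ring
    rw [hI', hP']
    field_simp
    rw [show vn n * N n * m = vn n * (N n * m) by ring]
    linear_combination J n * hexp
  rw [hsplit, hkey]
  have hN0 : (0 : ℝ) ≤ N n := Nat.cast_nonneg _
  rw [abs_le] at hq
  have hpr : 0 ≤ (P n).real E := measureReal_nonneg
  constructor
  · refine mul_le_mul_of_nonneg_right ?_ hpr
    have h1 : Real.exp (N n * vn n ^ 2 * (alphaSq μ τ / 2 - ε)) ≤ Real.exp (N n * X) := by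
      refine Real.exp_le_exp.2 ?_
      rw [mul_assoc]
      refine mul_le_mul_of_nonneg_left ?_ hN0
      rw [hX]; linarith [hq.1]
    calc Real.exp (N n * vn n ^ 2 * (alphaSq μ τ / 2 - ε)) / 2
        = Real.exp (N n * vn n ^ 2 * (alphaSq μ τ / 2 - ε)) * (1 / 2) := by ring
      _ ≤ _ := mul_le_mul h1 hr1.le (by norm_num) (Real.exp_pos _).le
  · refine mul_le_mul_of_nonneg_right ?_ hpr
    have h1 : Real.exp (N n * X) ≤ Real.exp (N n * vn n ^ 2 * (alphaSq μ τ / 2 + ε)) := by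
      refine Real.exp_le_exp.2 ?_
      rw [mul_assoc]
      refine mul_le_mul_of_nonneg_left ?_ hN0
      rw [hX]; linarith [hq.2]
    rw [mul_comm]
    exact mul_le_mul hr2.le h1 (Real.exp_pos _).le zero_le_two

end

/-! ### Large deviations from quadratic exponential moments -/

lemma quadraticRate_of_pos {α2 : ℝ} (h : 0 < α2) (y : ℝ) :
    quadraticRate α2 y = ENNReal.ofReal (y ^ 2 / (2 * α2)) :=
  (ENNReal.ofReal_div_of_pos (by linarith)).symm

lemma quadraticRate_zero_zero : quadraticRate 0 0 = 0 := by simp [quadraticRate]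

lemma quadraticRate_zero_of_ne {y : ℝ} (hy : y ≠ 0) : quadraticRate 0 y = ∞ := by
  simp only [quadraticRate, mul_zero, ENNReal.ofReal_zero]
  refine ENNReal.div_zero ?_
  rw [ne_eq, ENNReal.ofReal_eq_zero, not_le]
  positivity

lemma quadraticRate_abs (α2 y : ℝ) : quadraticRate α2 |y| = quadraticRate α2 y := by
  simp [quadraticRate]

lemma setOf_quadraticRate_zero_le {c : ℝ≥0∞} (hc : c ≠ ∞) : {y | quadraticRate 0 y ≤ c} = {0} := by
  ext y
  by_cases hy : y = 0
  · simp [hy, quadraticRate_zero_zero]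
  · simp [hy, quadraticRate_zero_of_ne hy, hc]

lemma lowerSemicontinuous_quadraticRate {α2 : ℝ} (h : 0 ≤ α2) :
    LowerSemicontinuous (quadraticRate α2) := by
  rcases h.eq_or_lt with rfl | h
  · rw [lowerSemicontinuous_iff_isClosed_preimage]
    intro c
    by_cases hc : c = ∞
    · simp [hc]
    · have : quadraticRate 0 ⁻¹' Iic c = {0} := setOf_quadraticRate_zero_le hc
      rw [this]; exact isClosed_singleton
  · have : quadraticRate α2 = fun y => ENNReal.ofReal (y ^ 2 / (2 * α2)) :=
      funext (quadraticRate_of_pos h)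
    rw [this]
    exact (ENNReal.continuous_ofReal.comp (by fun_prop)).lowerSemicontinuous

lemma isGoodRate_quadraticRate {α2 : ℝ} (h : 0 ≤ α2) : IsGoodRate (quadraticRate α2) := by
  intro c hc
  rcases h.eq_or_lt with rfl | h
  · rw [setOf_quadraticRate_zero_le ENNReal.ofReal_ne_top]
    exact isCompact_singleton
  · have hclosed : IsClosed {y | quadraticRate α2 y ≤ ENNReal.ofReal c} :=
      (lowerSemicontinuous_iff_isClosed_preimage.1 (lowerSemicontinuous_quadraticRate h.le)) _
    refine (isCompact_Icc (a := -(2 * α2 * c + 1)) (b := 2 * α2 * c + 1)).of_isClosed_subset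
      hclosed fun y hy => ?_
    rw [mem_ofPred_eq, quadraticRate_of_pos h, ENNReal.ofReal_le_ofReal_iff hc,
      div_le_iff₀ (by linarith)] at hy
    have h2 : 0 ≤ 2 * α2 * c := by positivity
    constructor <;> nlinarith [sq_nonneg (y - 1), sq_nonneg (y + 1)]

/-- For `α2 > 0` the slope `y / α2` attains the Legendre supremum. For `α2 = 0` and `y ≠ 0` the
supremum is infinite, and any level is exceeded by a large slope. -/
lemma exists_lt_legendre {α2 c y : ℝ} (h : 0 ≤ α2) (hc : 0 ≤ c)
    (hJ : ENNReal.ofReal c < quadraticRate α2 y) : ∃ u, c < u * y - α2 * u ^ 2 / 2 := by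
  rcases h.eq_or_lt with rfl | h
  · have hy : y ≠ 0 := by
      rintro rfl
      rw [quadraticRate_zero_zero] at hJ
      exact not_lt_zero hJ
    exact ⟨(c + 1) / y, by rw [div_mul_cancel₀ _ hy]; linarith⟩
  · rw [quadraticRate_of_pos h, ENNReal.ofReal_lt_ofReal_iff_of_nonneg hc] at hJ
    refine ⟨y / α2, hJ.trans_le (le_of_eq ?_)⟩
    field_simp; ring

/-- A point of finite rate is the derivative at some `u` of the limiting function `α2 u² / 2`, so
tilting by that `u` centres the law there. For `α2 = 0` the only such point is `0`. -/
lemma exists_eq_mul_of_quadraticRate_lt {α2 r x : ℝ} (h : 0 ≤ α2)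
    (hJ : quadraticRate α2 x < ENNReal.ofReal r) : ∃ u, x = α2 * u ∧ α2 * u ^ 2 / 2 < r := by
  rcases h.eq_or_lt with rfl | h
  · have hx : x = 0 := by
      by_contra hx
      rw [quadraticRate_zero_of_ne hx] at hJ
      exact not_top_lt hJ
    rw [hx, quadraticRate_zero_zero, ENNReal.ofReal_pos] at hJ
    exact ⟨0, by simp [hx], by simpa using hJ⟩
  · rw [quadraticRate_of_pos h] at hJ
    have h1 := (ENNReal.ofReal_lt_ofReal_iff_of_nonneg (by positivity)).1 hJ
    refine ⟨x / α2, by field_simp, lt_of_eq_of_lt ?_ h1⟩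
    field_simp

lemma mul_log_le {a t : ℝ} (ha : 0 < a) {x : ℝ≥0∞} (hx : x ≤ ENNReal.ofReal (Real.exp (t / a))) :
    (a : EReal) * ENNReal.log x ≤ (t : EReal) := by
  have h1 := ENNReal.log_le_log hx
  rw [ENNReal.log_ofReal_of_pos (Real.exp_pos _), Real.log_exp] at h1
  refine (mul_le_mul_of_nonneg_left h1 (by exact_mod_cast ha.le)).trans (le_of_eq ?_)
  rw [← EReal.coe_mul]
  congr 1; field_simp

lemma le_mul_log {a t : ℝ} (ha : 0 < a) {x : ℝ≥0∞} (hx : ENNReal.ofReal (Real.exp (t / a)) ≤ x) :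
    (t : EReal) ≤ (a : EReal) * ENNReal.log x := by
  have h1 := ENNReal.log_le_log hx
  rw [ENNReal.log_ofReal_of_pos (Real.exp_pos _), Real.log_exp] at h1
  refine le_trans (le_of_eq ?_) (mul_le_mul_of_nonneg_left h1 (by exact_mod_cast ha.le))
  rw [← EReal.coe_mul]
  congr 1; field_simp

section LDP

variable {R : ℕ → Measure ℝ} {a : ℕ → ℝ} {α2 : ℝ}

lemma eventually_le_exp_div (ha : ∀ᶠ n in atTop, 0 < a n) (ha0 : Tendsto a atTop (𝓝 0))
    {κ : ℝ} (hκ : 0 < κ) (K : ℝ) : ∀ᶠ n in atTop, K ≤ Real.exp (κ / a n) := by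
  have h1 : Tendsto (fun n => (a n)⁻¹) atTop atTop :=
    tendsto_inv_nhdsGT_zero.comp (tendsto_nhdsWithin_iff.2 ⟨ha0, ha⟩)
  exact (Real.tendsto_exp_atTop.comp (h1.const_mul_atTop hκ)).eventually_ge_atTop K

/-- Markov's inequality for a change of slope from `u` to `v`. With `u = 0` it is the Chernoff
bound; with `u ≠ 0` it controls tails of the tilted law. -/
lemma setLIntegral_exp_le {ν : Measure ℝ} {a u v c : ℝ} {A : Set ℝ}
    (hc : ∀ z ∈ A, (u * z + c) / a ≤ v * z / a) :
    ∫⁻ z in A, ENNReal.ofReal (Real.exp (u * z / a)) ∂ν ≤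
      ENNReal.ofReal (Real.exp (-c / a)) * ∫⁻ z, ENNReal.ofReal (Real.exp (v * z / a)) ∂ν := by
  rw [← lintegral_const_mul _ (by fun_prop)]
  refine (setLIntegral_mono (by fun_prop) fun z hz => ?_).trans (setLIntegral_le_lintegral _ _)
  rw [← ENNReal.ofReal_mul (Real.exp_pos _).le, ← Real.exp_add]
  refine ENNReal.ofReal_le_ofReal (Real.exp_le_exp.2 ?_)
  have := hc z hz
  rw [add_div] at this
  rw [neg_div]; linarith

/-- The Gärtner–Ellis theorem on the line for a quadratic limiting cumulant generating function. -/
theorem satisfiesLDP_of_quadratic (hα : 0 ≤ α2) (hR : ∀ᶠ n in atTop, IsProbabilityMeasure (R n))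
    (ha : ∀ᶠ n in atTop, 0 < a n) (ha0 : Tendsto a atTop (𝓝 0))
    (hM : ∀ u : ℝ, ∀ ε > 0, ∀ᶠ n in atTop,
      ENNReal.ofReal (Real.exp ((α2 * u ^ 2 / 2 - ε) / a n)) ≤
        ∫⁻ z, ENNReal.ofReal (Real.exp (u * z / a n)) ∂(R n) ∧
      ∫⁻ z, ENNReal.ofReal (Real.exp (u * z / a n)) ∂(R n) ≤
        ENNReal.ofReal (Real.exp ((α2 * u ^ 2 / 2 + ε) / a n))) :
    SatisfiesLDP R (quadraticRate α2) a where
  lowerSemicontinuous := lowerSemicontinuous_quadraticRate hα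
  lower_bound A _ := by
    by_contra hcon
    rw [not_le, EReal.lt_neg_comm, EReal.lt_iff_exists_real_btwn] at hcon
    obtain ⟨r, hr1, hr2⟩ := hcon
    have hr0 : 0 ≤ r := by
      have : (0 : EReal) ≤ r := (EReal.coe_ennreal_nonneg _).trans hr1.le
      exact_mod_cast this
    have hr1' : (⨅ x ∈ interior A, quadraticRate α2 x) < ENNReal.ofReal r := by
      rw [← EReal.coe_ennreal_lt_coe_ennreal_iff, EReal.coe_ennreal_ofReal, max_eq_left hr0]
      exact hr1
    simp only [iInf_lt_iff] at hr1'
    obtain ⟨x, hx, hJ⟩ := hr1'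
    refine hr2.not_ge (EReal.neg_le.1 (le_liminf_of_le (h := ?_)))
    obtain ⟨u, rfl, hu⟩ := exists_eq_mul_of_quadraticRate_lt hα hJ
    set κ := r - α2 * u ^ 2 / 2 with hκ
    have hκ0 : 0 < κ := by linarith
    obtain ⟨ε0, hε0, hball⟩ := Metric.mem_nhds_iff.1 (mem_interior_iff_mem_nhds.1 hx)
    -- Half of the slack `κ` pays for the variation `|u| η` of the tilt over the ball and for the
    -- error `e ≤ η`; the other half pays for a factor `2`.
    obtain ⟨η, hη, hη1, hη2, hη3⟩ : ∃ η, 0 < η ∧ η ≤ 1 ∧ η ≤ ε0 ∧ η * (1 + |u|) ≤ κ / 2 := by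
      have hp : 0 < 1 + |u| := by positivity
      refine ⟨min (min 1 ε0) (κ / 2 / (1 + |u|)), by positivity,
        (min_le_left _ _).trans (min_le_left _ _), (min_le_left _ _).trans (min_le_right _ _), ?_⟩
      rw [← le_div_iff₀ hp]; exact min_le_right _ _
    -- Shifting the slope by `δ` gains `δ η` on each tail and costs `α2 δ² / 2 ≤ δ η / 2`.
    set δ := η / (α2 + 1) with hδ
    have hδ0 : 0 < δ := by positivity
    have hδη : δ ≤ η := div_le_self hη.le (by linarith)
    have hαδ : α2 * δ ≤ η := by
      rw [hδ, ← mul_div_assoc, div_le_iff₀ (by linarith)]; nlinarith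
    -- The net gain is `δ η / 2 = 4 e`: `2 e` for the moment error at the shifted slope, `e` for a
    -- factor `4`, and `e` for the lower bound `S`.
    set e := δ * η / 8 with he
    have he0 : 0 < e := by positivity
    filter_upwards [hR, ha, hM u e he0, hM (u + δ) (2 * e) (by positivity),
      hM (u - δ) (2 * e) (by positivity), eventually_le_exp_div ha ha0 he0 4,
      eventually_le_exp_div ha ha0 (half_pos hκ0) 2] with n hRn han h0 h1 h2 h4 h5
    rw [← EReal.coe_neg]
    refine le_mul_log han ?_
    set x := α2 * u with hxdef
    set B := Ioo (x - η) (x + η) with hB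
    have hBA : B ⊆ A := by
      intro z hz
      refine hball ?_
      rw [Metric.mem_ball, Real.dist_eq, abs_lt]
      exact ⟨by linarith [hz.1], by linarith [hz.2]⟩
    set S := Real.exp ((α2 * u ^ 2 / 2 - e) / a n) with hS
    have hcover : (univ : Set ℝ) ⊆ B ∪ (Ici (x + η) ∪ Iic (x - η)) := by
      intro z _
      by_cases hz1 : z ≤ x - η
      · exact Or.inr (Or.inr hz1)
      · by_cases hz2 : x + η ≤ z
        · exact Or.inr (Or.inl hz2)
        · exact Or.inl ⟨not_le.1 hz1, not_le.1 hz2⟩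
    have htail : ∀ v : ℝ, (v = u + δ ∨ v = u - δ) → ∀ c, -c + α2 * v ^ 2 / 2
        ≤ α2 * u ^ 2 / 2 - 4 * e → Real.exp (-c / a n) * Real.exp ((α2 * v ^ 2 / 2 + 2 * e) / a n)
        ≤ S / 4 := by
      intro v _ c hc
      rw [le_div_iff₀ (by norm_num)]
      calc Real.exp (-c / a n) * Real.exp ((α2 * v ^ 2 / 2 + 2 * e) / a n) * 4
          ≤ Real.exp (-c / a n) * Real.exp ((α2 * v ^ 2 / 2 + 2 * e) / a n) * Real.exp (e / a n) := by
            gcongr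
        _ = Real.exp ((-c + (α2 * v ^ 2 / 2 + 2 * e) + e) / a n) := by
            rw [← Real.exp_add, ← Real.exp_add]; congr 1; ring
        _ ≤ S := by
            refine Real.exp_le_exp.2 (div_le_div_of_nonneg_right ?_ han.le)
            linarith
    have hexpo : α2 * δ ^ 2 / 2 ≤ δ * η / 2 := by nlinarith
    have hT1 : ∫⁻ z in Ici (x + η), ENNReal.ofReal (Real.exp (u * z / a n)) ∂(R n)
        ≤ ENNReal.ofReal (S / 4) := by
      refine (setLIntegral_exp_le (v := u + δ) (c := δ * (x + η))
        fun z hz => ?_).trans ?_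
      · refine div_le_div_of_nonneg_right ?_ han.le
        have := mul_le_mul_of_nonneg_left (mem_Ici.1 hz) hδ0.le
        linarith
      · refine (mul_le_mul_right h1.2 _).trans ?_
        rw [← ENNReal.ofReal_mul (Real.exp_pos _).le]
        refine ENNReal.ofReal_le_ofReal (htail _ (Or.inl rfl) _ ?_)
        rw [he, hxdef]; nlinarith
    have hT2 : ∫⁻ z in Iic (x - η), ENNReal.ofReal (Real.exp (u * z / a n)) ∂(R n)
        ≤ ENNReal.ofReal (S / 4) := by
      refine (setLIntegral_exp_le (v := u - δ) (c := -(δ * (x - η)))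
        fun z hz => ?_).trans ?_
      · refine div_le_div_of_nonneg_right ?_ han.le
        have := mul_le_mul_of_nonneg_left (mem_Iic.1 hz) hδ0.le
        linarith
      · refine (mul_le_mul_right h2.2 _).trans ?_
        rw [← ENNReal.ofReal_mul (Real.exp_pos _).le]
        refine ENNReal.ofReal_le_ofReal (htail _ (Or.inr rfl) _ ?_)
        rw [he, hxdef]; nlinarith
    have hTB : ∫⁻ z in B, ENNReal.ofReal (Real.exp (u * z / a n)) ∂(R n)
        ≤ ENNReal.ofReal (Real.exp ((u * x + |u| * η) / a n)) * R n B := by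
      rw [← setLIntegral_const]
      refine setLIntegral_mono (by fun_prop) fun z hz => ?_
      refine ENNReal.ofReal_le_ofReal (Real.exp_le_exp.2 (div_le_div_of_nonneg_right ?_ han.le))
      have h6 : |z - x| ≤ η := abs_le.2 ⟨by linarith [hz.1], by linarith [hz.2]⟩
      have h7 : u * (z - x) ≤ |u| * η := (le_abs_self _).trans (by rw [abs_mul]; gcongr)
      linarith
    -- Under the weight `exp (u z / a)` the total mass is at least `S` and each tail at most `S /
    -- 4`, so the ball `B` keeps at least `S / 2`.
    have hsum : ENNReal.ofReal S ≤ ENNReal.ofReal (Real.exp ((u * x + |u| * η) / a n)) * R n B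
        + (ENNReal.ofReal (S / 4) + ENNReal.ofReal (S / 4)) := by
      refine h0.1.trans ?_
      rw [← setLIntegral_univ]
      refine (lintegral_mono_set hcover).trans ((lintegral_union_le _ _ _).trans
        (add_le_add hTB ((lintegral_union_le _ _ _).trans (add_le_add hT1 hT2))))
    have hSpos : 0 < S := Real.exp_pos _
    have hreal : S ≤ Real.exp ((u * x + |u| * η) / a n) * (R n).real B + (S / 4 + S / 4) := by
      have hfin : R n B = ENNReal.ofReal ((R n).real B) := (ofReal_measureReal).symm
      rw [hfin, ← ENNReal.ofReal_mul (Real.exp_pos _).le, ← ENNReal.ofReal_add (by positivity)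
        (by positivity), ← ENNReal.ofReal_add (by positivity) (by positivity)] at hsum
      exact (ENNReal.ofReal_le_ofReal_iff (by positivity)).1 hsum
    refine le_trans ?_ (measure_mono hBA)
    rw [← ofReal_measureReal (μ := R n) (s := B)]
    refine ENNReal.ofReal_le_ofReal ?_
    have hfinal : Real.exp (-r / a n) * 2 * Real.exp ((u * x + |u| * η) / a n) ≤ S := by
      calc Real.exp (-r / a n) * 2 * Real.exp ((u * x + |u| * η) / a n)
          ≤ Real.exp (-r / a n) * Real.exp (κ / 2 / a n) * Real.exp ((u * x + |u| * η) / a n) := by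
            gcongr
        _ = Real.exp ((-r + κ / 2 + (u * x + |u| * η)) / a n) := by
            rw [← Real.exp_add, ← Real.exp_add]; congr 1; ring
        _ ≤ S := by
            refine Real.exp_le_exp.2 (div_le_div_of_nonneg_right ?_ han.le)
            have : e ≤ η := by rw [he]; nlinarith
            rw [hxdef]
            nlinarith
    have hE := Real.exp_pos ((u * x + |u| * η) / a n)
    by_contra hlt
    rw [not_le] at hlt
    nlinarith
  upper_bound A _ := by
    refine EReal.le_neg.2 ((EReal.ge_of_forall_gt_iff_ge).1 fun c hc => EReal.le_neg.1 ?_)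
    rw [← EReal.coe_neg]
    refine limsup_le_of_le (h := ?_)
    rcases lt_or_ge c 0 with hc0 | hc0
    · filter_upwards [hR, ha] with n hRn han
      refine mul_log_le han (prob_le_one.trans ?_)
      rw [← ENNReal.ofReal_one]
      exact ENNReal.ofReal_le_ofReal (Real.one_le_exp (div_nonneg (by linarith) han.le))
    rcases (closure A).eq_empty_or_nonempty with hA | hA
    · have hA' : A = ∅ := (closure_empty_iff A).1 hA
      filter_upwards [ha] with n han
      exact mul_log_le han (by simp [hA'])
    have hc' : ENNReal.ofReal c < ⨅ x ∈ closure A, quadraticRate α2 x := by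
      rw [← EReal.coe_ennreal_lt_coe_ennreal_iff, EReal.coe_ennreal_ofReal, max_eq_left hc0]
      exact hc
    -- The rate depends on `|y|` and increases with it, so the point of the closure nearest to `0`
    -- decides. `A` then lies in two half-lines, each handled by a Chernoff bound with slope `±u`.
    obtain ⟨x0, hx0, hdist⟩ := isClosed_closure.exists_infDist_eq_dist hA (0 : ℝ)
    have hmin : ∀ z ∈ A, |x0| ≤ |z| := by
      intro z hz
      have := Metric.infDist_le_dist_of_mem (x := (0 : ℝ)) (subset_closure hz)
      rw [hdist] at this
      simpa [Real.dist_eq] using this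
    have hJ : ENNReal.ofReal c < quadraticRate α2 |x0| := by
      rw [quadraticRate_abs]
      exact hc'.trans_le (iInf₂_le x0 hx0)
    obtain ⟨u, hu⟩ := exists_lt_legendre hα hc0 hJ
    have hu0 : 0 ≤ u := by
      by_contra hneg
      have h1 : u * |x0| ≤ 0 := mul_nonpos_of_nonpos_of_nonneg (not_le.1 hneg).le (abs_nonneg _)
      have h2 : 0 ≤ α2 * u ^ 2 / 2 := by positivity
      linarith
    -- Half of the gap above `c`: one `ε` covers the moment error, another a factor `2` for the two
    -- half-lines.
    set ε := (u * |x0| - α2 * u ^ 2 / 2 - c) / 2 with hε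
    have hε0 : 0 < ε := by linarith
    filter_upwards [ha, hM u ε hε0, hM (-u) ε hε0, eventually_le_exp_div ha ha0 hε0 2]
      with n han h1 h2 h3
    refine mul_log_le han ?_
    have hhalf : ∀ v : ℝ, v ^ 2 = u ^ 2 → ∫⁻ z, ENNReal.ofReal (Real.exp (v * z / a n)) ∂(R n) ≤
        ENNReal.ofReal (Real.exp ((α2 * v ^ 2 / 2 + ε) / a n)) →
        R n {z | u * |x0| ≤ v * z} ≤ ENNReal.ofReal (Real.exp (-c / a n) / 2) := by
      intro v hv hint
      have h4 := setLIntegral_exp_le (ν := R n) (u := 0) (v := v) (c := u * |x0|) (a := a n)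
        (A := {z | u * |x0| ≤ v * z}) (fun z hz => div_le_div_of_nonneg_right (by rw [zero_mul, zero_add]; exact hz) han.le)
      simp only [zero_mul, zero_div, Real.exp_zero, ENNReal.ofReal_one, setLIntegral_one] at h4
      refine h4.trans ((mul_le_mul_right hint _).trans ?_)
      rw [← ENNReal.ofReal_mul (Real.exp_pos _).le, hv]
      refine ENNReal.ofReal_le_ofReal ?_
      rw [le_div_iff₀ two_pos]
      calc Real.exp (-(u * |x0|) / a n) * Real.exp ((α2 * u ^ 2 / 2 + ε) / a n) * 2
          ≤ Real.exp (-(u * |x0|) / a n) * Real.exp ((α2 * u ^ 2 / 2 + ε) / a n)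
            * Real.exp (ε / a n) := by gcongr
        _ = Real.exp (-c / a n) := by
            rw [← Real.exp_add, ← Real.exp_add]; congr 1
            rw [hε]; ring
    have hsub : A ⊆ {z | u * |x0| ≤ u * z} ∪ {z | u * |x0| ≤ -u * z} := by
      intro z hz
      have h5 := mul_le_mul_of_nonneg_left (hmin z hz) hu0
      rcases abs_cases z with ⟨h6, -⟩ | ⟨h6, -⟩ <;> rw [h6] at h5
      · exact Or.inl h5
      · exact Or.inr (by rw [mem_ofPred_eq]; linarith)
    refine (measure_mono hsub).trans ((measure_union_le _ _).trans
      ((add_le_add (hhalf u rfl h1.2) (hhalf (-u) (by ring) h2.2)).trans (le_of_eq ?_)))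
    rw [← ENNReal.ofReal_add (by positivity) (by positivity), add_halves]

end LDP

end

end ConditionedSums

/-! ### The conditioned large deviation principle -/

open ConditionedSums in
theorem theorem2
    -- the laws of `(X, Y)` and of `(X^(n), Y^(n))`, `n ≥ 1`
    (μ : ProbabilityMeasure (ℕ × ℝ)) (μn : ℕ → ProbabilityMeasure (ℕ × ℝ))
    (hspan : spanX (μ : Measure (ℕ × ℝ)) = 1)
    (hconst : ¬ ∃ c : ℕ, ∀ᵐ w ∂(μ : Measure (ℕ × ℝ)), w.1 = c)
    (hspan_n : ∀ n, 1 ≤ n → spanX (μn n : Measure (ℕ × ℝ)) = 1)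
    (hlaw : Tendsto μn atTop (𝓝 μ))
    -- the integers `p, q, p_n, q_n`
    (p q : ℕ) (hp : 0 < p) (hq : 0 < q)
    (pn qn : ℕ → ℕ) (hpn : ∀ n, 1 ≤ n → 0 < pn n) (hqn : ∀ n, 1 ≤ n → 0 < qn n)
    (hpq : (p : ℝ) / q ∈ rangeX (μ : Measure (ℕ × ℝ)))
    (hpqn : ∀ n, 1 ≤ n → (pn n : ℝ) / qn n ∈ rangeX (μn n : Measure (ℕ × ℝ)))
    (hpq_lim : Tendsto (fun n => (pn n : ℝ) / qn n) atTop (𝓝 ((p : ℝ) / q)))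
    -- the array: row `n` is an i.i.d. sample of size `n q_n` of the law of `(X^(n), Y^(n))`
    {Ω : ℕ → Type*} [∀ n, MeasurableSpace (Ω n)] (P : ∀ n, Measure (Ω n))
    [∀ n, IsProbabilityMeasure (P n)]
    (W : ∀ n, Fin (n * qn n) → Ω n → ℕ × ℝ)
    (hW_law : ∀ n, 1 ≤ n → ∀ i, HasLaw (W n i) (μn n : Measure (ℕ × ℝ)) (P n))
    (hW_indep : ∀ n, 1 ≤ n → iIndepFun (W n) (P n))
    (hS : ∀ n, 1 ≤ n → 0 < P n {ω | sumX (W n) ω = n * pn n})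
    -- first assumption
    (r₀ : ℝ) (hr₀ : 0 < r₀)
    (hdomY : Ioo (-r₀) r₀ ⊆ domY (μ : Measure (ℕ × ℝ)))
    (hdomY_n : ∀ n, 1 ≤ n → Ioo (-r₀) r₀ ⊆ domY (μn n : Measure (ℕ × ℝ)))
    (τ : ℝ) (hτ_mem : τ ∈ interior (domX (μ : Measure (ℕ × ℝ))))
    (hτ : psiX' (μ : Measure (ℕ × ℝ)) τ = (p : ℝ) / q)
    (τn : ℕ → ℝ) (hτn_mem : ∀ n, 1 ≤ n → τn n ∈ interior (domX (μn n : Measure (ℕ × ℝ))))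
    (hτn : ∀ n, 1 ≤ n → psiX' (μn n : Measure (ℕ × ℝ)) (τn n) = (pn n : ℝ) / qn n)
    -- second assumption
    (r : ℝ) (hr : 0 < r)
    (hdomX : Icc (τ - r) (τ + r) ⊆ domX (μ : Measure (ℕ × ℝ)))
    (hdomX_n : ∀ n, 1 ≤ n → Icc (τ - r) (τ + r) ⊆ domX (μn n : Measure (ℕ × ℝ)))
    (hunif : ∀ s ∈ Icc (τ - r) (τ + r),
      Tendsto (fun n => ⨆ t : ℝ,
        ‖laplaceX (μn n : Measure (ℕ × ℝ)) s t - laplaceX (μ : Measure (ℕ × ℝ)) s t‖ₑ)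
        atTop (𝓝 0))
    (hbound : (⨆ (n : ℕ) (_ : 1 ≤ n) (s ∈ Icc (τ - r) (τ + r)) (v ∈ Ioo (-r₀) r₀),
      ∫⁻ w, ENNReal.ofReal (Real.exp (s * coordX w
        + v * (coordY w - tiltedMeanY (μn n : Measure (ℕ × ℝ)) (τn n))))
        ∂(μn n : Measure (ℕ × ℝ))) < ∞)
    -- the speed
    (a : ℕ → ℝ) (ha_pos : ∀ n, 1 ≤ n → 0 < a n) (ha_anti : AntitoneOn a (Ici 1))
    (ha_lim : Tendsto a atTop (𝓝 0))
    (ha_speed : Tendsto (fun n : ℕ => (n : ℝ) * a n * qn n) atTop atTop) :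
    SatisfiesLDP
      (fun n => ((P n)[|{ω | sumX (W n) ω = n * pn n}]).map
        (fun ω => Real.sqrt (a n / ((n : ℝ) * qn n))
          * (sumY (W n) ω
              - (n : ℝ) * qn n * tiltedMeanY (μn n : Measure (ℕ × ℝ)) (τn n))))
      (quadraticRate (alphaSq (μ : Measure (ℕ × ℝ)) τ)) a
    ∧ IsGoodRate (quadraticRate (alphaSq (μ : Measure (ℕ × ℝ)) τ)) := by
  -- Halving `r₀` puts `±β` inside the open interval of the moment bound, while `b` may be the right
  -- end of the closed interval for `s`.
  set β : ℝ := r₀ / 2 with hβdef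
  have hβ : 0 < β := by positivity
  set b : ℝ := τ + r with hbdef
  have hτb : τ < b := by linarith
  obtain ⟨C, hC0, hC⟩ : ∃ C, 0 ≤ C ∧ ∀ᶠ n in atTop,
      ∫⁻ w, ENNReal.ofReal (expWeight b β w) ∂(μn n : Measure (ℕ × ℝ)) ≤ ENNReal.ofReal C := by
    refine exists_expWeight_bound hlaw (m := fun n => tiltedMeanY (μn n) (τn n)) hβ.le
      (B := (⨆ n, ⨆ (_ : 1 ≤ n), ⨆ s ∈ Icc (τ - r) b, ⨆ v ∈ Ioo (-r₀) r₀,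
        ∫⁻ w, ENNReal.ofReal (Real.exp (s * coordX w
          + v * (coordY w - tiltedMeanY (μn n : Measure (ℕ × ℝ)) (τn n))))
          ∂(μn n : Measure (ℕ × ℝ))).toReal)
      ENNReal.toReal_nonneg τ ?_
    filter_upwards [eventually_ge_atTop 1] with n hn s hs v hv
    rw [ENNReal.ofReal_toReal hbound.ne]
    have hs' : s ∈ Icc (τ - r) (τ + r) := by
      rcases hs with rfl | hs
      · exact ⟨by linarith, by linarith⟩
      · rw [mem_singleton_iff.1 hs]; exact ⟨by linarith, by linarith⟩
    have hv' : v ∈ Ioo (-r₀) r₀ := by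
      rcases hv with rfl | hv
      · exact ⟨by linarith, by linarith⟩
      · rw [mem_singleton_iff.1 hv]; exact ⟨by linarith, by linarith⟩
    exact le_iSup₂_of_le n hn (le_iSup₂_of_le s hs' (le_iSup₂_of_le v hv' le_rfl))
  have hτn_lim : Tendsto τn atTop (𝓝 τ) := by
    refine tendsto_of_tendsto_psiX' hlaw hC0 hC hβ hconst hτb
      ((eventually_ge_atTop 1).mono hτn_mem) ?_
    rw [hτ]
    refine hpq_lim.congr' ?_
    filter_upwards [eventually_ge_atTop 1] with n hn
    exact (hτn n hn).symm
  have hN : Tendsto (fun n => n * qn n) atTop atTop :=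
    tendsto_atTop_mono' atTop ((eventually_ge_atTop 1).mono fun n hn =>
      Nat.le_mul_of_pos_right n (hqn n hn)) tendsto_id
  have hk : ∀ᶠ n in atTop, ((n * qn n : ℕ) : ℝ)
      * (∫ w, coordX w ∂(tilt₂ (μn n) (τn n) 0)) = (n * pn n : ℕ) := by
    filter_upwards [eventually_ge_atTop 1] with n hn
    rw [integral_coordX_tilt₂_eq_psiX' (hτn_mem n hn), hτn n hn]
    have : (qn n : ℝ) ≠ 0 := by exact_mod_cast (hqn n hn).ne'
    push_cast; field_simp
  have ha : ∀ᶠ n in atTop, 0 < a n := (eventually_ge_atTop 1).mono ha_pos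
  have hl := (eventually_ge_atTop 1).mono hW_law
  have hi := (eventually_ge_atTop 1).mono hW_indep
  have hZ : ∀ n, 1 ≤ n → AEMeasurable (fun ω => Real.sqrt (a n / ((n : ℝ) * qn n))
      * (sumY (W n) ω - (n : ℝ) * qn n * tiltedMeanY (μn n : Measure (ℕ × ℝ)) (τn n)))
      ((P n)[|{ω | sumX (W n) ω = n * pn n}]) := fun n hn =>
    (((aemeasurable_sumY (hW_law n hn)).sub_const _).const_mul _).mono_ac
      cond_absolutelyContinuous
  have hα : 0 ≤ alphaSq (μ : Measure (ℕ × ℝ)) τ := variance_nonneg _ _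
  refine ⟨satisfiesLDP_of_quadratic hα ?_ ha ha_lim ?_, isGoodRate_quadraticRate hα⟩
  · filter_upwards [eventually_ge_atTop 1] with n hn
    have := cond_isProbabilityMeasure (μ := P n) (hS n hn).ne'
    exact Measure.isProbabilityMeasure_map (hZ n hn)
  intro u ε hε
  -- Chosen so that `u Z / a_n = vn (T - N m)`; it tends to zero because `a_n N → ∞`, and `N vn² =
  -- u² / a_n`.
  set vn : ℕ → ℝ := fun n => u / √(a n * (n * qn n : ℕ)) with hvn
  have haN : Tendsto (fun n => a n * ((n * qn n : ℕ) : ℝ)) atTop atTop :=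
    ha_speed.congr fun n => by push_cast; ring
  have hvn_lim : Tendsto vn atTop (𝓝 0) :=
    tendsto_const_nhds.div_atTop (Real.tendsto_sqrt_atTop.comp haN)
  -- Half of `ε` absorbs the quadratic error `u² ε'`, the other half the factor `2` of the ratio
  -- bounds.
  set ε' : ℝ := ε / (2 * (u ^ 2 + 1)) with hε'
  have hε'0 : 0 < ε' := by positivity
  have huε : u ^ 2 * ε' ≤ ε / 2 := by
    rw [hε', mul_div_assoc', div_le_div_iff₀ (by positivity) two_pos]
    nlinarith [sq_nonneg u]
  filter_upwards [eventually_setIntegral_exp_ratio (k := fun n => n * pn n) hlaw hC0 hC hβ hspan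
    hconst hτb hτn_lim hvn_lim hN hk hl hi hε'0, eventually_ge_atTop 1,
    eventually_le_exp_div ha ha_lim (half_pos hε) 2] with n hratio hn h2
  have han := ha_pos n hn
  have hn0 : (0 : ℝ) < n := by exact_mod_cast hn
  have hq0 : (0 : ℝ) < qn n := by exact_mod_cast hqn n hn
  have hmean : ∫ w, coordY w ∂(tilt₂ (μn n : Measure (ℕ × ℝ)) (τn n) 0)
      = tiltedMeanY (μn n : Measure (ℕ × ℝ)) (τn n) := by rw [tiltedMeanY, tiltX_eq]
  rw [hmean] at hratio
  set m := tiltedMeanY (μn n : Measure (ℕ × ℝ)) (τn n)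
  set E : Set (Ω n) := {ω | sumX (W n) ω = n * pn n}
  have hpE : 0 < (P n).real E := ENNReal.toReal_pos (hS n hn).ne' (measure_ne_top _ _)
  have hNv : ((n * qn n : ℕ) : ℝ) * vn n ^ 2 = u ^ 2 / a n := by
    simp only [hvn]
    rw [div_pow, Real.sq_sqrt (by positivity)]
    push_cast; field_simp
  have hexponent : ∀ ω, u * (Real.sqrt (a n / ((n : ℝ) * qn n))
      * (sumY (W n) ω - (n : ℝ) * qn n * m)) / a n
      = vn n * (sumY (W n) ω - ((n * qn n : ℕ) : ℝ) * m) := by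
    intro ω
    have hsq : Real.sqrt (a n / ((n : ℝ) * qn n)) / a n = 1 / √(a n * ((n : ℝ) * qn n)) := by
      have hsa := Real.sqrt_pos.2 han
      have hsn := Real.sqrt_pos.2 (mul_pos hn0 hq0)
      rw [Real.sqrt_div han.le, Real.sqrt_mul han.le]
      field_simp
      exact Real.sq_sqrt han.le
    simp only [hvn]
    push_cast
    calc _ = u * (Real.sqrt (a n / ((n : ℝ) * qn n)) / a n)
          * (sumY (W n) ω - (n : ℝ) * qn n * m) := by ring
      _ = _ := by rw [hsq]; ring
  set I := ∫ ω in E, Real.exp (vn n * (sumY (W n) ω - ((n * qn n : ℕ) : ℝ) * m)) ∂(P n)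
  have hIpos : 0 < I := lt_of_lt_of_le (by positivity) hratio.1
  -- A Bochner integral is zero when the integrand is not integrable, so its positivity already
  -- gives integrability.
  have hIint : Integrable (fun ω => Real.exp (vn n * (sumY (W n) ω - ((n * qn n : ℕ) : ℝ) * m)))
      ((P n).restrict E) := by
    by_contra hcon
    exact hIpos.ne' (integral_undef hcon)
  have hM : ∫⁻ z, ENNReal.ofReal (Real.exp (u * z / a n))
      ∂(((P n)[|E]).map (fun ω => Real.sqrt (a n / ((n : ℝ) * qn n))
        * (sumY (W n) ω - (n : ℝ) * qn n * m))) = ENNReal.ofReal (I / (P n).real E) := by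
    rw [lintegral_map' (by fun_prop) (hZ n hn), ProbabilityTheory.cond, lintegral_smul_measure]
    change ((P n) E)⁻¹ • ∫⁻ ω in E, ENNReal.ofReal (Real.exp (u * (Real.sqrt (a n / ((n : ℝ) * qn n))
      * (sumY (W n) ω - (n : ℝ) * qn n * m)) / a n)) ∂(P n) = _
    simp_rw [hexponent]
    rw [← ofReal_integral_eq_lintegral_ofReal hIint (ae_of_all _ fun ω => (Real.exp_pos _).le),
      div_eq_inv_mul, ENNReal.ofReal_mul (inv_nonneg.2 hpE.le), ENNReal.ofReal_inv_of_pos hpE,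
      ofReal_measureReal, smul_eq_mul]
  rw [hM]
  rw [hNv] at hratio
  constructor
  · refine ENNReal.ofReal_le_ofReal ?_
    rw [le_div_iff₀ hpE]
    refine le_trans (mul_le_mul_of_nonneg_right ?_ hpE.le) hratio.1
    rw [le_div_iff₀ two_pos]
    calc Real.exp ((alphaSq μ τ * u ^ 2 / 2 - ε) / a n) * 2
        ≤ Real.exp ((alphaSq μ τ * u ^ 2 / 2 - ε) / a n) * Real.exp (ε / 2 / a n) := by gcongr
      _ = Real.exp ((alphaSq μ τ * u ^ 2 / 2 - ε / 2) / a n) := by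
          rw [← Real.exp_add]; congr 1; ring
      _ ≤ Real.exp (u ^ 2 / a n * (alphaSq μ τ / 2 - ε')) := by
          refine Real.exp_le_exp.2 ?_
          rw [div_mul_eq_mul_div]
          exact div_le_div_of_nonneg_right (by linarith) han.le
  · refine ENNReal.ofReal_le_ofReal ?_
    rw [div_le_iff₀ hpE]
    refine hratio.2.trans (mul_le_mul_of_nonneg_right ?_ hpE.le)
    calc 2 * Real.exp (u ^ 2 / a n * (alphaSq μ τ / 2 + ε'))
        ≤ Real.exp (ε / 2 / a n) * Real.exp ((alphaSq μ τ * u ^ 2 / 2 + ε / 2) / a n) := by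
          refine mul_le_mul h2 (Real.exp_le_exp.2 ?_) (Real.exp_pos _).le (Real.exp_pos _).le
          rw [div_mul_eq_mul_div]
          exact div_le_div_of_nonneg_right (by linarith) han.le
      _ = Real.exp ((alphaSq μ τ * u ^ 2 / 2 + ε) / a n) := by
          rw [← Real.exp_add]; congr 1; ring
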